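/- **Setting.** Let $d\in\{2,3\}$, and let $\widehat T\subset\mathbb R^d$ be the open unit simplex or the open unit hypercube. Let $\Omega\subset\mathbb R^d$ be a polygonal/polyhedral open set, and let $\mathcal T_1,\dots,\mathcal T_K$ be partitions of $\Omega$: finite families of pairwise disjoint elements $T=\mathsf F_T(\widehat T)$, with $\mathsf F_T$ an invertible affine map, such that $\Omega$ is the interior of the union of the closed elements. For $k\ge 2$, $\mathcal T_k$ is obtained from $\mathcal T_{k-1}$ by uniform (red) refinement: each triangle or parallelogram is split into four congruent ones and each parallelepiped into eight congruent ones; each tetrahedron is split, through the midpoints of its edges, into four corner tetrahedra and four tetrahedra obtained by cutting the remaining octahedron along one of its diagonals. Write $h_T$ for the diameter of $T$. Assume that $\mathcal T_K$ is shape-regular (each $T\in\mathcal T_K$ contains a ball of radius $r_T>0$ with $h_T\le\kappa_1 r_T$) and quasi-uniform ($h_T\le\kappa_2 h_{T'}$ for all $T,T'\in\mathcal T_K$). Let $p_1,\dots,p_K\geq 1$ be integers with $p_{k-1}\le p_k\le c\,p_{k-1}$, and let $$V_k=\{v\in L^2(\Omega): v\circ\mathsf F_T\in\mathbb M^{p_k}(\widehat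 T)\ \ \forall T\in\mathcal T_k\},$$ where $\mathbb M^{p}(\widehat T)$ is the space of polynomials of total degree at most $p$ if $\widehat T$ is the simplex, and of degree at most $p$ in each variable if $\widehat T$ is the hypercube. An interior face of $\mathcal T_k$ is the intersection of the closures of two different elements, and a boundary face is the intersection of a facet of an element with $\partial\Omega$, in both cases of positive $(d-1)$-dimensional measure; let $\mathcal F_k$ be the set of all faces and $\mathcal F_k^I$ that of the interior ones. On an interior face between $T^+$ and $T^-$, with outward unit normals $\mathbf n^\pm$, put $[\![v]\!]=v^+\mathbf n^++v^-\mathbf n^-$, $[\![\boldsymbol\eta]\!]=\boldsymbol\eta^+\cdot\mathbf n^++\boldsymbol\eta^-\cdot\mathbf n^-$ and $\{\boldsymbol\eta\}=\tfrac12(\boldsymbol\eta^++\boldsymbol\eta^-)$; on a boundary face of $T$ put $[\![v]\!]=v\,\mathbf n_T$ and $\{\boldsymbol\eta\}=\boldsymbol\eta$. The liftings $r_F(\boldsymbol\tau)\in[V_k]^d$ ($F\in\mathcal F_k$) and $l_F(q)\in[V_k]^d$ ($F\in\mathcal F_k^I$) are defined by $$\int_\Omega r_F(\boldsymbol\tau)\cdot\boldsymbol\eta\,dx=-\int_F\boldsymbol\tau\cdot\{\boldsymbol\eta\}\,ds,\qquad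 \int_\Omega l_F(q)\cdot\boldsymbol\eta\,dx=-\int_F q\,[\![\boldsymbol\eta]\!]\,ds\qquad\forall\boldsymbol\eta\in[V_k]^d .$$ Put $\mathcal R_k(\boldsymbol\tau)=\sum_{F\in\mathcal F_k}r_F(\boldsymbol\tau)$, $\mathcal L_k(q)=\sum_{F\in\mathcal F_k^I}l_F(q)$ and $\boldsymbol\Lambda_k(v)=\mathcal R_k([\![v]\!])+\mathcal L_k(\boldsymbol\beta_k\cdot[\![v]\!])$, and for $w,v\in V_k$ $$\mathcal A_k(w,v)=\sum_{T\in\mathcal T_k}\int_T\big(\nabla w\cdot\nabla v+\nabla w\cdot\boldsymbol\Lambda_k(v)+\boldsymbol\Lambda_k(w)\cdot\nabla v\big)dx+\sum_{F\in\mathcal F_k}\int_F\sigma_k[\![w]\!]\cdot[\![v]\!]\,ds+\theta\int_\Omega\boldsymbol\Lambda_k(w)\cdot\boldsymbol\Lambda_k(v)\,dx,$$ where $\sigma_k|_F=\alpha_kp_k^2/\min(h_{T^+},h_{T^-})$ on interior faces, $\sigma_k|_F=\alpha_kp_k^2/h_T$ on boundary faces, and $0<\alpha_{\min}\le\alpha_k\le\alpha_{\max}$.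 The method is one of the following: SIPG ($\theta=0$, $\boldsymbol\beta_k=0$); SIPG($\delta$) ($\theta=0$, $\boldsymbol\beta_k|_F=(\delta_F-\tfrac12)\mathbf n_F$ on each interior face, with $\delta_F\in[0,1]$ and $\mathbf n_F$ the normal pointing out of one of the two adjacent elements); LDG ($\theta=1$, $|\boldsymbol\beta_k|_F|\le B$ on each interior face). The energy norm on $V_k$ is $|||v|||_{1,k}=\sqrt{\mathcal A_k(v,v)}$. **Lemma 4.4.** There is a constant $\alpha_0>0$, depending only on $d$, $\widehat T$, the method, $\kappa_1$, $\kappa_2$, $B$, such that the following holds for every $\alpha_{\min}>0$, where for SIPG and SIPG($\delta$) it is also assumed that $\alpha_{\min}\ge\alpha_0$. There is a constant $C_{\mathsf{stab}}>0$, depending only on these data and on $\alpha_{\min},\alpha_{\max},c$ (in particular not on the mesh sizes, the polynomial degrees, $k$ or $K$), such that for all $\Omega$, $K$, $\mathcal T_k$, $p_k$, $\alpha_k$, $\boldsymbol\beta_k$ as above: * $\mathcal A_k(v,v)>0$ for all $0\neq v\in V_k$, $1\le k\le K$ (so the energy norms are well defined); * for $2\le k\le K$ one has $V_{k-1}\subseteq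 V_k$, and with $R_{k-1}^k:V_{k-1}\to V_k$ the inclusion there is exactly one linear operator $P_k^{k-1}:V_k\to V_{k-1}$ with $\mathcal A_{k-1}(P_k^{k-1}v,w)=\mathcal A_k(v,R_{k-1}^kw)$ for all $v\in V_k$, $w\in V_{k-1}$; moreover $$|||R_{k-1}^kv|||_{1,k}\le C_{\mathsf{stab}}|||v|||_{1,k-1}\quad\forall v\in V_{k-1},\qquad |||P_k^{k-1}v|||_{1,k-1}\le C_{\mathsf{stab}}|||v|||_{1,k}\quad\forall v\in V_k.$$ -/

import Mathlib

open MeasureTheory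
open scoped RealInnerProductSpace

noncomputable section

namespace HPDG

/-- Euclidean space `ℝᵈ`. -/
abbrev E (d : ℕ) : Type := EuclideanSpace ℝ (Fin d)

/-! ### Elements and meshes -/

/-- The two kinds of reference element. -/
inductive Shape
  | simplex
  | cube

/-- The reference element: the open unit simplex or the open unit hypercube. -/
def refElement (d : ℕ) : Shape → Set (E d)
  | .simplex => {x | (∀ i, 0 < x i) ∧ ∑ i, x i < 1}
  | .cube => {x | ∀ i, 0 < x i ∧ x i < 1}

/-- An element is given by its (invertible, affine) element map `F_T`. -/
abbrev Cell (d : ℕ) : Type := E d ≃ᵃ[ℝ] E d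

/-- The (open) element `T = F_T(T̂)`. -/
def cell {d : ℕ} (s : Shape) (T : Cell d) : Set (E d) := T '' refElement d s

/-- `𝒯` is a partition of `Ω` into elements: the elements are pairwise disjoint, and `Ω` is the
interior of the union of the closed elements (so that `Ω` is a bounded polygonal/polyhedral open
set lying on one side of its boundary). -/
structure IsPartition {d : ℕ} (s : Shape) (Ω : Set (E d)) (𝒯 : Finset (Cell d)) : Prop where
  disjoint : ∀ T ∈ 𝒯, ∀ T' ∈ 𝒯, T ≠ T' → Disjoint (cell s T) (cell s T')
  cover : Ω = interior (⋃ T ∈ 𝒯, closure (cell s T))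

/-- Shape regularity: each element contains a ball of radius `r > 0` with `h_T ≤ κ r`. -/
def IsShapeRegular {d : ℕ} (s : Shape) (κ : ℝ) (𝒯 : Finset (Cell d)) : Prop :=
  ∀ T ∈ 𝒯, ∃ (x : E d) (r : ℝ), 0 < r ∧ Metric.ball x r ⊆ cell s T ∧
    Metric.diam (cell s T) ≤ κ * r

/-- Quasi-uniformity: the diameters of any two elements are comparable. -/
def IsQuasiUniform {d : ℕ} (s : Shape) (κ : ℝ) (𝒯 : Finset (Cell d)) : Prop :=
  ∀ T ∈ 𝒯, ∀ T' ∈ 𝒯, Metric.diam (cell s T) ≤ κ * Metric.diam (cell s T')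

/-- The vertices `0, e₁, …, e_d` of the reference simplex. -/
def refVertex (d : ℕ) : Fin (d + 1) → E d :=
  Fin.cons 0 (fun i => EuclideanSpace.single i 1)

/-- Uniform (red) refinement of a triangle into four triangles and of a tetrahedron into eight
tetrahedra. Each entry describes a child: its `j`-th vertex is the midpoint of the vertices
`(c j).1` and `(c j).2` of the parent. For the tetrahedron, the first four children are the ones
at the corners, the last four split the remaining octahedron along the diagonal that joins the
midpoints of the edges `02` and `13`. -/
def redChildren : (d : ℕ) → List (Fin (d + 1) → Fin (d + 1) × Fin (d + 1))
  | 2 => [![(0, 0), (0, 1), (0, 2)],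
          ![(0, 1), (1, 1), (1, 2)],
          ![(0, 2), (1, 2), (2, 2)],
          ![(0, 1), (1, 2), (0, 2)]]
  | 3 => [![(0, 0), (0, 1), (0, 2), (0, 3)],
          ![(0, 1), (1, 1), (1, 2), (1, 3)],
          ![(0, 2), (1, 2), (2, 2), (2, 3)],
          ![(0, 3), (1, 3), (2, 3), (3, 3)],
          ![(0, 1), (0, 2), (0, 3), (1, 3)],
          ![(0, 1), (0, 2), (1, 2), (1, 3)],
          ![(0, 2), (0, 3), (1, 3), (2, 3)],
          ![(0, 2), (1, 2), (1, 3), (2, 3)]]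
  | _ => []

/-- `T'` is one of the children of `T` under uniform refinement. For simplices, `π` is the
numbering of the vertices of `T` that is used; for `d = 2` it does not affect the set of children,
for `d = 3` it selects the diagonal of the inner octahedron. Parallelograms/parallelepipeds are
split into `2 ^ d` congruent ones. -/
def IsChild {d : ℕ} (s : Shape) (π : Equiv.Perm (Fin (d + 1))) (T T' : Cell d) : Prop :=
  match s with
  | .simplex => ∃ c ∈ redChildren d, ∀ j,
      T' (refVertex d j) =
        midpoint ℝ (T (refVertex d (π (c j).1))) (T (refVertex d (π (c j).2)))
  | .cube => ∃ ε : Finset (Fin d), ∀ x,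
      T' x = T ((1 / 2 : ℝ) • (x + ∑ i ∈ ε, EuclideanSpace.single i 1))

/-- `𝒯'` is a uniform refinement of `𝒯`: its elements are exactly the children of those of `𝒯`. -/
def IsRefinement {d : ℕ} (s : Shape) (𝒯 𝒯' : Finset (Cell d)) : Prop :=
  ∃ π : Cell d → Equiv.Perm (Fin (d + 1)),
    ∀ T', T' ∈ 𝒯' ↔ ∃ T ∈ 𝒯, IsChild s (π T) T T'

/-! ### Faces -/

/-- The closed facets of the reference element. -/
def refFacets (d : ℕ) : Shape → Set (Set (E d))
  | .simplex => Set.range (fun i : Fin d => closure (refElement d .simplex) ∩ {x | x i = 0}) ∪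
      {closure (refElement d .simplex) ∩ {x | ∑ i, x i = 1}}
  | .cube => Set.range (fun i : Fin d => closure (refElement d .cube) ∩ {x | x i = 0}) ∪
      Set.range (fun i : Fin d => closure (refElement d .cube) ∩ {x | x i = 1})

theorem refFacets_finite (d : ℕ) (s : Shape) : (refFacets d s).Finite := by
  cases s
  · exact (Set.finite_range _).union (Set.finite_singleton _)
  · exact (Set.finite_range _).union (Set.finite_range _)

/-- Surface measure (`(d-1)`-dimensional Hausdorff measure, normalised as Lebesgue measure on
hyperplanes). -/
def surface (d : ℕ) : Measure (E d) := Measure.euclideanHausdorffMeasure (d - 1)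

/-- A face, together with the elements adjacent to it: two for an interior face, one for a
boundary face. -/
structure Face (d : ℕ) where
  cells : Finset (Cell d)
  carrier : Set (E d)

open Classical in
/-- Interior faces: the intersections of the closures of two neighbouring elements. -/
def interiorFaces {d : ℕ} (s : Shape) (𝒯 : Finset (Cell d)) : Finset (Face d) :=
  ((𝒯.powersetCard 2).image
    (fun c => (⟨c, ⋂ T ∈ c, closure (cell s T)⟩ : Face d))).filter
      (fun f => 0 < surface d f.carrier)

open Classical in
/-- Boundary faces: the parts of the facets of the elements that lie on `∂Ω`. -/
def boundaryFaces {d : ℕ} (s : Shape) (Ω : Set (E d)) (𝒯 : Finset (Cell d)) :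
    Finset (Face d) :=
  ((𝒯 ×ˢ (refFacets_finite d s).toFinset).image
    (fun a => (⟨{a.1}, a.1 '' a.2 ∩ frontier Ω⟩ : Face d))).filter
      (fun f => 0 < surface d f.carrier)

open Classical in
/-- All faces. -/
def faces {d : ℕ} (s : Shape) (Ω : Set (E d)) (𝒯 : Finset (Cell d)) : Finset (Face d) :=
  interiorFaces s 𝒯 ∪ boundaryFaces s Ω 𝒯

/-- The outward unit normal of the element `T` on the face `f`, i.e. the unit vector `n` such that
`T` lies in the half-space `⟪n, y - x⟫ ≤ 0` for every `x` in the face. (It exists, and since the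
face has positive surface measure it is unique, for each face `f` of `T`.) -/
def normal {d : ℕ} (s : Shape) (T : Cell d) (f : Face d) : E d :=
  Classical.epsilon (fun n : E d =>
    ‖n‖ = 1 ∧ ∀ x ∈ f.carrier, ∀ y ∈ cell s T, ⟪n, y - x⟫ ≤ 0)

/-! ### Discontinuous Galerkin spaces and forms -/

/-- `𝕄ᵖ(T̂)`: polynomials of total degree at most `p` on the simplex, and of degree at most `p` in
each variable on the hypercube. -/
def refPoly (d : ℕ) : Shape → ℕ → Submodule ℝ (MvPolynomial (Fin d) ℝ)
  | .simplex, p => MvPolynomial.restrictTotalDegree (Fin d) ℝ p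
  | .cube, p => MvPolynomial.restrictDegree (Fin d) ℝ p

/-- The data of one level of a DG method on `Ω`: the shape of the elements, the mesh, the degree,
the penalty parameter `α`, the parameter `θ`, and the vectors `β` on the interior faces. -/
structure Level (d : ℕ) (Ω : Set (E d)) where
  shape : Shape
  mesh : Finset (Cell d)
  degree : ℕ
  α : ℝ
  θ : ℝ
  β : Face d → E d

namespace Level

variable {d : ℕ} {Ω : Set (E d)} (D : Level d Ω)

/-- The function `P ∘ F_T⁻¹` for a polynomial `P` on the reference element. -/
def pushPoly (T : Cell d) (P : MvPolynomial (Fin d) ℝ) (x : E d) : ℝ :=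
  MvPolynomial.eval (fun i => T.symm x i) P

theorem pushPoly_add (T : Cell d) (P Q : MvPolynomial (Fin d) ℝ) (x : E d) :
    pushPoly T (P + Q) x = pushPoly T P x + pushPoly T Q x := by
  simp [pushPoly]

theorem pushPoly_smul (T : Cell d) (a : ℝ) (P : MvPolynomial (Fin d) ℝ) (x : E d) :
    pushPoly T (a • P) x = a * pushPoly T P x := by
  simp [pushPoly, MvPolynomial.smul_eval]

/-- The space `V = {v ∈ L²(Ω) : v ∘ F_T ∈ 𝕄ᵖ(T̂) for all T ∈ 𝒯}`. -/
def V : Submodule ℝ (Lp ℝ 2 (volume.restrict Ω)) where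
  carrier := {v | ∀ T ∈ D.mesh, ∃ P ∈ refPoly d D.shape D.degree,
    ∀ᵐ x ∂(volume.restrict Ω), x ∈ cell D.shape T → v x = pushPoly T P x}
  zero_mem' := fun T _ => ⟨0, Submodule.zero_mem _, by
    filter_upwards [Lp.coeFn_zero ℝ 2 (volume.restrict Ω)] with x hx _
    exact hx.trans (by simp [pushPoly])⟩
  add_mem' := by
    intro v w hv hw T hT
    obtain ⟨P, hP, hvP⟩ := hv T hT
    obtain ⟨Q, hQ, hwQ⟩ := hw T hT
    refine ⟨P + Q, Submodule.add_mem _ hP hQ, ?_⟩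
    filter_upwards [hvP, hwQ, Lp.coeFn_add v w] with x h1 h2 h3 hx
    rw [h3, Pi.add_apply, h1 hx, h2 hx, pushPoly_add]
  smul_mem' := by
    intro a v hv T hT
    obtain ⟨P, hP, hvP⟩ := hv T hT
    refine ⟨a • P, Submodule.smul_mem _ a hP, ?_⟩
    filter_upwards [hvP, Lp.coeFn_smul a v] with x h1 h3 hx
    rw [h3, Pi.smul_apply, h1 hx, pushPoly_smul, smul_eq_mul]

open Classical in
/-- `v|_T`, as the polynomial function on `ℝᵈ` that agrees with `v` almost everywhere on `T`. Its
values on `∂T` are the traces of `v` taken from within `T`. -/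
def on (v : D.V) (T : Cell d) : E d → ℝ :=
  if h : T ∈ D.mesh then pushPoly T (v.2 T h).choose else 0

/-- The jump `⟦v⟧ = v⁺ n⁺ + v⁻ n⁻` on an interior face, `⟦v⟧ = v n` on a boundary face. -/
def jump (v : D.V) (f : Face d) (x : E d) : E d :=
  ∑ T ∈ f.cells, D.on v T x • normal D.shape T f

/-- The restriction to `T` of a vector-valued function `η ∈ [V]ᵈ`. -/
def vecOn (η : Fin d → D.V) (T : Cell d) (x : E d) : E d :=
  WithLp.toLp 2 (fun i => D.on (η i) T x)

/-- The jump `⟦η⟧ = η⁺ · n⁺ + η⁻ · n⁻` of a vector-valued function on an interior face. -/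
def vecJump (η : Fin d → D.V) (f : Face d) (x : E d) : ℝ :=
  ∑ T ∈ f.cells, ⟪D.vecOn η T x, normal D.shape T f⟫

/-- The average `{η} = (η⁺ + η⁻) / 2` on an interior face, `{η} = η` on a boundary face. -/
def vecAvg (η : Fin d → D.V) (f : Face d) (x : E d) : E d :=
  (f.cells.card : ℝ)⁻¹ • ∑ T ∈ f.cells, D.vecOn η T x

/-- The local lifting `r_F(τ) ∈ [V]ᵈ`: `∫_Ω r_F(τ) · η = - ∫_F τ · {η}` for all `η ∈ [V]ᵈ`. -/
def liftR (f : Face d) (τ : E d → E d) : Fin d → D.V :=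
  Classical.epsilon (fun r : Fin d → D.V => ∀ η : Fin d → D.V,
    ∫ x in Ω, ∑ i, (r i).1 x * (η i).1 x =
      -∫ x in f.carrier, ⟪τ x, D.vecAvg η f x⟫ ∂(surface d))

/-- The local lifting `l_F(q) ∈ [V]ᵈ`: `∫_Ω l_F(q) · η = - ∫_F q ⟦η⟧` for all `η ∈ [V]ᵈ`. -/
def liftL (f : Face d) (q : E d → ℝ) : Fin d → D.V :=
  Classical.epsilon (fun r : Fin d → D.V => ∀ η : Fin d → D.V,
    ∫ x in Ω, ∑ i, (r i).1 x * (η i).1 x =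
      -∫ x in f.carrier, q x * D.vecJump η f x ∂(surface d))

/-- `ℛ(⟦v⟧) + ℒ(β · ⟦v⟧)`, where `ℛ` is the sum of the `r_F` over all faces and `ℒ` is the sum of
the `l_F` over the interior faces. -/
def lift (v : D.V) : Fin d → D.V :=
  (∑ f ∈ faces D.shape Ω D.mesh, D.liftR f (D.jump v f)) +
    (∑ f ∈ interiorFaces D.shape D.mesh, D.liftL f (fun x => ⟪D.β f, D.jump v f x⟫))

/-- `ℛ(⟦v⟧) + ℒ(β · ⟦v⟧)` as a vector field. -/
def liftFn (v : D.V) (x : E d) : E d :=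
  WithLp.toLp 2 (fun i => (D.lift v i).1 x)

/-- The penalty `σ|_F = α p² / min(h_{T⁺}, h_{T⁻})`, resp. `α p² / h_T` on the boundary. -/
def σ (f : Face d) : ℝ :=
  D.α * (D.degree : ℝ) ^ 2 / ⨅ T : {T // T ∈ f.cells}, Metric.diam (cell D.shape T.1)

/-- The DG bilinear form `𝒜(w, v)`. -/
def form (w v : D.V) : ℝ :=
  (∑ T ∈ D.mesh, (∫ x in cell D.shape T, ⟪gradient (D.on w T) x, gradient (D.on v T) x⟫)) +
  (∑ T ∈ D.mesh, (∫ x in cell D.shape T, ⟪gradient (D.on w T) x, D.liftFn v x⟫)) +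
  (∑ T ∈ D.mesh, (∫ x in cell D.shape T, ⟪D.liftFn w x, gradient (D.on v T) x⟫)) +
  (∑ f ∈ faces D.shape Ω D.mesh,
    (∫ x in f.carrier, D.σ f * ⟪D.jump w f x, D.jump v f x⟫ ∂(surface d))) +
  D.θ * (∫ x in Ω, ⟪D.liftFn w x, D.liftFn v x⟫)

/-- The energy norm `|||v|||₁ = √(A v, v) = √𝒜(v, v)`. -/
def energyNorm (v : D.V) : ℝ := Real.sqrt (D.form v v)

end Level

/-! ### The methods -/

/-- The symmetric interior penalty method, its version with weighted averages, and the local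
discontinuous Galerkin method. -/
inductive Method
  | sipg
  | sipgDelta
  | ldg

/-- `θ = 0` for SIPG and SIPG(δ), and `θ = 1` for LDG. -/
def Method.θ : Method → ℝ
  | .sipg => 0
  | .sipgDelta => 0
  | .ldg => 1

/-- The vectors `β` of the method: `β = 0` for SIPG; `β = (δ - 1/2) n_F` with a weight
`δ ∈ [0,1]`, where `n_F` is the normal to the face pointing out of one of the two elements
adjacent to it, for SIPG(δ); a bounded `β` for LDG. -/
def Method.IsBeta {d : ℕ} (m : Method) (B : ℝ) (s : Shape) (𝒯 : Finset (Cell d))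
    (β : Face d → E d) : Prop :=
  match m with
  | .sipg => ∀ f ∈ interiorFaces s 𝒯, β f = 0
  | .sipgDelta => ∀ f ∈ interiorFaces s 𝒯, ∃ T ∈ f.cells, ∃ δ : ℝ, 0 ≤ δ ∧ δ ≤ 1 ∧
      β f = (δ - 1 / 2) • normal s T f
  | .ldg => ∀ f ∈ interiorFaces s 𝒯, ‖β f‖ ≤ B

end HPDG

end

/-!
A trace inverse inequality for polynomials on a shape-regular element, with the sharp factor
`p² / h`, bounds the lifting `Λ(v)` in `L²` by the penalty seminorm of `v`, with a constant that
depends only on the shape of the elements and on the number of faces of an element. Hence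
`𝒜(v, v)` is equivalent to `|v|²_DG = ∑ ‖∇v‖² + ∑ σ ‖⟦v⟧‖²`: for `θ = 1` by Young's inequality,
for `θ = 0` once the penalty parameter dominates the lifting constant.

A coarse function has jumps only across the fine faces that lie in coarse faces; on those the
penalty weights of the two levels are comparable, and each coarse face contains boundedly many fine
ones. So the inclusion is bounded in the DG norms, therefore in the energy norms. The operator `P`
is the adjoint of the inclusion with respect to the two energy inner products, so it obeys the same
bound by the Cauchy–Schwarz inequality.
-/

noncomputable section

namespace HPDG

/-! ### Endpoint values of univariate polynomials -/

section Univariate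

open Polynomial Real

theorem integral_cos_int_mul (k : ℤ) : ∫ θ in 0..π, cos (k * θ) = if k = 0 then π else 0 := by
  split_ifs with hk
  · simp [hk]
  · rw [intervalIntegral.integral_comp_mul_left cos (Int.cast_ne_zero.2 hk)]
    simp [sin_int_mul_pi]

theorem integral_sin_mul_sin (i j : ℕ) :
    ∫ θ in 0..π, sin ((i + 1) * θ) * sin ((j + 1) * θ) = if i = j then π / 2 else 0 := by
  have product_to_sum : ∀ θ : ℝ, sin ((i + 1) * θ) * sin ((j + 1) * θ) =
      1 / 2 * cos ((i - j : ℤ) * θ) - 1 / 2 * cos ((i + j + 2 : ℤ) * θ) := by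
    intro θ
    rw [show ((i - j : ℤ) : ℝ) * θ = (i + 1) * θ - (j + 1) * θ by push_cast; ring,
      show ((i + j + 2 : ℤ) : ℝ) * θ = (i + 1) * θ + (j + 1) * θ by push_cast; ring,
      cos_sub, cos_add]
    ring
  simp_rw [product_to_sum]
  rw [intervalIntegral.integral_sub (Continuous.intervalIntegrable (by fun_prop) _ _)
      (Continuous.intervalIntegrable (by fun_prop) _ _),
    intervalIntegral.integral_const_mul, intervalIntegral.integral_const_mul,
    integral_cos_int_mul, integral_cos_int_mul, if_neg (by omega : ¬(i : ℤ) + j + 2 = 0)]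
  rcases eq_or_ne i j with rfl | hij
  · simp only [sub_self, if_true]
    ring
  · simp [hij, sub_eq_zero]

/-- The Chebyshev polynomials of the second kind, as a sequence of polynomials of degrees
`0, 1, 2, …`. -/
def chebyshevU : Polynomial.Sequence ℝ where
  elems' n := Chebyshev.U ℝ n
  degree_eq' := Chebyshev.degree_U_natCast ℝ

theorem exists_eq_sum_chebyshevU {m : ℕ} {Q : ℝ[X]} (hQ : Q.natDegree ≤ m) :
    ∃ c : ℕ → ℝ, Q = ∑ k ∈ Finset.range (m + 1), c k • Chebyshev.U ℝ (k : ℤ) := by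
  have hmem : Q ∈ degreeLT ℝ (m + 1) :=
    mem_degreeLT.2 (degree_le_natDegree.trans_lt (by exact_mod_cast Nat.lt_succ_of_le hQ))
  rw [← chebyshevU.span_degreeLT
      (fun _ => by simp [chebyshevU, Chebyshev.leadingCoeff_U_natCast]),
    show Set.Iio (m + 1) = Finset.range (m + 1) by simp,
    Submodule.mem_span_image_finset_iff_exists_fun'] at hmem
  obtain ⟨c, hc⟩ := hmem
  exact ⟨c, hc.symm⟩

theorem integral_chebyshevU_mul_sin (k j : ℕ) :
    ∫ θ in 0..π, (Chebyshev.U ℝ (k : ℤ)).eval (cos θ) * sin θ * sin ((j + 1) * θ) =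
      if k = j then π / 2 else 0 := by
  simp_rw [← integral_sin_mul_sin, Chebyshev.U_real_cos, Int.cast_natCast]

theorem eval_one_eq_sum_integral {m : ℕ} {Q : ℝ[X]} (hQ : Q.natDegree ≤ m) :
    Q.eval 1 = ∑ j ∈ Finset.range (m + 1), (j + 1) * (2 / π *
      ∫ θ in 0..π, Q.eval (cos θ) * sin θ * sin ((j + 1) * θ)) := by
  obtain ⟨c, rfl⟩ := exists_eq_sum_chebyshevU hQ
  have coeff_eq : ∀ j ∈ Finset.range (m + 1), 2 / π * ∫ θ in 0..π,
      (∑ k ∈ Finset.range (m + 1), c k • Chebyshev.U ℝ (k : ℤ)).eval (cos θ) * sin θ *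
        sin ((j + 1) * θ) = c j := by
    intro j hj
    simp only [eval_finsetSum, eval_smul, smul_eq_mul, Finset.sum_mul, mul_assoc (c _)]
    rw [intervalIntegral.integral_finsetSum fun k _ =>
      Continuous.intervalIntegrable (by fun_prop) _ _]
    simp_rw [intervalIntegral.integral_const_mul, integral_chebyshevU_mul_sin, mul_ite, mul_zero]
    rw [Finset.sum_ite_eq' _ j, if_pos hj]
    field_simp
  rw [eval_finsetSum]
  refine Finset.sum_congr rfl fun j hj => ?_
  rw [coeff_eq j hj, eval_smul, Chebyshev.U_eval_one, smul_eq_mul, Int.cast_natCast, mul_comm]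

theorem integral_comp_cos_mul_sin {f : ℝ → ℝ} (hf : Continuous f) :
    ∫ θ in 0..π, f (cos θ) * sin θ = ∫ t in -1..1, f t := by
  have h := intervalIntegral.integral_comp_mul_deriv (a := 0) (b := π) (g := f)
    (fun x _ => hasDerivAt_cos x) (by fun_prop) hf
  simp only [Function.comp_apply, mul_neg, intervalIntegral.integral_neg, cos_zero, cos_pi] at h
  rw [intervalIntegral.integral_symm 1 (-1), ← h, neg_neg]

theorem eval_one_le_integral {m : ℕ} {Q : ℝ[X]} (hQ : Q.natDegree ≤ m)
    (hpos : ∀ t, 0 ≤ Q.eval t) :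
    Q.eval 1 ≤ (m + 1) ^ 2 * ∫ t in (-1 : ℝ)..1, Q.eval t := by
  set I := ∫ t in (-1 : ℝ)..1, Q.eval t with hI
  have hI0 : 0 ≤ I := intervalIntegral.integral_nonneg (by norm_num) fun t _ => hpos t
  have coeff_le : ∀ j : ℕ,
      ∫ θ in 0..π, Q.eval (cos θ) * sin θ * sin ((j + 1) * θ) ≤ I := by
    intro j
    rw [hI, ← integral_comp_cos_mul_sin Q.continuous]
    refine intervalIntegral.integral_mono_on pi_pos.le
      (Continuous.intervalIntegrable (by fun_prop) _ _)
      (Continuous.intervalIntegrable (by fun_prop) _ _) fun θ hθ => ?_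
    exact mul_le_of_le_one_right (mul_nonneg (hpos _) (sin_nonneg_of_mem_Icc hθ)) (sin_le_one _)
  calc Q.eval 1
      = ∑ j ∈ Finset.range (m + 1), (j + 1) * (2 / π *
          ∫ θ in 0..π, Q.eval (cos θ) * sin θ * sin ((j + 1) * θ)) :=
        eval_one_eq_sum_integral hQ
    _ ≤ ∑ j ∈ Finset.range (m + 1), (m + 1) * (1 * I) := by
        refine Finset.sum_le_sum fun j hj => ?_
        have hjm : (j : ℝ) ≤ m := by exact_mod_cast Finset.mem_range_succ_iff.1 hj
        have hπ : 2 / π ≤ 1 := (div_le_one pi_pos).2 two_le_pi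
        exact mul_le_mul_of_nonneg (by linarith)
          (mul_le_mul_of_nonneg hπ (coeff_le j) (by positivity) hI0) (by positivity)
          (by positivity)
    _ = (m + 1) ^ 2 * I := by
        rw [Finset.sum_const, Finset.card_range, nsmul_eq_mul]
        push_cast
        ring

theorem sq_eval_one_le_integral {n : ℕ} {q : ℝ[X]} (hq : q.natDegree ≤ n) :
    q.eval 1 ^ 2 ≤ 16 * (n + 1) ^ 2 * ∫ t in (1 / 2 : ℝ)..1, q.eval t ^ 2 := by
  -- `L` maps `[-1, 1]` onto `[1 / 2, 1]` and fixes `1`.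
  set L : ℝ[X] := C (1 / 4) * X + C (3 / 4) with hL
  have hdeg : ((q.comp L) ^ 2).natDegree ≤ 2 * n := by
    have : (q.comp L).natDegree ≤ n * 1 :=
      natDegree_comp_le.trans (Nat.mul_le_mul hq natDegree_linear_le)
    exact natDegree_pow_le.trans (by omega)
  have heval : ∀ t, ((q.comp L) ^ 2).eval t = q.eval (1 / 4 * t + 3 / 4) ^ 2 := by
    intro t; simp [hL]
  have h := eval_one_le_integral hdeg (fun t => by rw [heval]; positivity)
  simp_rw [heval] at h
  rw [intervalIntegral.integral_comp_mul_add (fun t => q.eval t ^ 2)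
    (by norm_num : (1 / 4 : ℝ) ≠ 0) (3 / 4)] at h
  norm_num at h
  have hI0 : 0 ≤ ∫ t in (1 / 2 : ℝ)..1, q.eval t ^ 2 :=
    intervalIntegral.integral_nonneg (by norm_num) fun t _ => by positivity
  norm_num at hI0 ⊢
  nlinarith [(Nat.cast_nonneg n : (0 : ℝ) ≤ n)]

end Univariate

/-! ### The trace inverse inequality -/

section Facet

variable {V : Type*} [NormedAddCommGroup V] [InnerProductSpace ℝ V] {T F : Set V} {n : V}

/-- `F` is a flat part of the boundary of `T` with outward unit normal `n`. -/
structure IsFacet (T F : Set V) (n : V) : Prop where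
  subset : F ⊆ closure T
  norm : ‖n‖ = 1
  inner_le : ∀ x ∈ F, ∀ y ∈ T, ⟪n, y - x⟫ ≤ 0

namespace IsFacet

theorem inner_le_closure (h : IsFacet T F n) {x y : V} (hx : x ∈ F) (hy : y ∈ closure T) :
    ⟪n, y - x⟫ ≤ 0 := by
  have hclosed : IsClosed {y : V | ⟪n, y - x⟫ ≤ 0} := isClosed_le (by fun_prop) continuous_const
  exact closure_minimal (h.inner_le x hx) hclosed hy

theorem inner_eq_zero (h : IsFacet T F n) {x y : V} (hx : x ∈ F) (hy : y ∈ F) :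
    ⟪n, y - x⟫ = 0 := by
  refine le_antisymm (h.inner_le_closure hx (h.subset hy)) ?_
  have := h.inner_le_closure hy (h.subset hx)
  rwa [← neg_sub, inner_neg_right, neg_nonpos] at this

theorem radius_le_inner (h : IsFacet T F n) {x z : V} {r : ℝ} (hr : 0 < r)
    (hball : Metric.ball x r ⊆ T) (hz : z ∈ F) : r ≤ ⟪n, z - x⟫ := by
  have hmem : x + r • n ∈ closure T := by
    refine closure_mono hball ?_
    rw [closure_ball x hr.ne', Metric.mem_closedBall, dist_self_add_left, norm_smul, h.norm,
      mul_one, Real.norm_of_nonneg hr.le]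
  have := h.inner_le_closure hz hmem
  rw [add_sub_right_comm, inner_add_right, inner_smul_right, real_inner_self_eq_norm_sq, h.norm,
    ← neg_sub, inner_neg_right] at this
  linarith

theorem inner_neg (h : IsFacet T F n) (hT : IsOpen T) {x y : V} (hx : x ∈ F) (hy : y ∈ T) :
    ⟪n, y - x⟫ < 0 := by
  obtain ⟨r, hr, hball⟩ := Metric.isOpen_iff.1 hT y hy
  have := h.radius_le_inner hr hball hx
  rw [← neg_sub, inner_neg_right] at this
  linarith

theorem exists_altitude (h : IsFacet T F n) {x : V} {r : ℝ} (hr : 0 < r)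
    (hball : Metric.ball x r ⊆ T) : ∃ v : V, r ≤ ‖v‖ ∧ ∀ z ∈ F, ⟪v, z - x⟫ = ‖v‖ ^ 2 := by
  rcases F.eq_empty_or_nonempty with rfl | ⟨z₀, hz₀⟩
  · exact ⟨r • n, by rw [norm_smul, h.norm, mul_one, Real.norm_of_nonneg hr.le], by simp⟩
  have hδ := h.radius_le_inner hr hball hz₀
  have hnorm : ‖⟪n, z₀ - x⟫ • n‖ = ⟪n, z₀ - x⟫ := by
    rw [norm_smul, h.norm, mul_one, Real.norm_of_nonneg (hr.le.trans hδ)]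
  refine ⟨⟪n, z₀ - x⟫ • n, by rwa [hnorm], fun z hz => ?_⟩
  rw [hnorm, inner_smul_left, ← sub_add_sub_cancel z z₀ x, inner_add_right,
    h.inner_eq_zero hz₀ hz, zero_add, sq]
  rfl

end IsFacet

end Facet

theorem surface_le_homothety_image {d : ℕ} (x₀ : E d) {t : ℝ} (ht : 1 / 2 ≤ t) (S : Set (E d)) :
    surface d S ≤ 2 ^ (d - 1) * surface d (AffineMap.homothety x₀ t '' S) := by
  have htwo : (1 : ENNReal) ≤ 2 * ‖t‖ₑ := by
    rw [Real.enorm_of_nonneg (by linarith), ← ENNReal.ofReal_ofNat 2,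
      ← ENNReal.ofReal_mul zero_le_two, ENNReal.one_le_ofReal]
    linarith
  rw [surface, euclideanHausdorffMeasure_homothety_image (d - 1) x₀ (by linarith) S,
    ENNReal.smul_def, smul_eq_mul, ENNReal.coe_pow, ← mul_assoc, ← mul_pow]
  exact le_mul_of_one_le_left' (one_le_pow₀ htwo)

theorem homothety_image_subset_slice {d : ℕ} {v x₀ : E d} {F : Set (E d)}
    (hF : ∀ z ∈ F, ⟪v, z - x₀⟫ = ‖v‖ ^ 2) (t : ℝ) :
    AffineMap.homothety x₀ t '' F ⊆ AffineSubspace.mk' (t • v +ᵥ x₀) (ℝ ∙ v)ᗮ := by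
  rintro _ ⟨z, hz, rfl⟩
  have hsub : AffineMap.homothety x₀ t z -ᵥ (t • v +ᵥ x₀) = t • (z - x₀ - v) := by
    simp only [AffineMap.homothety_apply, vsub_eq_sub, vadd_eq_add, smul_sub]
    abel
  rw [SetLike.mem_coe, AffineSubspace.mem_mk', hsub,
    Submodule.mem_orthogonal_singleton_iff_inner_right, inner_smul_right, inner_sub_right, hF z hz,
    real_inner_self_eq_norm_sq, sub_self, mul_zero]

/-- Cavalieri's principle for the slices orthogonal to the altitude `v`, each of which is a
homothetic copy, of ratio at least `1 / 2`, of a part of the base `F`. -/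
theorem lintegral_surface_slice_le {d : ℕ} {v x₀ : E d} (hv : v ≠ 0) {F A : Set (E d)}
    (hA : MeasurableSet A) (hF : ∀ z ∈ F, ⟪v, z - x₀⟫ = ‖v‖ ^ 2) :
    ∫⁻ t in Set.Ioc (1 / 2 : ℝ) 1, surface d {z ∈ F | x₀ + t • (z - x₀) ∈ A} ≤
      ENNReal.ofReal (2 ^ (d - 1) / ‖v‖) * volume A := by
  let slice (t : ℝ) : Set (E d) := A ∩ AffineSubspace.mk' (t • v +ᵥ x₀) (ℝ ∙ v)ᗮ
  have slice_le : ∀ t ∈ Set.Ioc (1 / 2 : ℝ) 1,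
      surface d {z ∈ F | x₀ + t • (z - x₀) ∈ A} ≤ 2 ^ (d - 1) * surface d (slice t) := by
    refine fun t ht => (surface_le_homothety_image x₀ ht.1.le _).trans ?_
    gcongr
    refine Set.subset_inter ?_ (homothety_image_subset_slice (fun z hz => hF z hz.1) t)
    rintro _ ⟨z, hz, rfl⟩
    simpa only [AffineMap.homothety_apply, vsub_eq_sub, vadd_eq_add, add_comm] using hz.2
  have cavalieri : volume A = ‖v‖ₑ * ∫⁻ t : ℝ, surface d (slice t) := by
    have := EuclideanGeometry.euclideanHausdorffMeasure_eq_lintegral x₀ hv hA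
    rwa [finrank_euclideanSpace_fin, EuclideanSpace.euclideanHausdorffMeasure_eq_volume] at this
  calc ∫⁻ t in Set.Ioc (1 / 2 : ℝ) 1, surface d {z ∈ F | x₀ + t • (z - x₀) ∈ A}
      ≤ ∫⁻ t in Set.Ioc (1 / 2 : ℝ) 1, 2 ^ (d - 1) * surface d (slice t) :=
        setLIntegral_mono' measurableSet_Ioc slice_le
    _ ≤ ∫⁻ t : ℝ, 2 ^ (d - 1) * surface d (slice t) := setLIntegral_le_lintegral _ _
    _ = 2 ^ (d - 1) * ∫⁻ t : ℝ, surface d (slice t) := lintegral_const_mul' _ _ (by simp)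
    _ = ENNReal.ofReal (2 ^ (d - 1) / ‖v‖) * volume A := by
        rw [cavalieri, ← ofReal_norm, ← mul_assoc, ← ENNReal.ofReal_mul (by positivity),
          div_mul_cancel₀ _ (norm_ne_zero_iff.2 hv), ENNReal.ofReal_pow zero_le_two,
          ENNReal.ofReal_ofNat]

section Trace

variable {d : ℕ} {T F : Set (E d)} {n x₀ : E d} {r : ℝ}

theorem IsFacet.surface_lt_top (h : IsFacet T F n) (hT : Convex ℝ T) (hTb : Bornology.IsBounded T)
    (hr : 0 < r) (hball : Metric.ball x₀ r ⊆ T) : surface d F < ⊤ := by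
  obtain ⟨v, hrv, hv⟩ := h.exists_altitude hr hball
  have hx₀ : x₀ ∈ closure T := subset_closure (hball (Metric.mem_ball_self hr))
  have cone : ∀ t ∈ Set.Ioc (1 / 2 : ℝ) 1, {z ∈ F | x₀ + t • (z - x₀) ∈ closure T} = F :=
    fun t ht => Set.sep_eq_self_iff_mem_true.2 fun z hz =>
      hT.closure.add_smul_sub_mem hx₀ (h.subset hz) ⟨by linarith [ht.1], ht.2⟩
  have hle := lintegral_surface_slice_le (norm_pos_iff.1 (hr.trans_le hrv))
    (isClosed_closure (s := T)).measurableSet hv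
  rw [setLIntegral_congr_fun measurableSet_Ioc fun t ht => by rw [cone t ht], setLIntegral_const,
    Real.volume_Ioc] at hle
  have hlt := hle.trans_lt (ENNReal.mul_lt_top ENNReal.ofReal_lt_top hTb.closure.measure_lt_top)
  exact (ENNReal.lt_top_of_mul_ne_top_left hlt.ne (by norm_num))

theorem IsFacet.map_prod_le (h : IsFacet T F n) (hT : Convex ℝ T) (hTb : Bornology.IsBounded T)
    (hr : 0 < r) (hball : Metric.ball x₀ r ⊆ T) :
    (((surface d).restrict F).prod (volume.restrict (Set.Ioc (1 / 2 : ℝ) 1))).map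
        (fun p => x₀ + p.2 • (p.1 - x₀)) ≤
      ENNReal.ofReal (2 ^ (d - 1) / r) • volume.restrict T := by
  obtain ⟨v, hrv, hv⟩ := h.exists_altitude hr hball
  have hx₀ : x₀ ∈ closure T := subset_closure (hball (Metric.mem_ball_self hr))
  have : IsFiniteMeasure ((surface d).restrict F) :=
    ⟨by simpa using h.surface_lt_top hT hTb hr hball⟩
  have hΦ : Measurable fun p : E d × ℝ => x₀ + p.2 • (p.1 - x₀) := by fun_prop
  refine Measure.le_iff.2 fun A hA => ?_
  have section_eq : ∀ t ∈ Set.Ioc (1 / 2 : ℝ) 1,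
      (surface d).restrict F ((·, t) ⁻¹' ((fun p => x₀ + p.2 • (p.1 - x₀)) ⁻¹' A)) =
        surface d {z ∈ F | x₀ + t • (z - x₀) ∈ A ∩ closure T} := by
    intro t ht
    rw [Measure.restrict_apply (measurable_prodMk_right (hΦ hA))]
    congr 1
    ext z
    exact ⟨fun hz => ⟨hz.2, hz.1, hT.closure.add_smul_sub_mem hx₀ (h.subset hz.2)
      ⟨by linarith [ht.1], ht.2⟩⟩, fun hz => ⟨hz.2.1, hz.1⟩⟩
  have hclosure : volume (A ∩ closure T) = volume.restrict T A := by
    rw [Measure.restrict_apply hA]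
    exact measure_congr (Filter.EventuallyEq.rfl.inter
      (closure_ae_eq_of_null_frontier (hT.addHaar_frontier volume)))
  rw [Measure.map_apply hΦ hA, Measure.prod_apply_symm (hΦ hA),
    setLIntegral_congr_fun measurableSet_Ioc section_eq, Measure.smul_apply, smul_eq_mul,
    ← hclosure]
  refine (lintegral_surface_slice_le (norm_pos_iff.1 (hr.trans_le hrv))
    (hA.inter isClosed_closure.measurableSet) hv).trans ?_
  gcongr

theorem IsFacet.lintegral_le (h : IsFacet T F n) (hT : Convex ℝ T) (hTb : Bornology.IsBounded T)
    (hr : 0 < r) (hball : Metric.ball x₀ r ⊆ T) {g : E d → ENNReal} (hg : Measurable g) :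
    ∫⁻ z in F, (∫⁻ t in Set.Ioc (1 / 2 : ℝ) 1, g (x₀ + t • (z - x₀))) ∂(surface d) ≤
      ENNReal.ofReal (2 ^ (d - 1) / r) * ∫⁻ x in T, g x := by
  have hΦ : Measurable fun p : E d × ℝ => x₀ + p.2 • (p.1 - x₀) := by fun_prop
  calc _ = ∫⁻ p, g (x₀ + p.2 • (p.1 - x₀))
          ∂(((surface d).restrict F).prod (volume.restrict (Set.Ioc (1 / 2 : ℝ) 1))) :=
        (lintegral_prod _ (hg.comp hΦ).aemeasurable).symm
    _ ≤ ∫⁻ x, g x ∂(ENNReal.ofReal (2 ^ (d - 1) / r) • volume.restrict T) := by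
        rw [← lintegral_map hg hΦ]
        exact lintegral_mono' (h.map_prod_le hT hTb hr hball) le_rfl
    _ = ENNReal.ofReal (2 ^ (d - 1) / r) * ∫⁻ x in T, g x := by
        rw [lintegral_smul_measure, smul_eq_mul]

/-- `g` is a polynomial of degree at most `N` on every line. This is the only property of
polynomials on which the trace inverse inequality depends, and it is stable under affine maps. -/
def IsPolyOnLines {V : Type*} [AddCommGroup V] [Module ℝ V] (N : ℕ) (g : V → ℝ) : Prop :=
  ∀ x v : V, ∃ q : Polynomial ℝ, q.natDegree ≤ N ∧ ∀ t : ℝ, g (x + t • v) = q.eval t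

theorem IsPolyOnLines.sq_le_lintegral {V : Type*} [AddCommGroup V] [Module ℝ V] {N : ℕ} {g : V → ℝ}
    (hg : IsPolyOnLines N g) (x z : V) :
    ENNReal.ofReal (g z ^ 2) ≤ ENNReal.ofReal (16 * (N + 1) ^ 2) *
      ∫⁻ t in Set.Ioc (1 / 2 : ℝ) 1, ENNReal.ofReal (g (x + t • (z - x)) ^ 2) := by
  obtain ⟨q, hq, hgq⟩ := hg x (z - x)
  have hz : g z = q.eval 1 := by rw [← hgq, one_smul, add_sub_cancel]
  have hint : IntegrableOn (fun t => q.eval t ^ 2) (Set.Ioc (1 / 2) 1) :=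
    (q.continuous.pow 2).integrableOn_Ioc
  simp_rw [hgq, hz]
  rw [← ofReal_integral_eq_lintegral_ofReal hint (.of_forall fun t => sq_nonneg _),
    ← ENNReal.ofReal_mul (by positivity), ← intervalIntegral.integral_of_le (by norm_num)]
  exact ENNReal.ofReal_le_ofReal (sq_eval_one_le_integral hq)

theorem IsFacet.integral_sq_le (h : IsFacet T F n) (hT : Convex ℝ T) (hTb : Bornology.IsBounded T)
    (hr : 0 < r) (hball : Metric.ball x₀ r ⊆ T) {N : ℕ} {g : E d → ℝ} (hgc : Continuous g)
    (hg : IsPolyOnLines N g) :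
    ∫ z in F, g z ^ 2 ∂(surface d) ≤ 16 * 2 ^ (d - 1) * (N + 1) ^ 2 / r * ∫ x in T, g x ^ 2 := by
  have hint : IntegrableOn (fun x => g x ^ 2) T :=
    ((hgc.pow 2).continuousOn.integrableOn_compact hTb.isCompact_closure).mono_set subset_closure
  rw [integral_eq_lintegral_of_nonneg_ae (.of_forall fun _ => sq_nonneg _)
    (hgc.pow 2).aestronglyMeasurable]
  refine ENNReal.toReal_le_of_le_ofReal
    (mul_nonneg (by positivity) (integral_nonneg fun _ => sq_nonneg _)) ?_
  calc ∫⁻ z in F, ENNReal.ofReal (g z ^ 2) ∂(surface d)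
      ≤ ∫⁻ z in F, ENNReal.ofReal (16 * (N + 1) ^ 2) *
          (∫⁻ t in Set.Ioc (1 / 2 : ℝ) 1, ENNReal.ofReal (g (x₀ + t • (z - x₀)) ^ 2))
            ∂(surface d) := lintegral_mono fun z => hg.sq_le_lintegral x₀ z
    _ = ENNReal.ofReal (16 * (N + 1) ^ 2) * ∫⁻ z in F,
          (∫⁻ t in Set.Ioc (1 / 2 : ℝ) 1, ENNReal.ofReal (g (x₀ + t • (z - x₀)) ^ 2))
            ∂(surface d) := lintegral_const_mul' _ _ ENNReal.ofReal_ne_top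
    _ ≤ ENNReal.ofReal (16 * (N + 1) ^ 2) * (ENNReal.ofReal (2 ^ (d - 1) / r) *
          ∫⁻ x in T, ENNReal.ofReal (g x ^ 2)) := by
        gcongr
        exact h.lintegral_le hT hTb hr hball (hgc.pow 2).measurable.ennreal_ofReal
    _ = ENNReal.ofReal (16 * 2 ^ (d - 1) * (N + 1) ^ 2 / r * ∫ x in T, g x ^ 2) := by
        rw [← mul_assoc, ← ENNReal.ofReal_mul (by positivity),
          ← ofReal_integral_eq_lintegral_ofReal hint (.of_forall fun _ => sq_nonneg _),
          ← ENNReal.ofReal_mul (by positivity)]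
        ring_nf

end Trace

theorem IsFacet.of_le {V : Type*} [NormedAddCommGroup V] [InnerProductSpace ℝ V] [CompleteSpace V]
    {T F : Set V} {L : V →L[ℝ] ℝ} (hL : L ≠ 0) (hF : F ⊆ closure T)
    (h : ∀ x ∈ F, ∀ y ∈ T, L y ≤ L x) :
    IsFacet T F (‖L‖⁻¹ • (InnerProductSpace.toDual ℝ V).symm L) where
  subset := hF
  norm := by
    rw [norm_smul, norm_inv, norm_norm, LinearIsometryEquiv.norm_map,
      inv_mul_cancel₀ (norm_ne_zero_iff.2 hL)]
  inner_le x hx y hy := by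
    rw [real_inner_smul_left, InnerProductSpace.toDual_symm_apply, map_sub]
    exact mul_nonpos_of_nonneg_of_nonpos (by positivity) (sub_nonpos.2 (h x hx y hy))

theorem IsFacet.mono {V : Type*} [NormedAddCommGroup V] [InnerProductSpace ℝ V] {T F F' : Set V}
    {n : V} (h : IsFacet T F n) (hF : F' ⊆ F) : IsFacet T F' n :=
  ⟨hF.trans h.subset, h.norm, fun x hx => h.inner_le x (hF hx)⟩

theorem exists_separating_normal {V : Type*} [NormedAddCommGroup V] [InnerProductSpace ℝ V]
    [CompleteSpace V] {T T' : Set V} (hT : Convex ℝ T) (hTo : IsOpen T) (hTn : T.Nonempty)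
    (hT' : Convex ℝ T') (hTo' : IsOpen T') (hTn' : T'.Nonempty) (h : Disjoint T T') :
    ∃ n : V, IsFacet T (closure T ∩ closure T') n ∧ IsFacet T' (closure T ∩ closure T') (-n) := by
  obtain ⟨L, u, hlt, hgt⟩ := geometric_hahn_banach_open_open hT hTo hT' hTo' h
  have hle : ∀ x ∈ closure T, L x ≤ u :=
    closure_minimal (fun y hy => (hlt y hy).le) (isClosed_le L.continuous continuous_const)
  have hge : ∀ x ∈ closure T', u ≤ L x :=
    closure_minimal (fun y hy => (hgt y hy).le) (isClosed_le continuous_const L.continuous)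
  have hL : L ≠ 0 := by
    rintro rfl
    obtain ⟨y, hy⟩ := hTn
    obtain ⟨y', hy'⟩ := hTn'
    exact lt_asymm (hlt y hy) (hgt y' hy')
  refine ⟨_, .of_le hL Set.inter_subset_left fun x hx y hy => (hlt y hy).le.trans (hge x hx.2), ?_⟩
  rw [← smul_neg, ← map_neg, ← norm_neg]
  exact .of_le (neg_ne_zero.2 hL) Set.inter_subset_right fun x hx y hy =>
    neg_le_neg ((hle x hx.1).trans (hgt y hy).le)

/-! ### Geometry of the elements -/

/-- The barycentric coordinates with respect to the vertices `0, e₁, …, e_d` of the reference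
simplex. -/
def bary {d : ℕ} (x : E d) : Fin (d + 1) → ℝ := Fin.cons (1 - ∑ i, x i) (fun i => x i)

theorem sum_bary {d : ℕ} (x : E d) : ∑ j, bary x j = 1 := by
  simp [bary, Fin.sum_univ_succ]

theorem mem_simplex_iff {d : ℕ} (x : E d) :
    x ∈ refElement d .simplex ↔ ∀ j, 0 < bary x j := by
  simp only [refElement, Set.mem_ofPred_eq, Fin.forall_fin_succ, bary, Fin.cons_zero, Fin.cons_succ,
    sub_pos]
  exact and_comm

theorem isOpen_refElement (d : ℕ) (s : Shape) : IsOpen (refElement d s) := by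
  cases s
  · have : refElement d .simplex = (⋂ i, {x : E d | 0 < x i}) ∩ {x | ∑ i, x i < 1} := by
      ext x; simp [refElement]
    rw [this]
    exact (isOpen_iInter_of_finite fun i => isOpen_lt continuous_const (by fun_prop)).inter
      (isOpen_lt (by fun_prop) continuous_const)
  · have : refElement d .cube = ⋂ i, ({x : E d | 0 < x i} ∩ {x | x i < 1}) := by
      ext x; simp [refElement]
    rw [this]
    exact isOpen_iInter_of_finite fun i => (isOpen_lt continuous_const (by fun_prop)).inter
      (isOpen_lt (by fun_prop) continuous_const)

theorem convex_refElement (d : ℕ) (s : Shape) : Convex ℝ (refElement d s) := by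
  rw [convex_iff_forall_pos]
  cases s
  · rintro x ⟨hx, hx'⟩ y ⟨hy, hy'⟩ a b ha hb hab
    refine ⟨fun i => ?_, ?_⟩
    · have := mul_pos ha (hx i)
      have := mul_pos hb (hy i)
      simp only [PiLp.add_apply, PiLp.smul_apply, smul_eq_mul]
      linarith
    · simp only [PiLp.add_apply, PiLp.smul_apply, smul_eq_mul, Finset.sum_add_distrib,
        ← Finset.mul_sum]
      nlinarith
  · intro x hx y hy a b ha hb hab i
    have h1 := mul_pos ha (hx i).1
    have h2 := mul_pos hb (hy i).1
    have h3 := mul_lt_mul_of_pos_left (hx i).2 ha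
    have h4 := mul_lt_mul_of_pos_left (hy i).2 hb
    simp only [PiLp.add_apply, PiLp.smul_apply, smul_eq_mul]
    exact ⟨by linarith, by linarith⟩

theorem refElement_nonempty (d : ℕ) (s : Shape) : (refElement d s).Nonempty := by
  cases s
  · refine ⟨WithLp.toLp 2 fun _ => 1 / ((d : ℝ) + 1), fun i => ?_, ?_⟩
    · simp only; positivity
    · simp only [Finset.sum_const, Finset.card_univ, Fintype.card_fin, nsmul_eq_mul]
      rw [mul_one_div, div_lt_one (by positivity)]
      linarith
  · exact ⟨WithLp.toLp 2 fun _ => 1 / 2, fun i => by simp only; norm_num⟩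

theorem coord_mem_Ioo {d : ℕ} {s : Shape} {x : E d} (hx : x ∈ refElement d s) (i : Fin d) :
    x i ∈ Set.Ioo (0 : ℝ) 1 := by
  cases s
  · exact ⟨hx.1 i, (Finset.single_le_sum (f := fun i => x i) (fun j _ => (hx.1 j).le)
      (Finset.mem_univ i)).trans_lt hx.2⟩
  · exact hx i

theorem coord_mem_Icc {d : ℕ} {s : Shape} {x : E d} (hx : x ∈ closure (refElement d s))
    (i : Fin d) : x i ∈ Set.Icc (0 : ℝ) 1 := by
  have hsub : refElement d s ⊆ {x | x i ∈ Set.Icc (0 : ℝ) 1} := fun y hy =>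
    ⟨(coord_mem_Ioo hy i).1.le, (coord_mem_Ioo hy i).2.le⟩
  exact closure_minimal hsub (isClosed_Icc.preimage (by fun_prop)) hx

theorem isBounded_refElement (d : ℕ) (s : Shape) : Bornology.IsBounded (refElement d s) := by
  refine (Metric.isBounded_closedBall (x := (0 : E d)) (r := Real.sqrt d)).subset fun x hx => ?_
  rw [mem_closedBall_zero_iff, EuclideanSpace.norm_eq]
  refine Real.sqrt_le_sqrt ?_
  calc ∑ i, ‖x i‖ ^ 2 ≤ ∑ _i : Fin d, (1 : ℝ) := by
        refine Finset.sum_le_sum fun i _ => pow_le_one₀ (norm_nonneg _) ?_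
        rw [Real.norm_of_nonneg (coord_mem_Ioo hx i).1.le]
        exact (coord_mem_Ioo hx i).2.le
    _ = d := by simp

theorem frontier_refElement_subset (d : ℕ) (s : Shape) :
    frontier (refElement d s) ⊆ ⋃ G ∈ refFacets d s, G := by
  intro x hx
  rw [(isOpen_refElement d s).frontier_eq] at hx
  obtain ⟨hxc, hxn⟩ := hx
  simp only [Set.mem_iUnion, exists_prop]
  cases s
  · have hsum : ∑ i, x i ≤ 1 := by
      have hclosed : IsClosed {x : E d | ∑ i, x i ≤ 1} := isClosed_le (by fun_prop) continuous_const
      exact closure_minimal (fun y hy => hy.2.le) hclosed hxc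
    by_cases h : ∀ i, 0 < x i
    · exact ⟨_, Or.inr rfl, hxc, hsum.antisymm (not_lt.1 fun hlt => hxn ⟨h, hlt⟩)⟩
    · push Not at h
      obtain ⟨i, hi⟩ := h
      exact ⟨_, Or.inl ⟨i, rfl⟩, hxc, hi.antisymm (coord_mem_Icc hxc i).1⟩
  · obtain ⟨i, hi⟩ : ∃ i, ¬(0 < x i ∧ x i < 1) := not_forall.1 hxn
    by_cases h0 : 0 < x i
    · exact ⟨_, Or.inr ⟨i, rfl⟩, hxc,
        (coord_mem_Icc hxc i).2.antisymm (not_lt.1 fun h => hi ⟨h0, h⟩)⟩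
    · exact ⟨_, Or.inl ⟨i, rfl⟩, hxc, (not_lt.1 h0).antisymm (coord_mem_Icc hxc i).1⟩

theorem refFacet_subset_closure {d : ℕ} {s : Shape} {G : Set (E d)} (hG : G ∈ refFacets d s) :
    G ⊆ closure (refElement d s) := by
  cases s
  · rcases hG with ⟨i, rfl⟩ | rfl <;> exact Set.inter_subset_left
  · rcases hG with ⟨i, rfl⟩ | ⟨i, rfl⟩ <;> exact Set.inter_subset_left

theorem isClosed_refFacet {d : ℕ} {s : Shape} {G : Set (E d)} (hG : G ∈ refFacets d s) :
    IsClosed G := by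
  cases s
  · rcases hG with ⟨i, rfl⟩ | rfl <;>
    exact isClosed_closure.inter (isClosed_eq (by fun_prop) continuous_const)
  · rcases hG with ⟨i, rfl⟩ | ⟨i, rfl⟩ <;>
    exact isClosed_closure.inter (isClosed_eq (by fun_prop) continuous_const)

theorem exists_supporting_form_refFacet {d : ℕ} {s : Shape} {G : Set (E d)}
    (hG : G ∈ refFacets d s) :
    ∃ L : E d →L[ℝ] ℝ, ∀ x ∈ G, ∀ y ∈ refElement d s, L y < L x := by
  cases s
  · rcases hG with ⟨i, rfl⟩ | rfl
    · refine ⟨-EuclideanSpace.proj i, fun x hx y hy => ?_⟩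
      simpa using hx.2.trans_lt (coord_mem_Ioo hy i).1
    · refine ⟨∑ i, EuclideanSpace.proj i, fun x hx y hy => ?_⟩
      simpa using hy.2.trans_eq hx.2.symm
  · rcases hG with ⟨i, rfl⟩ | ⟨i, rfl⟩
    · refine ⟨-EuclideanSpace.proj i, fun x hx y hy => ?_⟩
      simpa using hx.2.trans_lt (coord_mem_Ioo hy i).1
    · refine ⟨EuclideanSpace.proj i, fun x hx y hy => ?_⟩
      simpa using (coord_mem_Ioo hy i).2.trans_eq hx.2.symm

section Cell

variable {d : ℕ} (s : Shape) (T : Cell d)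

/-- The element map as a homeomorphism. -/
def Cell.homeo (T : Cell d) : E d ≃ₜ E d := (AffineEquiv.toContinuousAffineEquiv T).toHomeomorph

theorem cell_eq_homeo_image : cell s T = Cell.homeo T '' refElement d s := rfl

theorem isOpen_cell : IsOpen (cell s T) :=
  (Cell.homeo T).isOpenMap _ (isOpen_refElement d s)

theorem convex_cell : Convex ℝ (cell s T) :=
  (convex_refElement d s).affine_image (T : E d →ᵃ[ℝ] E d)

theorem cell_nonempty : (cell s T).Nonempty := (refElement_nonempty d s).image _

theorem closure_cell : closure (cell s T) = T '' closure (refElement d s) :=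
  ((Cell.homeo T).image_closure _).symm

theorem isBounded_cell : Bornology.IsBounded (cell s T) := by
  have h : IsCompact (Cell.homeo T '' closure (refElement d s)) :=
    (isBounded_refElement d s).isCompact_closure.image (Cell.homeo T).continuous
  exact h.isBounded.subset (Set.image_mono subset_closure)

theorem measurableSet_cell : MeasurableSet (cell s T) := (isOpen_cell s T).measurableSet

theorem volume_frontier_cell : volume (frontier (cell s T)) = 0 :=
  (convex_cell s T).addHaar_frontier volume

theorem frontier_cell_subset :
    frontier (cell s T) ⊆ ⋃ G ∈ refFacets d s, T '' G := by
  rw [cell_eq_homeo_image, ← (Cell.homeo T).image_frontier, ← Set.image_iUnion₂]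
  exact Set.image_mono (frontier_refElement_subset d s)

theorem isClosed_image_refFacet {G : Set (E d)} (hG : G ∈ refFacets d s) : IsClosed (T '' G) :=
  (Cell.homeo T).isClosedMap _ (isClosed_refFacet hG)

theorem image_refFacet_subset_closure {G : Set (E d)} (hG : G ∈ refFacets d s) :
    T '' G ⊆ closure (cell s T) :=
  (closure_cell s T).symm ▸ Set.image_mono (refFacet_subset_closure hG)

theorem diam_cell_pos (hd : 0 < d) : 0 < Metric.diam (cell s T) := by
  have : Nonempty (Fin d) := ⟨⟨0, hd⟩⟩
  obtain ⟨x, hx⟩ := cell_nonempty s T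
  exact Metric.diam_pos (infinite_of_mem_nhds x ((isOpen_cell s T).mem_nhds hx)).nontrivial
    (isBounded_cell s T)

variable {s} in
theorem exists_isFacet_image_refFacet {G : Set (E d)} (hG : G ∈ refFacets d s)
    (hne : G.Nonempty) : ∃ n : E d, IsFacet (cell s T) (T '' G) n := by
  obtain ⟨L, hL⟩ := exists_supporting_form_refFacet hG
  let L' : E d →L[ℝ] ℝ := L.comp (T.symm.linear : E d →ₗ[ℝ] E d).toContinuousLinearMap
  have hlt : ∀ x ∈ G, ∀ y ∈ refElement d s, L' (T y) < L' (T x) := by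
    intro x hx y hy
    have hL' : L' (T y) - L' (T x) = L y - L x := by
      have hsymm := (T.symm : E d →ᵃ[ℝ] E d).linearMap_vsub (T y) (T x)
      rw [← map_sub L', ← map_sub L]
      exact congrArg L (by simpa using hsymm)
    linarith [hL x hx y hy]
  obtain ⟨x₀, hx₀⟩ := hne
  obtain ⟨y₀, hy₀⟩ := refElement_nonempty d s
  refine ⟨_, .of_le (L := L') ?_ (image_refFacet_subset_closure s T hG) ?_⟩
  · intro h0
    have := hlt x₀ hx₀ y₀ hy₀
    simp only [h0, zero_apply, lt_irrefl] at this
  · rintro _ ⟨x, hx, rfl⟩ _ ⟨y, hy, rfl⟩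
    exact (hlt x hx y hy).le

end Cell

/-! ### Surface measure -/

theorem surface_eq_zero_of_sub_mem {d : ℕ} {F : Set (E d)} {S : Submodule ℝ (E d)}
    (hS : Module.finrank ℝ S < d - 1) {x₀ : E d} (h : ∀ x ∈ F, x - x₀ ∈ S) : surface d F = 0 := by
  have hiso : Isometry fun w : S => x₀ + w := (isometry_add_left x₀).comp isometry_subtype_coe
  have hsub : F ⊆ (fun w : S => x₀ + w) '' Set.univ := fun x hx =>
    ⟨⟨x - x₀, h x hx⟩, trivial, add_sub_cancel x₀ x⟩
  have hdim : dimH F < ((d - 1 : ℕ) : NNReal) := by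
    refine (dimH_mono hsub).trans_lt ?_
    rw [hiso.dimH_image, Real.dimH_univ_eq_finrank]
    exact_mod_cast hS
  have := hausdorffMeasure_of_dimH_lt hdim
  rw [NNReal.coe_natCast] at this
  rw [surface, Measure.euclideanHausdorffMeasure_def, Measure.smul_apply, this, smul_zero]

theorem surface_eq_zero_of_codim_two {d : ℕ} (hd : 2 ≤ d) {F : Set (E d)} {x₀ n n' : E d}
    (hind : LinearIndependent ℝ ![n, n']) (h : ∀ x ∈ F, ⟪n, x - x₀⟫ = 0)
    (h' : ∀ x ∈ F, ⟪n', x - x₀⟫ = 0) : surface d F = 0 := by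
  set S : Submodule ℝ (E d) := Submodule.span ℝ (Set.range ![n, n']) with hS
  have hrank : Module.finrank ℝ Sᗮ < d - 1 := by
    have hS2 : Module.finrank ℝ S = 2 := by rw [hS, finrank_span_eq_card hind, Fintype.card_fin]
    have hdim := S.finrank_add_finrank_orthogonal
    rw [hS2, finrank_euclideanSpace_fin] at hdim
    omega
  refine surface_eq_zero_of_sub_mem hrank (x₀ := x₀) fun x hx => ?_
  have hortho : S ⟂ ℝ ∙ (x - x₀) := by
    rw [hS, Submodule.isOrtho_span]
    rintro _ ⟨i, rfl⟩ _ rfl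
    fin_cases i
    exacts [h x hx, h' x hx]
  exact hortho.symm (Submodule.mem_span_singleton_self _)

theorem IsFacet.eq_of_surface_pos {d : ℕ} (hd : 2 ≤ d) {T F : Set (E d)} {n n' : E d}
    (hTo : IsOpen T) (hTn : T.Nonempty) (hF : 0 < surface d F) (h : IsFacet T F n)
    (h' : IsFacet T F n') : n = n' := by
  obtain ⟨x₀, hx₀⟩ := nonempty_of_measure_ne_zero hF.ne'
  have hn0 : n ≠ 0 := norm_ne_zero_iff.1 (h.norm.trans_ne one_ne_zero)
  by_cases hind : LinearIndependent ℝ ![n, n']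
  · exact absurd (surface_eq_zero_of_codim_two hd hind (fun x hx => h.inner_eq_zero hx₀ hx)
      (fun x hx => h'.inner_eq_zero hx₀ hx)) hF.ne'
  · rw [LinearIndependent.pair_iff' hn0] at hind
    push Not at hind
    obtain ⟨a, rfl⟩ := hind
    have ha : |a| = 1 := by
      simpa only [norm_smul, h.norm, mul_one, Real.norm_eq_abs] using h'.norm
    rcases eq_or_eq_neg_of_abs_eq ha with rfl | rfl
    · rw [one_smul]
    · obtain ⟨y, hy⟩ := hTn
      have hneg := h.inner_neg hTo hx₀ hy
      have hneg' := h'.inner_neg hTo hx₀ hy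
      rw [neg_one_smul, inner_neg_left] at hneg'
      linarith

theorem exists_add_smul_mem_frontier {V : Type*} [NormedAddCommGroup V] [NormedSpace ℝ V]
    {U : Set V} (hU : Bornology.IsBounded U) {x e : V} (hx : x ∈ U) (he : e ≠ 0) :
    ∃ t : ℝ, x + t • e ∈ frontier U := by
  have hc : Continuous fun t : ℝ => x + t • e := by fun_prop
  obtain ⟨t, ht⟩ : (frontier ((fun t : ℝ => x + t • e) ⁻¹' U)).Nonempty := by
    refine nonempty_frontier_iff.2 ⟨⟨0, by simpa using hx⟩, fun huniv => ?_⟩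
    obtain ⟨R, hR⟩ := hU.subset_ball x
    have hmem : x + (R / ‖e‖) • e ∈ U := (huniv ▸ Set.mem_univ (R / ‖e‖) :)
    have := hR hmem
    rw [Metric.mem_ball, dist_self_add_left, norm_smul, norm_div, norm_norm,
      div_mul_cancel₀ _ (norm_ne_zero_iff.2 he)] at this
    exact absurd this (not_lt.2 (le_abs_self R))
  exact ⟨t, hc.frontier_preimage_subset U ht⟩

/-- The orthogonal projection onto a hyperplane does not increase surface measure, and the shadow of
the frontier contains the shadow of the interior, which is open. -/
theorem surface_frontier_pos {d : ℕ} (hd : 0 < d) {U : Set (E d)} (hU : Bornology.IsBounded U)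
    (hint : (interior U).Nonempty) : 0 < surface d (frontier U) := by
  set e : E d := EuclideanSpace.single ⟨0, hd⟩ 1 with he
  have he0 : e ≠ 0 := by simp [he]
  set K := (ℝ ∙ e)ᗮ with hK
  have hrank : Module.finrank ℝ K = d - 1 := by
    have : Fact (Module.finrank ℝ (E d) = d - 1 + 1) :=
      ⟨by rw [finrank_euclideanSpace_fin]; omega⟩
    exact Submodule.finrank_orthogonal_span_singleton he0
  set π := K.orthogonalProjectionOnto with hπ
  have hπe : π e = 0 := by
    rw [hπ, Submodule.orthogonalProjectionOnto_eq_zero_iff, hK, Submodule.orthogonal_orthogonal]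
    exact Submodule.mem_span_singleton_self e
  have shadow : π '' interior U ⊆ π '' frontier U := by
    rintro _ ⟨x, hx, rfl⟩
    obtain ⟨t, ht⟩ := exists_add_smul_mem_frontier hU (interior_subset hx) he0
    exact ⟨_, ht, by rw [map_add, map_smul, hπe, smul_zero, add_zero]⟩
  have hopen : IsOpenMap π := π.isOpenMap_of_finiteDimensional fun y =>
    ⟨y, Submodule.orthogonalProjectionOnto_mem_subspace_eq_self y⟩
  calc (0 : ENNReal) < volume (π '' interior U) :=
        (hopen _ isOpen_interior).measure_pos volume (hint.image _)
    _ ≤ Measure.euclideanHausdorffMeasure (d - 1) (π '' frontier U) := by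
        rw [← hrank, InnerProductSpace.euclideanHausdorffMeasure_eq_volume]
        exact measure_mono shadow
    _ ≤ surface d (frontier U) := by
        rw [surface, Measure.euclideanHausdorffMeasure_def, Measure.euclideanHausdorffMeasure_def,
          Measure.smul_apply, Measure.smul_apply]
        gcongr
        exact hausdorffMeasure_orthogonalProjectionOnto_le K _ _ (Nat.cast_nonneg _)

/-! ### Faces and normals -/

section Faces

variable {d : ℕ} {s : Shape} {Ω : Set (E d)} {𝒯 : Finset (Cell d)}

open Classical in
theorem mem_interiorFaces {f : Face d} : f ∈ interiorFaces s 𝒯 ↔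
    ∃ T ∈ 𝒯, ∃ T' ∈ 𝒯, T ≠ T' ∧ f = ⟨{T, T'}, closure (cell s T) ∩ closure (cell s T')⟩ ∧
      0 < surface d f.carrier := by
  have hinter : ∀ T T' : Cell d, (⋂ S ∈ ({T, T'} : Finset (Cell d)), closure (cell s S)) =
      closure (cell s T) ∩ closure (cell s T') := by
    simp
  simp only [interiorFaces, Finset.mem_filter, Finset.mem_image, Finset.mem_powersetCard]
  constructor
  · rintro ⟨⟨c, ⟨hc, hcard⟩, rfl⟩, hpos⟩
    obtain ⟨T, T', hne, rfl⟩ := Finset.card_eq_two.1 hcard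
    exact ⟨T, hc (by simp), T', hc (by simp), hne, by rw [hinter], hpos⟩
  · rintro ⟨T, hT, T', hT', hne, rfl, hpos⟩
    exact ⟨⟨{T, T'}, ⟨Finset.insert_subset hT (Finset.singleton_subset_iff.2 hT'),
      Finset.card_pair hne⟩, by rw [hinter]⟩, hpos⟩

open Classical in
theorem mem_boundaryFaces {f : Face d} : f ∈ boundaryFaces s Ω 𝒯 ↔
    ∃ T ∈ 𝒯, ∃ G ∈ refFacets d s, f = ⟨{T}, T '' G ∩ frontier Ω⟩ ∧
      0 < surface d f.carrier := by
  simp only [boundaryFaces, Finset.mem_filter, Finset.mem_image, Finset.mem_product,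
    Set.Finite.mem_toFinset, Prod.exists]
  constructor
  · rintro ⟨⟨T, G, ⟨hT, hG⟩, rfl⟩, hpos⟩
    exact ⟨T, hT, G, hG, rfl, hpos⟩
  · rintro ⟨T, hT, G, hG, rfl, hpos⟩
    exact ⟨⟨T, G, ⟨hT, hG⟩, rfl⟩, hpos⟩

theorem mem_faces {f : Face d} : f ∈ faces s Ω 𝒯 ↔
    f ∈ interiorFaces s 𝒯 ∨ f ∈ boundaryFaces s Ω 𝒯 := by
  classical
  simp [faces]

theorem mem_faces_of_mem_interiorFaces {f : Face d} (hf : f ∈ interiorFaces s 𝒯) :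
    f ∈ faces s Ω 𝒯 :=
  mem_faces.2 (Or.inl hf)

theorem surface_pos_of_mem_faces {f : Face d} (hf : f ∈ faces s Ω 𝒯) : 0 < surface d f.carrier := by
  rcases mem_faces.1 hf with h | h
  · obtain ⟨_, _, _, _, _, _, hpos⟩ := mem_interiorFaces.1 h
    exact hpos
  · obtain ⟨_, _, _, _, _, hpos⟩ := mem_boundaryFaces.1 h
    exact hpos

theorem carrier_nonempty {f : Face d} (hf : f ∈ faces s Ω 𝒯) : f.carrier.Nonempty :=
  nonempty_of_measure_ne_zero (surface_pos_of_mem_faces hf).ne'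

theorem isClosed_carrier {f : Face d} (hf : f ∈ faces s Ω 𝒯) : IsClosed f.carrier := by
  rcases mem_faces.1 hf with h | h
  · obtain ⟨T, _, T', _, _, rfl, _⟩ := mem_interiorFaces.1 h
    exact isClosed_closure.inter isClosed_closure
  · obtain ⟨T, _, G, hG, rfl, _⟩ := mem_boundaryFaces.1 h
    exact (isClosed_image_refFacet s T hG).inter isClosed_frontier

theorem mem_mesh_of_mem_cells {f : Face d} (hf : f ∈ faces s Ω 𝒯) {T : Cell d}
    (hT : T ∈ f.cells) : T ∈ 𝒯 := by
  classical
  rcases mem_faces.1 hf with h | h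
  · obtain ⟨T₁, h₁, T₂, h₂, _, rfl, _⟩ := mem_interiorFaces.1 h
    simp only [Finset.mem_insert, Finset.mem_singleton] at hT
    rcases hT with rfl | rfl <;> assumption
  · obtain ⟨T₁, h₁, G, -, rfl, -⟩ := mem_boundaryFaces.1 h
    rwa [Finset.mem_singleton.1 hT]

theorem cells_nonempty {f : Face d} (hf : f ∈ faces s Ω 𝒯) : f.cells.Nonempty := by
  classical
  rcases mem_faces.1 hf with h | h
  · obtain ⟨T, -, T', -, -, rfl, -⟩ := mem_interiorFaces.1 h
    exact ⟨T, Finset.mem_insert_self _ _⟩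
  · obtain ⟨T, -, G, -, rfl, -⟩ := mem_boundaryFaces.1 h
    exact ⟨T, Finset.mem_singleton_self _⟩

theorem carrier_subset_closure {f : Face d} (hf : f ∈ faces s Ω 𝒯) {T : Cell d}
    (hT : T ∈ f.cells) : f.carrier ⊆ closure (cell s T) := by
  classical
  rcases mem_faces.1 hf with h | h
  · obtain ⟨T₁, -, T₂, -, -, rfl, -⟩ := mem_interiorFaces.1 h
    simp only [Finset.mem_insert, Finset.mem_singleton] at hT
    rcases hT with rfl | rfl
    · exact Set.inter_subset_left
    · exact Set.inter_subset_right
  · obtain ⟨T₁, -, G, hG, rfl, -⟩ := mem_boundaryFaces.1 h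
    rw [Finset.mem_singleton.1 hT]
    exact Set.inter_subset_left.trans (image_refFacet_subset_closure s _ hG)

theorem exists_separating_normal_cell {T T' : Cell d} (h : Disjoint (cell s T) (cell s T')) :
    ∃ n : E d, IsFacet (cell s T) (closure (cell s T) ∩ closure (cell s T')) n ∧
      IsFacet (cell s T') (closure (cell s T) ∩ closure (cell s T')) (-n) :=
  exists_separating_normal (convex_cell s T) (isOpen_cell s T) (cell_nonempty s T)
    (convex_cell s T') (isOpen_cell s T') (cell_nonempty s T') h

theorem exists_isFacet_carrier {f : Face d} (hP : IsPartition s Ω 𝒯) (hf : f ∈ faces s Ω 𝒯)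
    {T : Cell d} (hT : T ∈ f.cells) : ∃ n : E d, IsFacet (cell s T) f.carrier n := by
  classical
  rcases mem_faces.1 hf with h | h
  · obtain ⟨T₁, h₁, T₂, h₂, hne, rfl, _⟩ := mem_interiorFaces.1 h
    obtain ⟨n, hn₁, hn₂⟩ := exists_separating_normal_cell (hP.disjoint T₁ h₁ T₂ h₂ hne)
    simp only [Finset.mem_insert, Finset.mem_singleton] at hT
    rcases hT with rfl | rfl
    exacts [⟨n, hn₁⟩, ⟨-n, hn₂⟩]
  · obtain ⟨x, hx⟩ := carrier_nonempty hf
    obtain ⟨T₁, -, G, hG, rfl, -⟩ := mem_boundaryFaces.1 h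
    obtain ⟨y, hy, -⟩ := hx.1
    obtain ⟨n, hn⟩ := exists_isFacet_image_refFacet T₁ hG ⟨y, hy⟩
    rw [Finset.mem_singleton.1 hT]
    exact ⟨n, hn.mono Set.inter_subset_left⟩

theorem isFacet_normal {f : Face d} (hP : IsPartition s Ω 𝒯) (hf : f ∈ faces s Ω 𝒯) {T : Cell d}
    (hT : T ∈ f.cells) : IsFacet (cell s T) f.carrier (normal s T f) := by
  obtain ⟨n, hn⟩ := exists_isFacet_carrier hP hf hT
  obtain ⟨hnorm, hle⟩ := Classical.epsilon_spec (p := fun n : E d =>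
    ‖n‖ = 1 ∧ ∀ x ∈ f.carrier, ∀ y ∈ cell s T, ⟪n, y - x⟫ ≤ 0) ⟨n, hn.norm, hn.inner_le⟩
  exact ⟨hn.subset, hnorm, hle⟩

open Classical in
theorem normal_eq_neg_of_mem_interiorFaces (hd : 2 ≤ d) {f : Face d} (hP : IsPartition s Ω 𝒯)
    (hf : f ∈ interiorFaces s 𝒯) {T T' : Cell d} (hc : f.cells = {T, T'}) :
    normal s T' f = -normal s T f := by
  obtain ⟨T₁, h₁, T₂, h₂, hne, hfe, hpos⟩ := mem_interiorFaces.1 hf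
  obtain ⟨n, hn₁, hn₂⟩ := exists_separating_normal_cell (hP.disjoint T₁ h₁ T₂ h₂ hne)
  have hcarrier : closure (cell s T₁) ∩ closure (cell s T₂) = f.carrier := by rw [hfe]
  rw [hcarrier] at hn₁ hn₂
  have hf' : f ∈ faces s Ω 𝒯 := mem_faces_of_mem_interiorFaces hf
  have e₁ : normal s T₁ f = n := (isFacet_normal hP hf' (by simp [hfe])).eq_of_surface_pos hd
    (isOpen_cell s T₁) (cell_nonempty s T₁) hpos hn₁
  have e₂ : normal s T₂ f = -n := (isFacet_normal hP hf' (by simp [hfe])).eq_of_surface_pos hd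
    (isOpen_cell s T₂) (cell_nonempty s T₂) hpos hn₂
  have hpair : ({T₁, T₂} : Set (Cell d)) = {T, T'} := by
    rw [← Finset.coe_pair, ← Finset.coe_pair, ← hc, hfe]
  rcases Set.pair_eq_pair_iff.1 hpair with ⟨rfl, rfl⟩ | ⟨rfl, rfl⟩
  · rw [e₁, e₂]
  · rw [e₁, e₂, neg_neg]

end Faces

theorem card_le_of_disjoint_balls {V : Type*} [NormedAddCommGroup V] [NormedSpace ℝ V]
    [FiniteDimensional ℝ V] {ι : Type*} {S : Finset ι} {A : ι → Set V} {x₀ : V} {R ρ : ℝ}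
    (hR : 0 ≤ R) (hρ : 0 < ρ) (hdisj : (S : Set ι).PairwiseDisjoint A)
    (hball : ∀ i ∈ S, ∃ x, Metric.ball x ρ ⊆ A i) (hA : ∀ i ∈ S, A i ⊆ Metric.closedBall x₀ R) :
    (S.card : ℝ) ≤ (R / ρ) ^ Module.finrank ℝ V := by
  borelize V
  let μ : Measure V := Measure.addHaar
  choose! x hx using hball
  have hunit : 0 < μ.real (Metric.ball 0 1) :=
    ENNReal.toReal_pos (Metric.measure_ball_pos μ _ one_pos).ne'
      Metric.isBounded_ball.measure_lt_top.ne
  have hvolume : ∀ y, μ.real (Metric.ball y ρ) =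
      ρ ^ Module.finrank ℝ V * μ.real (Metric.ball 0 1) := fun y => by
    simp [measureReal_def, μ.addHaar_ball_of_pos y hρ, hρ.le]
  have hballs : ∑ i ∈ S, μ.real (Metric.ball (x i) ρ) ≤ μ.real (Metric.closedBall x₀ R) := by
    rw [← measureReal_biUnion_finset (hdisj.mono_on hx) (fun i _ => measurableSet_ball)
      (fun i _ => Metric.isBounded_ball.measure_lt_top.ne)]
    exact measureReal_mono (Set.iUnion₂_subset fun i hi => (hx i hi).trans (hA i hi))
      Metric.isBounded_closedBall.measure_lt_top.ne
  have hvol : S.card * ρ ^ Module.finrank ℝ V * μ.real (Metric.ball 0 1) ≤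
      R ^ Module.finrank ℝ V * μ.real (Metric.ball 0 1) := by
    simpa [hvolume, μ.addHaar_real_closedBall _ hR, mul_assoc]
      using hballs
  rw [div_pow, le_div_iff₀ (by positivity)]
  exact le_of_mul_le_mul_right hvol hunit

/-! ### Polynomial functions -/

section IsPolyOnLines

variable {V : Type*} [AddCommGroup V] [Module ℝ V] {N : ℕ} {f g : V → ℝ}

theorem IsPolyOnLines.add (hf : IsPolyOnLines N f) (hg : IsPolyOnLines N g) :
    IsPolyOnLines N (f + g) := by
  intro x v
  obtain ⟨p, hp, hp'⟩ := hf x v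
  obtain ⟨q, hq, hq'⟩ := hg x v
  exact ⟨p + q, (Polynomial.natDegree_add_le _ _).trans (max_le hp hq), fun t => by
    simp [hp', hq']⟩

theorem IsPolyOnLines.smul (a : ℝ) (hf : IsPolyOnLines N f) : IsPolyOnLines N (a • f) := by
  intro x v
  obtain ⟨p, hp, hp'⟩ := hf x v
  exact ⟨a • p, (Polynomial.natDegree_smul_le _ _).trans hp, fun t => by simp [hp']⟩

theorem IsPolyOnLines.comp_affineMap {W : Type*} [AddCommGroup W] [Module ℝ W]
    (hf : IsPolyOnLines N f) (A : W →ᵃ[ℝ] V) : IsPolyOnLines N (f ∘ A) := by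
  intro x v
  obtain ⟨p, hp, hp'⟩ := hf (A x) (A.linear v)
  refine ⟨p, hp, fun t => ?_⟩
  have hA : A (x + t • v) = A x + t • A.linear v := by
    rw [add_comm x, add_comm (A x), ← map_smul]
    exact A.map_vadd x (t • v)
  rw [Function.comp_apply, hA, hp']

end IsPolyOnLines

theorem IsPolyOnLines.eq_of_eqOn {V : Type*} [NormedAddCommGroup V] [NormedSpace ℝ V] {N M : ℕ}
    {f g : V → ℝ} (hf : IsPolyOnLines N f) (hg : IsPolyOnLines M g) {U : Set V} (hU : IsOpen U)
    (hne : U.Nonempty) (h : Set.EqOn f g U) : f = g := by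
  obtain ⟨x₀, hx₀⟩ := hne
  ext x
  obtain ⟨p, -, hp⟩ := hf x₀ (x - x₀)
  obtain ⟨q, -, hq⟩ := hg x₀ (x - x₀)
  have hopen : IsOpen ((fun t : ℝ => x₀ + t • (x - x₀)) ⁻¹' U) := hU.preimage (by fun_prop)
  have hinf : ((fun t : ℝ => x₀ + t • (x - x₀)) ⁻¹' U).Infinite :=
    infinite_of_mem_nhds (0 : ℝ) (hopen.mem_nhds (by simpa using hx₀))
  have hpq : p = q := Polynomial.eq_of_infinite_eval_eq p q (hinf.mono fun t ht => by
    rw [Set.mem_ofPred_eq, ← hp, ← hq]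
    exact h ht)
  have hx : x = x₀ + (1 : ℝ) • (x - x₀) := by rw [one_smul, add_sub_cancel]
  rw [hx, hp, hq, hpq]

theorem isPolyOnLines_eval {d N : ℕ} {P : MvPolynomial (Fin d) ℝ} (hP : P.totalDegree ≤ N) :
    IsPolyOnLines N fun x : E d => MvPolynomial.eval (fun i => x i) P := by
  intro x v
  refine ⟨MvPolynomial.aeval (fun i => Polynomial.C (v i) * Polynomial.X + Polynomial.C (x i)) P,
    ?_, fun t => ?_⟩
  · simpa using MvPolynomial.aeval_natDegree_le (n := 1) P hP
      (fun i => Polynomial.C (v i) * Polynomial.X + Polynomial.C (x i))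
      (fun i => Polynomial.natDegree_linear_le)
  · have hcoord : (fun i => (x + t • v) i) = fun i =>
        Polynomial.aeval t (Polynomial.C (v i) * Polynomial.X + Polynomial.C (x i)) := by
      ext i
      simp only [PiLp.add_apply, PiLp.smul_apply, smul_eq_mul, map_add, map_mul, Polynomial.aeval_C,
        Polynomial.aeval_X, Algebra.algebraMap_self_apply]
      ring
    simp only [hcoord, ← MvPolynomial.coe_aeval_eq_eval, ← Polynomial.coe_aeval_eq_eval]
    exact (DFunLike.congr_fun (MvPolynomial.comp_aeval _ (Polynomial.aeval t)) P).symm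

theorem totalDegree_le_of_mem_refPoly {d : ℕ} {s : Shape} {p : ℕ} {P : MvPolynomial (Fin d) ℝ}
    (hP : P ∈ refPoly d s p) : P.totalDegree ≤ d * p + p := by
  cases s
  · have := (MvPolynomial.mem_restrictTotalDegree (Fin d) p P).1 hP
    omega
  · have hP' := (MvPolynomial.mem_restrictDegree (Fin d) P p).1 hP
    refine le_trans ?_ (Nat.le_add_right _ _)
    refine Finset.sup_le fun m hm => ?_
    have h1 : m.sum (fun _ e => e) = ∑ i, m i := m.sum_fintype _ fun _ => rfl
    rw [h1]
    calc ∑ i, m i ≤ ∑ _i : Fin d, p := Finset.sum_le_sum fun i _ => hP' m hm i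
      _ = d * p := by simp

theorem refPoly_mono {d : ℕ} {s : Shape} {p q : ℕ} (h : p ≤ q) : refPoly d s p ≤ refPoly d s q := by
  intro P hP
  cases s
  · exact (MvPolynomial.mem_restrictTotalDegree _ _ _).2
      (((MvPolynomial.mem_restrictTotalDegree (Fin d) p P).1 hP).trans h)
  · exact (MvPolynomial.mem_restrictDegree _ _ _).2 fun m hm i =>
      ((MvPolynomial.mem_restrictDegree (Fin d) P p).1 hP m hm i).trans h

instance finiteDimensional_refPoly (d : ℕ) (s : Shape) (p : ℕ) :
    FiniteDimensional ℝ (refPoly d s p) := by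
  cases s
  · exact inferInstanceAs (Module.Finite ℝ (MvPolynomial.restrictTotalDegree (Fin d) ℝ p))
  · exact inferInstanceAs (Module.Finite ℝ (MvPolynomial.restrictDegree (Fin d) ℝ p))

namespace Level

variable {d : ℕ}

theorem contDiff_pushPoly (T : Cell d) (P : MvPolynomial (Fin d) ℝ) :
    ContDiff ℝ 1 (pushPoly T P) := by
  have hT : ContDiff ℝ 1 (T.symm : E d → E d) :=
    (AffineEquiv.toContinuousAffineEquiv T.symm).toContinuousAffineMap.contDiff
  have hcoord : ∀ i : Fin d, ContDiff ℝ 1 fun x => T.symm x i := fun i => by fun_prop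
  unfold pushPoly
  simp_rw [MvPolynomial.eval_eq]
  refine ContDiff.sum fun m _ => contDiff_const.mul ?_
  exact contDiff_prod fun i _ => (hcoord i).pow _

theorem isPolyOnLines_pushPoly (T : Cell d) {s : Shape} {p : ℕ} {P : MvPolynomial (Fin d) ℝ}
    (hP : P ∈ refPoly d s p) : IsPolyOnLines (d * p + p) (pushPoly T P) :=
  (isPolyOnLines_eval (totalDegree_le_of_mem_refPoly hP)).comp_affineMap
    (T.symm : E d →ᵃ[ℝ] E d)

variable {Ω : Set (E d)} (D : Level d Ω)

theorem exists_on_eq (v : D.V) (T : Cell d) :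
    ∃ P ∈ refPoly d D.shape D.degree, D.on v T = pushPoly T P := by
  by_cases h : T ∈ D.mesh
  · exact ⟨_, (v.2 T h).choose_spec.1, by rw [on, dif_pos h]⟩
  · refine ⟨0, Submodule.zero_mem _, ?_⟩
    rw [on, dif_neg h]
    ext x; simp [pushPoly]

theorem contDiff_on (v : D.V) (T : Cell d) : ContDiff ℝ 1 (D.on v T) := by
  obtain ⟨P, _, h⟩ := D.exists_on_eq v T
  rw [h]; exact contDiff_pushPoly T P

@[fun_prop]
theorem continuous_on (v : D.V) (T : Cell d) : Continuous (D.on v T) :=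
  (D.contDiff_on v T).continuous

@[fun_prop]
theorem continuous_gradient_on (v : D.V) (T : Cell d) : Continuous (gradient (D.on v T)) := by
  have := (D.contDiff_on v T).continuous_fderiv (by norm_num)
  exact (InnerProductSpace.toDual ℝ (E d)).symm.continuous.comp this

theorem isPolyOnLines_on (v : D.V) (T : Cell d) :
    IsPolyOnLines (d * D.degree + D.degree) (D.on v T) := by
  obtain ⟨P, hP, h⟩ := D.exists_on_eq v T
  rw [h]; exact isPolyOnLines_pushPoly T hP

theorem on_ae (v : D.V) {T : Cell d} (hT : T ∈ D.mesh) :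
    ∀ᵐ x ∂(volume.restrict Ω), x ∈ cell D.shape T → v.1 x = D.on v T x := by
  rw [on, dif_pos hT]
  exact (v.2 T hT).choose_spec.2

end Level

section Mesh

variable {d : ℕ} {s : Shape} {Ω : Set (E d)} {𝒯 : Finset (Cell d)}

theorem IsPartition.isOpen (hP : IsPartition s Ω 𝒯) : IsOpen Ω := by
  rw [hP.cover]; exact isOpen_interior

theorem IsPartition.cell_subset (hP : IsPartition s Ω 𝒯) {T : Cell d} (hT : T ∈ 𝒯) :
    cell s T ⊆ Ω := by
  rw [hP.cover]
  exact interior_maximal (subset_closure.trans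
    (Set.subset_biUnion_of_mem (u := fun T => closure (cell s T)) hT)) (isOpen_cell s T)

theorem IsPartition.ae_eq (hP : IsPartition s Ω 𝒯) :
    (⋃ T ∈ 𝒯, cell s T) =ᵐ[volume] Ω := by
  have hsub : (⋃ T ∈ 𝒯, cell s T) ⊆ Ω := Set.iUnion₂_subset fun T hT => hP.cell_subset hT
  refine hsub.eventuallyLE.antisymm ?_
  have hnull : volume (⋃ T ∈ 𝒯, frontier (cell s T)) = 0 :=
    (measure_biUnion_null_iff 𝒯.countable_toSet).2 fun T _ => volume_frontier_cell s T
  have hnull' : ∀ᵐ x, x ∉ ⋃ T ∈ 𝒯, frontier (cell s T) := measure_eq_zero_iff_ae_notMem.1 hnull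
  filter_upwards [hnull'] with x hx hxΩ
  have hx2 : x ∈ ⋃ T ∈ 𝒯, closure (cell s T) := by
    have : x ∈ interior (⋃ T ∈ 𝒯, closure (cell s T)) := hP.cover ▸ hxΩ
    exact interior_subset this
  obtain ⟨T, hT, hxT⟩ := Set.mem_iUnion₂.1 hx2
  have hnf : x ∉ frontier (cell s T) := fun h => hx (Set.mem_iUnion₂.2 ⟨T, hT, h⟩)
  refine Set.mem_iUnion₂.2 ⟨T, hT, ?_⟩
  by_contra hnot
  exact hnf (by rw [(isOpen_cell s T).frontier_eq]; exact ⟨hxT, hnot⟩)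

theorem IsPartition.integral_eq_sum (hP : IsPartition s Ω 𝒯) {f : E d → ℝ}
    (hf : ∀ T ∈ 𝒯, IntegrableOn f (cell s T)) :
    ∫ x in Ω, f x = ∑ T ∈ 𝒯, ∫ x in cell s T, f x := by
  rw [← Measure.restrict_congr_set hP.ae_eq]
  exact integral_biUnion_finset 𝒯 (fun T _ => measurableSet_cell s T)
    (fun T hT T' hT' hne => hP.disjoint T hT T' hT' hne) hf

theorem integrableOn_cell {M : Type*} [NormedAddCommGroup M] {f : E d → M} (hf : Continuous f)
    (T : Cell d) : IntegrableOn f (cell s T) :=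
  (hf.continuousOn.integrableOn_compact (isBounded_cell s T).isCompact_closure).mono_set
    subset_closure

theorem surface_carrier_lt_top (hP : IsPartition s Ω 𝒯) {f : Face d} (hf : f ∈ faces s Ω 𝒯) :
    surface d f.carrier < ⊤ := by
  obtain ⟨T, hT⟩ := cells_nonempty hf
  obtain ⟨x, hx⟩ := cell_nonempty s T
  obtain ⟨r, hr, hball⟩ := Metric.isOpen_iff.1 (isOpen_cell s T) x hx
  exact (isFacet_normal hP hf hT).surface_lt_top (convex_cell s T) (isBounded_cell s T) hr hball

theorem isBounded_carrier {f : Face d} (hf : f ∈ faces s Ω 𝒯) :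
    Bornology.IsBounded f.carrier := by
  obtain ⟨T, hT⟩ := cells_nonempty hf
  exact (isBounded_cell s T).closure.subset (carrier_subset_closure hf hT)

theorem integrableOn_of_isBounded {A : Set (E d)} (hA : Bornology.IsBounded A)
    (hfin : surface d A < ⊤) (hAm : MeasurableSet A) {g : E d → ℝ} (hg : Continuous g) :
    IntegrableOn g A (surface d) := by
  obtain ⟨C, hC⟩ := hA.isCompact_closure.exists_bound_of_continuousOn hg.continuousOn
  refine Measure.integrableOn_of_bounded (M := C) hfin.ne hg.aestronglyMeasurable ?_
  exact (ae_restrict_iff' hAm).2 (Filter.Eventually.of_forall fun x hx =>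
    hC x (subset_closure hx))

theorem integrableOn_carrier (hP : IsPartition s Ω 𝒯) {f : Face d} (hf : f ∈ faces s Ω 𝒯)
    {g : E d → ℝ} (hg : Continuous g) : IntegrableOn g f.carrier (surface d) :=
  integrableOn_of_isBounded (isBounded_carrier hf) (surface_carrier_lt_top hP hf)
    (isClosed_carrier hf).measurableSet hg

end Mesh

namespace Level

variable {d : ℕ} {Ω : Set (E d)} {D : Level d Ω}

/-- The standing assumption on a level: its mesh is a partition of `Ω`. -/
abbrev IsMesh (D : Level d Ω) : Prop := IsPartition D.shape Ω D.mesh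

theorem on_ae_cell (hP : D.IsMesh) (v : D.V) {T : Cell d} (hT : T ∈ D.mesh) :
    ∀ᵐ x ∂(volume.restrict (cell D.shape T)), v.1 x = D.on v T x := by
  have h := D.on_ae v hT
  have h2 := ae_mono (Measure.restrict_mono (hP.cell_subset hT) le_rfl) h
  filter_upwards [h2, ae_restrict_mem (measurableSet_cell D.shape T)] with x h3 h4
  exact h3 h4

theorem on_eq_of_ae_eq (hP : D.IsMesh) (v : D.V) {T : Cell d} (hT : T ∈ D.mesh) {N : ℕ}
    {g : E d → ℝ} (hg : Continuous g) (hgN : IsPolyOnLines N g) {U : Set (E d)} (hU : IsOpen U)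
    (hUne : U.Nonempty) (hUT : U ⊆ cell D.shape T)
    (h : ∀ᵐ x ∂(volume.restrict U), v.1 x = g x) : D.on v T = g := by
  have h1 := ae_mono (Measure.restrict_mono hUT le_rfl) (on_ae_cell hP v hT)
  refine (D.isPolyOnLines_on v T).eq_of_eqOn hgN hU hUne ?_
  have h2 : ∀ᵐ x ∂(volume.restrict U), D.on v T x = g x := by
    filter_upwards [h, h1] with x ha hb
    rw [← hb, ha]
  exact Measure.eqOn_open_of_ae_eq h2 hU (by fun_prop) hg.continuousOn

theorem on_add (hP : D.IsMesh) (v w : D.V) (T : Cell d) :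
    D.on (v + w) T = D.on v T + D.on w T := by
  by_cases hT : T ∈ D.mesh
  · refine on_eq_of_ae_eq hP _ hT ((D.continuous_on v T).add (D.continuous_on w T))
      ((D.isPolyOnLines_on v T).add (D.isPolyOnLines_on w T))
      (isOpen_cell D.shape T) (cell_nonempty D.shape T) subset_rfl ?_
    have h := ae_mono (Measure.restrict_mono (hP.cell_subset hT) le_rfl) (Lp.coeFn_add v.1 w.1)
    filter_upwards [h, on_ae_cell hP v hT, on_ae_cell hP w hT] with x h1 h2 h3
    rw [Submodule.coe_add, h1, Pi.add_apply, Pi.add_apply, h2, h3]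
  · simp [on, hT]

theorem on_smul (hP : D.IsMesh) (a : ℝ) (v : D.V) (T : Cell d) :
    D.on (a • v) T = a • D.on v T := by
  by_cases hT : T ∈ D.mesh
  · refine on_eq_of_ae_eq hP _ hT ((D.continuous_on v T).const_smul a)
      ((D.isPolyOnLines_on v T).smul a)
      (isOpen_cell D.shape T) (cell_nonempty D.shape T) subset_rfl ?_
    have h := ae_mono (Measure.restrict_mono (hP.cell_subset hT) le_rfl) (Lp.coeFn_smul a v.1)
    filter_upwards [h, on_ae_cell hP v hT] with x h1 h2
    rw [Submodule.coe_smul, h1, Pi.smul_apply, Pi.smul_apply, h2]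
  · simp [on, hT]

theorem ext_on (hP : D.IsMesh) {v w : D.V} (h : ∀ T ∈ D.mesh, ∀ x ∈ cell D.shape T,
    D.on v T x = D.on w T x) : v = w := by
  apply Subtype.ext
  apply Lp.ext
  have hae : ∀ᵐ x ∂(volume.restrict (⋃ T ∈ D.mesh, cell D.shape T)), v.1 x = w.1 x := by
    rw [ae_restrict_biUnion_finset_iff]
    intro T hT
    filter_upwards [on_ae_cell hP v hT, on_ae_cell hP w hT,
      ae_restrict_mem (measurableSet_cell D.shape T)] with x h1 h2 h3
    rw [h1, h2, h T hT x h3]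
  rw [Measure.restrict_congr_set hP.ae_eq] at hae
  exact hae

/-- The restriction `v ↦ v|_T` as a linear map. -/
def onLinear (hP : D.IsMesh) (T : Cell d) : D.V →ₗ[ℝ] (E d → ℝ) where
  toFun v := D.on v T
  map_add' v w := on_add hP v w T
  map_smul' a v := on_smul hP a v T

/-- The linear map `P ↦ P ∘ F_T⁻¹`. -/
def pushLinear (T : Cell d) : MvPolynomial (Fin d) ℝ →ₗ[ℝ] (E d → ℝ) where
  toFun P := pushPoly T P
  map_add' P Q := by ext x; exact pushPoly_add T P Q x
  map_smul' a P := by ext x; exact pushPoly_smul T a P x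

theorem finiteDimensional_V (hP : D.IsMesh) : FiniteDimensional ℝ D.V := by
  set W : {T // T ∈ D.mesh} → Submodule ℝ (E d → ℝ) := fun T =>
    (refPoly d D.shape D.degree).map (pushLinear T.1)
  have hmem : ∀ (T : {T // T ∈ D.mesh}) (v : D.V), onLinear hP T.1 v ∈ W T := by
    intro T v
    obtain ⟨P, hPm, h⟩ := D.exists_on_eq v T.1
    exact ⟨P, hPm, h.symm⟩
  let Φ : D.V →ₗ[ℝ] (∀ T, W T) := LinearMap.pi fun T => (onLinear hP T.1).codRestrict (W T) (hmem T)
  have hinj : Function.Injective Φ := by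
    intro v w hvw
    refine ext_on hP fun T hT x _ => ?_
    exact congrFun (congrArg Subtype.val (congrFun hvw ⟨T, hT⟩)) x
  exact FiniteDimensional.of_injective Φ hinj

end Level

namespace Level

variable {d : ℕ} {Ω : Set (E d)} {D : Level d Ω}

/-! ### The lifting operators -/

/-- The `L²` inner product on `[V]ᵈ`, in terms of which the liftings are Riesz representatives. -/
def pairing (r η : Fin d → D.V) : ℝ := ∑ i, ⟪(r i).1, (η i).1⟫

theorem integral_eq_pairing (r η : Fin d → D.V) :
    ∫ x in Ω, ∑ i, (r i).1 x * (η i).1 x = pairing r η := by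
  have hint : ∀ i, Integrable (fun x => (r i).1 x * (η i).1 x) (volume.restrict Ω) := by
    intro i
    have := L2.integrable_inner (𝕜 := ℝ) (r i).1 (η i).1
    refine this.congr (Filter.Eventually.of_forall fun x => ?_)
    simp [mul_comm]
  rw [integral_finsetSum _ fun i _ => hint i, pairing]
  refine Finset.sum_congr rfl fun i _ => ?_
  rw [L2.inner_def]
  refine integral_congr_ae (Filter.Eventually.of_forall fun x => ?_)
  simp [mul_comm]

theorem pairing_add_left (r r' η : Fin d → D.V) :
    pairing (r + r') η = pairing r η + pairing r' η := by
  simp [pairing, inner_add_left, Finset.sum_add_distrib]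

theorem pairing_smul_left (a : ℝ) (r η : Fin d → D.V) :
    pairing (a • r) η = a * pairing r η := by
  simp [pairing, inner_smul_left, Finset.mul_sum]

theorem pairing_sum_left {ι : Type*} (S : Finset ι) (r : ι → Fin d → D.V) (η : Fin d → D.V) :
    pairing (∑ j ∈ S, r j) η = ∑ j ∈ S, pairing (r j) η := by
  classical
  induction S using Finset.induction_on with
  | empty => simp [pairing]
  | insert j S hj ih => rw [Finset.sum_insert hj, Finset.sum_insert hj, pairing_add_left, ih]

theorem ext_pairing {r r' : Fin d → D.V} (h : ∀ η, pairing r η = pairing r' η) : r = r' := by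
  have h1 : pairing (r + (-1 : ℝ) • r') (r + (-1 : ℝ) • r') = 0 := by
    rw [pairing_add_left, pairing_smul_left, h]; ring
  rw [pairing] at h1
  rw [Finset.sum_eq_zero_iff_of_nonneg fun i _ => real_inner_self_nonneg] at h1
  ext1 i
  have := inner_self_eq_zero.1 (h1 i (Finset.mem_univ i))
  apply Subtype.ext
  simpa [add_neg_eq_zero] using this

theorem exists_pairing_eq (hP : D.IsMesh) (ℓ : (Fin d → D.V) →ₗ[ℝ] ℝ) :
    ∃ r : Fin d → D.V, ∀ η, pairing r η = ℓ η := by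
  have := finiteDimensional_V hP
  have hc : CompleteSpace D.V := FiniteDimensional.complete ℝ D.V
  refine ⟨fun i => (InnerProductSpace.toDual ℝ D.V).symm
    (LinearMap.toContinuousLinearMap (ℓ ∘ₗ LinearMap.single ℝ (fun _ => D.V) i)), fun η => ?_⟩
  have h1 : ∀ i, ⟪((InnerProductSpace.toDual ℝ D.V).symm (LinearMap.toContinuousLinearMap
      (ℓ ∘ₗ LinearMap.single ℝ (fun _ => D.V) i))).1, (η i).1⟫ = ℓ (Pi.single i (η i)) := by
    intro i
    rw [← Submodule.coe_inner, InnerProductSpace.toDual_symm_apply]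
    rfl
  rw [pairing]
  simp only [h1]
  rw [← map_sum, Finset.univ_sum_single]

@[fun_prop]
theorem continuous_jump (v : D.V) (f : Face d) : Continuous (D.jump v f) := by
  unfold jump; fun_prop

@[fun_prop]
theorem continuous_vecOn (η : Fin d → D.V) (T : Cell d) : Continuous (D.vecOn η T) := by
  unfold vecOn; fun_prop

@[fun_prop]
theorem continuous_vecAvg (η : Fin d → D.V) (f : Face d) : Continuous (D.vecAvg η f) := by
  unfold vecAvg; fun_prop

@[fun_prop]
theorem continuous_vecJump (η : Fin d → D.V) (f : Face d) : Continuous (D.vecJump η f) := by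
  unfold vecJump; fun_prop

theorem jump_add (hP : D.IsMesh) (v w : D.V) (f : Face d) (x : E d) :
    D.jump (v + w) f x = D.jump v f x + D.jump w f x := by
  simp [jump, on_add hP, add_smul, Finset.sum_add_distrib]

theorem jump_smul (hP : D.IsMesh) (a : ℝ) (v : D.V) (f : Face d) (x : E d) :
    D.jump (a • v) f x = a • D.jump v f x := by
  simp [jump, on_smul hP, Finset.smul_sum, mul_smul]

theorem vecOn_add (hP : D.IsMesh) (η ξ : Fin d → D.V) (T : Cell d) (x : E d) :
    D.vecOn (η + ξ) T x = D.vecOn η T x + D.vecOn ξ T x := by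
  ext i; simp [vecOn, on_add hP]

theorem vecOn_smul (hP : D.IsMesh) (a : ℝ) (η : Fin d → D.V) (T : Cell d) (x : E d) :
    D.vecOn (a • η) T x = a • D.vecOn η T x := by
  ext i; simp [vecOn, on_smul hP]

theorem vecAvg_add (hP : D.IsMesh) (η ξ : Fin d → D.V) (f : Face d) (x : E d) :
    D.vecAvg (η + ξ) f x = D.vecAvg η f x + D.vecAvg ξ f x := by
  simp [vecAvg, vecOn_add hP, Finset.sum_add_distrib]

theorem vecAvg_smul (hP : D.IsMesh) (a : ℝ) (η : Fin d → D.V) (f : Face d) (x : E d) :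
    D.vecAvg (a • η) f x = a • D.vecAvg η f x := by
  simp only [vecAvg, vecOn_smul hP, ← Finset.smul_sum, smul_comm a]

theorem vecJump_add (hP : D.IsMesh) (η ξ : Fin d → D.V) (f : Face d) (x : E d) :
    D.vecJump (η + ξ) f x = D.vecJump η f x + D.vecJump ξ f x := by
  simp [vecJump, vecOn_add hP, inner_add_left, Finset.sum_add_distrib]

theorem vecJump_smul (hP : D.IsMesh) (a : ℝ) (η : Fin d → D.V) (f : Face d) (x : E d) :
    D.vecJump (a • η) f x = a * D.vecJump η f x := by
  simp [vecJump, vecOn_smul hP, inner_smul_left, Finset.mul_sum]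

theorem pairing_epsilon (hP : D.IsMesh) (ℓ : (Fin d → D.V) →ₗ[ℝ] ℝ) (η : Fin d → D.V) :
    pairing (Classical.epsilon fun r : Fin d → D.V => ∀ η : Fin d → D.V,
      ∫ x in Ω, ∑ i, (r i).1 x * (η i).1 x = ℓ η) η = ℓ η := by
  obtain ⟨r, hr⟩ := exists_pairing_eq hP ℓ
  rw [← integral_eq_pairing]
  exact Classical.epsilon_spec (p := fun r : Fin d → D.V => ∀ η : Fin d → D.V,
    ∫ x in Ω, ∑ i, (r i).1 x * (η i).1 x = ℓ η)
    ⟨r, fun η => (integral_eq_pairing r η).trans (hr η)⟩ η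

theorem pairing_liftR (hP : D.IsMesh) {f : Face d} (hf : f ∈ faces D.shape Ω D.mesh)
    {τ : E d → E d} (hτ : Continuous τ) (η : Fin d → D.V) :
    pairing (D.liftR f τ) η = -∫ x in f.carrier, ⟪τ x, D.vecAvg η f x⟫ ∂(surface d) := by
  have hint : ∀ η, IntegrableOn (fun x => ⟪τ x, D.vecAvg η f x⟫) f.carrier (surface d) :=
    fun η => integrableOn_carrier hP hf (by fun_prop)
  exact pairing_epsilon hP
    { toFun := fun η => -∫ x in f.carrier, ⟪τ x, D.vecAvg η f x⟫ ∂(surface d)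
      map_add' := fun η ξ => by
        simp only [vecAvg_add hP, inner_add_right]
        rw [integral_add (hint η) (hint ξ), neg_add]
      map_smul' := fun a η => by
        simp only [vecAvg_smul hP, inner_smul_right, integral_const_mul, RingHom.id_apply,
          smul_eq_mul, mul_neg] } η

theorem pairing_liftL (hP : D.IsMesh) {f : Face d} (hf : f ∈ faces D.shape Ω D.mesh)
    {q : E d → ℝ} (hq : Continuous q) (η : Fin d → D.V) :
    pairing (D.liftL f q) η = -∫ x in f.carrier, q x * D.vecJump η f x ∂(surface d) := by
  have hint : ∀ η, IntegrableOn (fun x => q x * D.vecJump η f x) f.carrier (surface d) :=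
    fun η => integrableOn_carrier hP hf (by fun_prop)
  exact pairing_epsilon hP
    { toFun := fun η => -∫ x in f.carrier, q x * D.vecJump η f x ∂(surface d)
      map_add' := fun η ξ => by
        simp only [vecJump_add hP, mul_add]
        rw [integral_add (hint η) (hint ξ), neg_add]
      map_smul' := fun a η => by
        simp only [vecJump_smul hP, mul_left_comm _ a, integral_const_mul, RingHom.id_apply,
          smul_eq_mul, mul_neg] } η

theorem pairing_lift (hP : D.IsMesh) (v : D.V) (η : Fin d → D.V) :
    pairing (D.lift v) η =
      (∑ f ∈ faces D.shape Ω D.mesh,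
        -∫ x in f.carrier, ⟪D.jump v f x, D.vecAvg η f x⟫ ∂(surface d)) +
      ∑ f ∈ interiorFaces D.shape D.mesh,
        -∫ x in f.carrier, ⟪D.β f, D.jump v f x⟫ * D.vecJump η f x ∂(surface d) := by
  rw [lift, pairing_add_left, pairing_sum_left, pairing_sum_left]
  congr 1
  · exact Finset.sum_congr rfl fun f hf => pairing_liftR hP hf (by fun_prop) η
  · exact Finset.sum_congr rfl fun f hf =>
      pairing_liftL hP (mem_faces_of_mem_interiorFaces hf) (by fun_prop) η

theorem lift_add (hP : D.IsMesh) (v w : D.V) : D.lift (v + w) = D.lift v + D.lift w := by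
  refine ext_pairing fun η => ?_
  rw [pairing_add_left, pairing_lift hP, pairing_lift hP, pairing_lift hP, add_add_add_comm,
    ← Finset.sum_add_distrib, ← Finset.sum_add_distrib]
  congr 1
  · refine Finset.sum_congr rfl fun f hf => ?_
    simp only [jump_add hP, inner_add_left]
    rw [integral_add (integrableOn_carrier hP hf (by fun_prop))
      (integrableOn_carrier hP hf (by fun_prop))]
    ring
  · refine Finset.sum_congr rfl fun f hf => ?_
    have hf' := mem_faces_of_mem_interiorFaces (Ω := Ω) hf
    simp only [jump_add hP, inner_add_right, add_mul]
    rw [integral_add (integrableOn_carrier hP hf' (by fun_prop))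
      (integrableOn_carrier hP hf' (by fun_prop))]
    ring

theorem lift_smul (hP : D.IsMesh) (a : ℝ) (v : D.V) : D.lift (a • v) = a • D.lift v := by
  refine ext_pairing fun η => ?_
  rw [pairing_smul_left, pairing_lift hP, pairing_lift hP, mul_add, Finset.mul_sum,
    Finset.mul_sum]
  congr 1
  · refine Finset.sum_congr rfl fun f _ => ?_
    simp only [jump_smul hP, real_inner_smul_left, integral_const_mul]
    ring
  · refine Finset.sum_congr rfl fun f _ => ?_
    simp only [jump_smul hP, real_inner_smul_right, mul_assoc, integral_const_mul]
    ring

/-! ### The bilinear form -/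

theorem liftFn_ae_cell (hP : D.IsMesh) (v : D.V) {T : Cell d} (hT : T ∈ D.mesh) :
    ∀ᵐ x ∂(volume.restrict (cell D.shape T)), D.liftFn v x = D.vecOn (D.lift v) T x := by
  have h : ∀ᵐ x ∂(volume.restrict (cell D.shape T)), ∀ i,
      (D.lift v i).1 x = D.on (D.lift v i) T x :=
    ae_all_iff.2 fun i => on_ae_cell hP (D.lift v i) hT
  filter_upwards [h] with x hx
  ext i
  exact hx i

/-- The broken `L²` inner product of two piecewise vector fields, each given by one vector field
per element. -/
def brokenInner (D : Level d Ω) (a b : Cell d → E d → E d) : ℝ :=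
  ∑ T ∈ D.mesh, ∫ x in cell D.shape T, ⟪a T x, b T x⟫

theorem integrableOn_inner_cell {s : Shape} {a b : E d → E d} (ha : Continuous a)
    (hb : Continuous b) (T : Cell d) : IntegrableOn (fun x => ⟪a x, b x⟫) (cell s T) :=
  integrableOn_cell (by fun_prop) T

theorem brokenInner_comm (a b : Cell d → E d → E d) : D.brokenInner a b = D.brokenInner b a := by
  simp only [brokenInner, real_inner_comm]

theorem brokenInner_add_left {a a' b : Cell d → E d → E d} (ha : ∀ T, Continuous (a T))
    (ha' : ∀ T, Continuous (a' T)) (hb : ∀ T, Continuous (b T)) :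
    D.brokenInner (a + a') b = D.brokenInner a b + D.brokenInner a' b := by
  simp only [brokenInner, Pi.add_apply, inner_add_left, ← Finset.sum_add_distrib]
  exact Finset.sum_congr rfl fun T _ => integral_add (integrableOn_inner_cell (ha T) (hb T) T)
    (integrableOn_inner_cell (ha' T) (hb T) T)

theorem brokenInner_smul_left (c : ℝ) (a b : Cell d → E d → E d) :
    D.brokenInner (c • a) b = c * D.brokenInner a b := by
  simp only [brokenInner, Pi.smul_apply, real_inner_smul_left, integral_const_mul, Finset.mul_sum]

theorem brokenInner_self_nonneg (a : Cell d → E d → E d) : 0 ≤ D.brokenInner a a :=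
  Finset.sum_nonneg fun _ _ => integral_nonneg fun _ => real_inner_self_nonneg

theorem brokenInner_add_smul_self {a b : Cell d → E d → E d} (ha : ∀ T, Continuous (a T))
    (hb : ∀ T, Continuous (b T)) (c : ℝ) :
    D.brokenInner (a + c • b) (a + c • b) =
      D.brokenInner a a + 2 * c * D.brokenInner a b + c ^ 2 * D.brokenInner b b := by
  have hcb : ∀ T, Continuous ((c • b) T) := fun T => (hb T).const_smul c
  have hacb : ∀ T, Continuous ((a + c • b) T) := fun T => (ha T).add (hcb T)
  rw [brokenInner_add_left ha hcb hacb, brokenInner_smul_left, brokenInner_comm a,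
    brokenInner_comm b, brokenInner_add_left ha hcb ha, brokenInner_add_left ha hcb hb,
    brokenInner_smul_left, brokenInner_smul_left, brokenInner_comm b a]
  ring

theorem abs_two_mul_brokenInner_le {a b : Cell d → E d → E d} (ha : ∀ T, Continuous (a T))
    (hb : ∀ T, Continuous (b T)) {ε : ℝ} (hε : 0 < ε) :
    |2 * D.brokenInner a b| ≤ ε * D.brokenInner a a + ε⁻¹ * D.brokenInner b b := by
  have hsq : ∀ c : ℝ, c ^ 2 = 1 → 0 ≤ ε * D.brokenInner a a + 2 * c * D.brokenInner a b +
      ε⁻¹ * D.brokenInner b b := fun c hc =>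
    calc 0 ≤ ε * D.brokenInner (a + (c * ε⁻¹) • b) (a + (c * ε⁻¹) • b) :=
          mul_nonneg hε.le (brokenInner_self_nonneg _)
      _ = ε * D.brokenInner a a + 2 * c * D.brokenInner a b + c ^ 2 * ε⁻¹ * D.brokenInner b b := by
          rw [brokenInner_add_smul_self ha hb]
          field_simp
      _ = _ := by rw [hc, one_mul]
  have hpos := hsq 1 (by norm_num)
  have hneg := hsq (-1) (by norm_num)
  rw [abs_le]
  constructor <;> linarith

/-- The broken (elementwise) gradient. -/
def grad (v : D.V) : Cell d → E d → E d := fun T => gradient (D.on v T)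

/-- The lifting `ℛ(⟦v⟧) + ℒ(β · ⟦v⟧)`, element by element. -/
def liftOn (v : D.V) : Cell d → E d → E d := fun T => D.vecOn (D.lift v) T

theorem continuous_grad (v : D.V) (T : Cell d) : Continuous (grad v T) :=
  D.continuous_gradient_on v T

theorem continuous_liftOn (v : D.V) (T : Cell d) : Continuous (liftOn v T) :=
  continuous_vecOn _ T

/-- The penalty terms `∑_F ∫_F σ ⟦w⟧ · ⟦v⟧` of the DG form. -/
def jumpForm (w v : D.V) : ℝ := ∑ f ∈ faces D.shape Ω D.mesh,
    (∫ x in f.carrier, D.σ f * ⟪D.jump w f x, D.jump v f x⟫ ∂(surface d))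

theorem form_eq (hP : D.IsMesh) (w v : D.V) :
    D.form w v = D.brokenInner (grad w) (grad v) + D.brokenInner (grad w) (liftOn v) +
      D.brokenInner (liftOn w) (grad v) + jumpForm w v +
      D.θ * D.brokenInner (liftOn w) (liftOn v) := by
  have h2 : ∫ x in Ω, ⟪D.liftFn w x, D.liftFn v x⟫ = D.brokenInner (liftOn w) (liftOn v) := by
    have hae : ∀ T ∈ D.mesh, (fun x => ⟪D.liftFn w x, D.liftFn v x⟫)
        =ᵐ[volume.restrict (cell D.shape T)] fun x => ⟪liftOn w T x, liftOn v T x⟫ := by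
      intro T hT
      filter_upwards [liftFn_ae_cell hP w hT, liftFn_ae_cell hP v hT] with x h1 h2
      rw [h1, h2]; rfl
    rw [hP.integral_eq_sum fun T hT => (integrableOn_inner_cell (continuous_liftOn w T)
      (continuous_liftOn v T) T).congr (hae T hT).symm]
    exact Finset.sum_congr rfl fun T hT => integral_congr_ae (hae T hT)
  have h3 : ∑ T ∈ D.mesh, ∫ x in cell D.shape T, ⟪gradient (D.on w T) x, D.liftFn v x⟫ =
      D.brokenInner (grad w) (liftOn v) := by
    refine Finset.sum_congr rfl fun T hT => integral_congr_ae ?_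
    filter_upwards [liftFn_ae_cell hP v hT] with x h1
    rw [h1]; rfl
  have h4 : ∑ T ∈ D.mesh, ∫ x in cell D.shape T, ⟪D.liftFn w x, gradient (D.on v T) x⟫ =
      D.brokenInner (liftOn w) (grad v) := by
    refine Finset.sum_congr rfl fun T hT => integral_congr_ae ?_
    filter_upwards [liftFn_ae_cell hP w hT] with x h1
    rw [h1]; rfl
  rw [form, h2, h3, h4]
  rfl

theorem jumpForm_comm (w v : D.V) : jumpForm w v = jumpForm v w := by
  simp only [jumpForm, real_inner_comm]

theorem form_comm (hP : D.IsMesh) (w v : D.V) : D.form w v = D.form v w := by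
  rw [form_eq hP, form_eq hP, brokenInner_comm (grad w) (grad v),
    brokenInner_comm (grad w) (liftOn v), brokenInner_comm (liftOn w) (grad v),
    brokenInner_comm (liftOn w) (liftOn v), jumpForm_comm]
  ring

theorem grad_add (hP : D.IsMesh) (v w : D.V) : grad (v + w) = grad v + grad w := by
  ext1 T; ext1 x
  simp only [grad, gradient, on_add hP, Pi.add_apply]
  rw [fderiv_add ((D.contDiff_on v T).differentiable (by norm_num) x)
    ((D.contDiff_on w T).differentiable (by norm_num) x), map_add]

theorem grad_smul (hP : D.IsMesh) (a : ℝ) (v : D.V) : grad (a • v) = a • grad v := by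
  ext1 T; ext1 x
  simp only [grad, gradient, on_smul hP, Pi.smul_apply]
  rw [fderiv_const_smul ((D.contDiff_on v T).differentiable (by norm_num) x)]
  simp

theorem liftOn_add (hP : D.IsMesh) (v w : D.V) : liftOn (v + w) = liftOn v + liftOn w := by
  ext1 T; ext1 x
  simp only [liftOn, lift_add hP, vecOn_add hP, Pi.add_apply]

theorem liftOn_smul (hP : D.IsMesh) (a : ℝ) (v : D.V) : liftOn (a • v) = a • liftOn v := by
  ext1 T; ext1 x
  simp only [liftOn, lift_smul hP, vecOn_smul hP, Pi.smul_apply]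

theorem jumpForm_add_left (hP : D.IsMesh) (v v' w : D.V) :
    jumpForm (v + v') w = jumpForm v w + jumpForm v' w := by
  simp only [jumpForm, jump_add hP, inner_add_left, mul_add, ← Finset.sum_add_distrib]
  exact Finset.sum_congr rfl fun f hf => integral_add
    (integrableOn_carrier hP hf (by fun_prop)) (integrableOn_carrier hP hf (by fun_prop))

theorem jumpForm_smul_left (hP : D.IsMesh) (a : ℝ) (v w : D.V) :
    jumpForm (a • v) w = a * jumpForm v w := by
  simp only [jumpForm, jump_smul hP, real_inner_smul_left, mul_left_comm _ a, integral_const_mul,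
    Finset.mul_sum]

theorem form_add_left (hP : D.IsMesh) (v v' w : D.V) :
    D.form (v + v') w = D.form v w + D.form v' w := by
  simp only [form_eq hP, grad_add hP, liftOn_add hP, jumpForm_add_left hP,
    brokenInner_add_left (continuous_grad v) (continuous_grad v') (continuous_grad w),
    brokenInner_add_left (continuous_grad v) (continuous_grad v') (continuous_liftOn w),
    brokenInner_add_left (continuous_liftOn v) (continuous_liftOn v') (continuous_grad w),
    brokenInner_add_left (continuous_liftOn v) (continuous_liftOn v') (continuous_liftOn w)]
  ring

theorem form_smul_left (hP : D.IsMesh) (a : ℝ) (v w : D.V) :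
    D.form (a • v) w = a * D.form v w := by
  simp only [form_eq hP, grad_smul hP, liftOn_smul hP, jumpForm_smul_left hP, brokenInner_smul_left]
  ring

/-- The DG form as a bilinear map. -/
def bilin (hP : D.IsMesh) : D.V →ₗ[ℝ] D.V →ₗ[ℝ] ℝ :=
  LinearMap.mk₂ ℝ D.form (form_add_left hP) (form_smul_left hP)
    (fun v w w' => by rw [form_comm hP, form_add_left hP, form_comm hP w, form_comm hP w'])
    (fun a v w => by rw [form_comm hP, form_smul_left hP, form_comm hP w]; rfl)

end Level

/-! ### Shape regular, quasi-uniform meshes -/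

/-- A bound for the number of neighbours of an element. -/
def neighbourBound (d : ℕ) (κ₁ κ₂ : ℝ) : ℝ := ((1 + κ₂) * κ₁ * κ₂) ^ d

/-- A bound for the number of faces of an element. -/
def faceBound (d : ℕ) (s : Shape) (κ₁ κ₂ : ℝ) : ℝ :=
  neighbourBound d κ₁ κ₂ + (refFacets_finite d s).toFinset.card

section Regular

variable {d : ℕ} {s : Shape} {Ω : Set (E d)} {𝒯 : Finset (Cell d)} {κ₁ κ₂ : ℝ}

theorem IsShapeRegular.pos (hd : 0 < d) (hreg : IsShapeRegular s κ₁ 𝒯) {T : Cell d}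
    (hT : T ∈ 𝒯) : 0 < κ₁ := by
  obtain ⟨x, r, hr, -, hdiam⟩ := hreg T hT
  exact pos_of_mul_pos_left ((diam_cell_pos s T hd).trans_le hdiam) hr.le

theorem IsQuasiUniform.one_le (hd : 0 < d) (hqu : IsQuasiUniform s κ₂ 𝒯) {T : Cell d}
    (hT : T ∈ 𝒯) : 1 ≤ κ₂ :=
  le_of_mul_le_mul_right ((one_mul _).trans_le (hqu T hT T hT)) (diam_cell_pos s T hd)

theorem IsPartition.card_le_of_subset_closedBall (hP : IsPartition s Ω 𝒯)
    (hreg : IsShapeRegular s κ₁ 𝒯) (h₁ : 0 < κ₁) {S : Finset (Cell d)} (hS : S ⊆ 𝒯) {x : E d}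
    {R h : ℝ} (hR : 0 ≤ R) (hh : 0 < h) (hdiam : ∀ T ∈ S, h ≤ Metric.diam (cell s T))
    (hball : ∀ T ∈ S, cell s T ⊆ Metric.closedBall x R) :
    (S.card : ℝ) ≤ (κ₁ * R / h) ^ d := by
  have hinner : ∀ T ∈ S, ∃ y, Metric.ball y (h / κ₁) ⊆ cell s T := fun T hT => by
    obtain ⟨y, r, -, hr, hdr⟩ := hreg T (hS hT)
    exact ⟨y, (Metric.ball_subset_ball
      ((div_le_iff₀' h₁).2 ((hdiam T hT).trans hdr))).trans hr⟩
  calc (S.card : ℝ) ≤ (R / (h / κ₁)) ^ Module.finrank ℝ (E d) :=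
        card_le_of_disjoint_balls hR (by positivity)
          (fun T hT T' hT' hne => hP.disjoint T (hS hT) T' (hS hT') hne) hinner hball
    _ = (κ₁ * R / h) ^ d := by
        rw [finrank_euclideanSpace_fin]
        congr 1
        field_simp

open Classical in
/-- The elements whose closure meets that of `T`, including `T` itself. -/
def neighbours (s : Shape) (𝒯 : Finset (Cell d)) (T : Cell d) : Finset (Cell d) :=
  𝒯.filter fun T' => (closure (cell s T) ∩ closure (cell s T')).Nonempty

open Classical in
theorem mem_neighbours {T T' : Cell d} :
    T' ∈ neighbours s 𝒯 T ↔ T' ∈ 𝒯 ∧ (closure (cell s T) ∩ closure (cell s T')).Nonempty :=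
  Finset.mem_filter

theorem card_neighbours_le (hd : 0 < d) (hP : IsPartition s Ω 𝒯) (hreg : IsShapeRegular s κ₁ 𝒯)
    (hqu : IsQuasiUniform s κ₂ 𝒯) {T : Cell d} (hT : T ∈ 𝒯) :
    ((neighbours s 𝒯 T).card : ℝ) ≤ neighbourBound d κ₁ κ₂ := by
  have h₁ := hreg.pos hd hT
  have h₂ : 0 < κ₂ := one_pos.trans_le (hqu.one_le hd hT)
  have hdiam := diam_cell_pos s T hd
  obtain ⟨x, hx⟩ := cell_nonempty s T
  have hball : ∀ T' ∈ neighbours s 𝒯 T,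
      cell s T' ⊆ Metric.closedBall x ((1 + κ₂) * Metric.diam (cell s T)) := by
    intro T' hT' y hy
    obtain ⟨hT'm, z, hz, hz'⟩ := mem_neighbours.1 hT'
    have hzx := Metric.dist_le_diam_of_mem (isBounded_cell s T).closure hz (subset_closure hx)
    have hyz := Metric.dist_le_diam_of_mem (isBounded_cell s T').closure (subset_closure hy) hz'
    rw [Metric.diam_closure] at hzx hyz
    rw [Metric.mem_closedBall]
    linarith [dist_triangle y z x, hqu T' hT'm T hT]
  calc ((neighbours s 𝒯 T).card : ℝ)
      ≤ (κ₁ * ((1 + κ₂) * Metric.diam (cell s T)) / (Metric.diam (cell s T) / κ₂)) ^ d :=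
        hP.card_le_of_subset_closedBall hreg h₁ (fun _ hT' => (mem_neighbours.1 hT').1)
          (by positivity) (by positivity)
          (fun T' hT' => (div_le_iff₀' h₂).2 (hqu T hT T' (mem_neighbours.1 hT').1)) hball
    _ = neighbourBound d κ₁ κ₂ := by
        rw [neighbourBound]
        congr 1
        field_simp

open Classical in
theorem filter_mem_cells_subset (T : Cell d) :
    ((faces s Ω 𝒯).filter fun f => T ∈ f.cells) ⊆
      (neighbours s 𝒯 T).image
          (fun T' => (⟨{T, T'}, closure (cell s T) ∩ closure (cell s T')⟩ : Face d)) ∪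
        (refFacets_finite d s).toFinset.image
          (fun G => (⟨{T}, T '' G ∩ frontier Ω⟩ : Face d)) := by
  intro f hf
  obtain ⟨hf, hTf⟩ := Finset.mem_filter.1 hf
  have hne := carrier_nonempty hf
  rw [Finset.mem_union, Finset.mem_image, Finset.mem_image]
  rcases mem_faces.1 hf with h | h
  · left
    obtain ⟨T₁, hT₁, T₂, hT₂, _, rfl, _⟩ := mem_interiorFaces.1 h
    simp only [Finset.mem_insert, Finset.mem_singleton] at hTf
    rcases hTf with rfl | rfl
    · exact ⟨T₂, mem_neighbours.2 ⟨hT₂, hne⟩, rfl⟩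
    · refine ⟨T₁, mem_neighbours.2 ⟨hT₁, by rwa [Set.inter_comm]⟩, ?_⟩
      rw [Set.inter_comm, Finset.pair_comm]
  · right
    obtain ⟨T₁, -, G, hG, rfl, _⟩ := mem_boundaryFaces.1 h
    rw [Finset.mem_singleton.1 hTf]
    exact ⟨G, (Set.Finite.mem_toFinset _).2 hG, rfl⟩

open Classical in
theorem card_faces_le (hd : 0 < d) (hP : IsPartition s Ω 𝒯) (hreg : IsShapeRegular s κ₁ 𝒯)
    (hqu : IsQuasiUniform s κ₂ 𝒯) {T : Cell d} (hT : T ∈ 𝒯) :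
    (((faces s Ω 𝒯).filter fun f => T ∈ f.cells).card : ℝ) ≤ faceBound d s κ₁ κ₂ := by
  have hcard : ((faces s Ω 𝒯).filter fun f => T ∈ f.cells).card ≤
      (neighbours s 𝒯 T).card + (refFacets_finite d s).toFinset.card :=
    (Finset.card_le_card (filter_mem_cells_subset T)).trans ((Finset.card_union_le _ _).trans
      (add_le_add Finset.card_image_le Finset.card_image_le))
  calc (((faces s Ω 𝒯).filter fun f => T ∈ f.cells).card : ℝ)
      ≤ (neighbours s 𝒯 T).card + (refFacets_finite d s).toFinset.card := by exact_mod_cast hcard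
    _ ≤ faceBound d s κ₁ κ₂ := add_le_add_left (card_neighbours_le hd hP hreg hqu hT) _

theorem sum_faces_sum_cells_le (hd : 0 < d) (hP : IsPartition s Ω 𝒯)
    (hreg : IsShapeRegular s κ₁ 𝒯) (hqu : IsQuasiUniform s κ₂ 𝒯) {g : Cell d → ℝ}
    (hg : ∀ T ∈ 𝒯, 0 ≤ g T) :
    ∑ f ∈ faces s Ω 𝒯, ∑ T ∈ f.cells, g T ≤ faceBound d s κ₁ κ₂ * ∑ T ∈ 𝒯, g T := by
  classical
  calc ∑ f ∈ faces s Ω 𝒯, ∑ T ∈ f.cells, g T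
      = ∑ T ∈ 𝒯, ∑ _f ∈ (faces s Ω 𝒯).filter fun f => T ∈ f.cells, g T :=
        Finset.sum_comm' fun f T => by
          simp only [Finset.mem_filter]
          exact ⟨fun h => ⟨h, mem_mesh_of_mem_cells h.1 h.2⟩, fun h => h.1⟩
    _ = ∑ T ∈ 𝒯, (((faces s Ω 𝒯).filter fun f => T ∈ f.cells).card : ℝ) * g T := by
        simp only [Finset.sum_const, nsmul_eq_mul]
    _ ≤ ∑ T ∈ 𝒯, faceBound d s κ₁ κ₂ * g T := Finset.sum_le_sum fun T hT =>
        mul_le_mul_of_nonneg_right (card_faces_le hd hP hreg hqu hT) (hg T hT)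
    _ = _ := (Finset.mul_sum _ _ _).symm

end Regular

/-! ### Stability of the lifting operators -/

/-- The size `min (h_{T⁺}, h_{T⁻})` of a face. -/
def faceSize {d : ℕ} (s : Shape) (f : Face d) : ℝ :=
  ⨅ T : {T // T ∈ f.cells}, Metric.diam (cell s T.1)

theorem faceSize_le {d : ℕ} {s : Shape} {f : Face d} {T : Cell d} (hT : T ∈ f.cells) :
    faceSize s f ≤ Metric.diam (cell s T) := by
  have hfin : BddBelow (Set.range fun T : {T // T ∈ f.cells} => Metric.diam (cell s T.1)) :=
    ⟨0, by rintro _ ⟨T, rfl⟩; exact Metric.diam_nonneg⟩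
  exact ciInf_le hfin (⟨T, hT⟩ : {T // T ∈ f.cells})

theorem exists_faceSize_eq {d : ℕ} {s : Shape} {f : Face d} (hf : f.cells.Nonempty) :
    ∃ T ∈ f.cells, faceSize s f = Metric.diam (cell s T) := by
  have : Nonempty {T // T ∈ f.cells} := ⟨⟨hf.choose, hf.choose_spec⟩⟩
  obtain ⟨T, hT⟩ := exists_eq_ciInf_of_finite
    (f := fun T : {T // T ∈ f.cells} => Metric.diam (cell s T.1))
  exact ⟨T.1, T.2, hT.symm⟩

theorem faceSize_pos {d : ℕ} (hd : 0 < d) {s : Shape} {f : Face d} (hf : f.cells.Nonempty) :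
    0 < faceSize s f := by
  obtain ⟨T, -, h⟩ := exists_faceSize_eq (s := s) hf
  rw [h]; exact diam_cell_pos s T hd

/-- The constant of the trace inverse inequality. -/
def traceConst (d : ℕ) (κ₁ : ℝ) : ℝ := 16 * 2 ^ (d - 1) * (d + 2) ^ 2 * κ₁

/-- The constant of the stability bound for the lifting operators. -/
def liftConst (d : ℕ) (s : Shape) (κ₁ κ₂ B : ℝ) : ℝ :=
  4 * (1 + B) ^ 2 * (traceConst d κ₁ * faceBound d s κ₁ κ₂)

theorem traceConst_pos {d : ℕ} {κ₁ : ℝ} (h₁ : 0 < κ₁) : 0 < traceConst d κ₁ := by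
  unfold traceConst; positivity

theorem faceBound_pos {d : ℕ} {s : Shape} {κ₁ κ₂ : ℝ} (h₁ : 0 < κ₁) (h₂ : 0 < κ₂) :
    0 < faceBound d s κ₁ κ₂ := by
  unfold faceBound neighbourBound; positivity

theorem liftConst_pos {d : ℕ} {s : Shape} {κ₁ κ₂ B : ℝ} (h₁ : 0 < κ₁) (h₂ : 0 < κ₂) (hB : 0 ≤ B) :
    0 < liftConst d s κ₁ κ₂ B := by
  have := traceConst_pos (d := d) h₁
  have := faceBound_pos (d := d) (s := s) h₁ h₂
  unfold liftConst; positivity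

theorem mul_sum_le_young {ι : Type*} (S : Finset ι) (m : ι → ℝ) (a : ℝ) {c : ℝ} (hc : 0 < c) :
    a * ∑ i ∈ S, m i ≤ c / 2 * a ^ 2 + S.card / (2 * c) * ∑ i ∈ S, m i ^ 2 :=
  calc a * ∑ i ∈ S, m i ≤ c / 2 * a ^ 2 + (2 * c)⁻¹ * (∑ i ∈ S, m i) ^ 2 := by
        have hsq : 0 ≤ (2 * c)⁻¹ * (c * a - ∑ i ∈ S, m i) ^ 2 := by positivity
        have hexp : (2 * c)⁻¹ * (c * a - ∑ i ∈ S, m i) ^ 2 =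
            c / 2 * a ^ 2 + (2 * c)⁻¹ * (∑ i ∈ S, m i) ^ 2 - a * ∑ i ∈ S, m i := by
          field_simp
          ring
        linarith
    _ ≤ c / 2 * a ^ 2 + (2 * c)⁻¹ * (S.card * ∑ i ∈ S, m i ^ 2) := by
        gcongr
        exact sq_sum_le_card_mul_sum_sq
    _ = _ := by ring

namespace Level

variable {d : ℕ} {Ω : Set (E d)} {D : Level d Ω} {κ₁ κ₂ B : ℝ}

theorem σ_eq (f : Face d) : D.σ f = D.α * (D.degree : ℝ) ^ 2 / faceSize D.shape f := rfl

theorem pairing_eq_brokenInner (hP : D.IsMesh) (r η : Fin d → D.V) :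
    pairing r η = D.brokenInner (D.vecOn r) (D.vecOn η) := by
  rw [← integral_eq_pairing]
  have hae : ∀ T ∈ D.mesh, (fun x => ∑ i, (r i).1 x * (η i).1 x)
      =ᵐ[volume.restrict (cell D.shape T)] fun x => ⟪D.vecOn r T x, D.vecOn η T x⟫ := by
    intro T hT
    have h1 : ∀ᵐ x ∂(volume.restrict (cell D.shape T)), ∀ i, (r i).1 x = D.on (r i) T x :=
      ae_all_iff.2 fun i => on_ae_cell hP (r i) hT
    have h2 : ∀ᵐ x ∂(volume.restrict (cell D.shape T)), ∀ i, (η i).1 x = D.on (η i) T x :=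
      ae_all_iff.2 fun i => on_ae_cell hP (η i) hT
    filter_upwards [h1, h2] with x h1 h2
    rw [PiLp.inner_apply]
    refine Finset.sum_congr rfl fun i _ => ?_
    rw [h1, h2]
    simp [vecOn, mul_comm]
  rw [hP.integral_eq_sum fun T hT => (integrableOn_inner_cell (continuous_vecOn r T)
      (continuous_vecOn η T) T).congr (hae T hT).symm]
  exact Finset.sum_congr rfl fun T hT => integral_congr_ae (hae T hT)

theorem integral_sq_on_le (hreg : IsShapeRegular D.shape κ₁ D.mesh) (hP : D.IsMesh) (hd : 0 < d)
    (hp : 1 ≤ D.degree) (v : D.V) {f : Face d} (hf : f ∈ faces D.shape Ω D.mesh) {T : Cell d}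
    (hT : T ∈ f.cells) :
    faceSize D.shape f / (D.degree : ℝ) ^ 2 * ∫ x in f.carrier, D.on v T x ^ 2 ∂(surface d) ≤
      traceConst d κ₁ * ∫ x in cell D.shape T, D.on v T x ^ 2 := by
  have hTm := mem_mesh_of_mem_cells hf hT
  obtain ⟨x₀, r, hr, hball, hdiam⟩ := hreg T hTm
  have hκ := hreg.pos hd hTm
  have hp0 : (1 : ℝ) ≤ D.degree := by exact_mod_cast hp
  have htrace := (isFacet_normal hP hf hT).integral_sq_le (convex_cell D.shape T)
    (isBounded_cell D.shape T) hr hball (D.continuous_on v T) (D.isPolyOnLines_on v T)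
  have : 0 ≤ ∫ x in cell D.shape T, D.on v T x ^ 2 := integral_nonneg fun _ => sq_nonneg _
  have hsize : faceSize D.shape f ≤ κ₁ * r := (faceSize_le hT).trans hdiam
  have hsize_pos := faceSize_pos hd (s := D.shape) (cells_nonempty hf)
  have hN : ((d * D.degree + D.degree : ℕ) : ℝ) + 1 ≤ (d + 2) * D.degree := by
    push_cast; linarith
  calc _ ≤ faceSize D.shape f / (D.degree : ℝ) ^ 2 * (16 * 2 ^ (d - 1) *
        (((d * D.degree + D.degree : ℕ) : ℝ) + 1) ^ 2 / r *
          ∫ x in cell D.shape T, D.on v T x ^ 2) := by gcongr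
    _ ≤ (κ₁ * r) / (D.degree : ℝ) ^ 2 * (16 * 2 ^ (d - 1) *
        ((d + 2) * D.degree) ^ 2 / r * ∫ x in cell D.shape T, D.on v T x ^ 2) := by gcongr
    _ = _ := by
      rw [traceConst]
      field_simp

theorem norm_sq_vecOn (η : Fin d → D.V) (T : Cell d) (x : E d) :
    ‖D.vecOn η T x‖ ^ 2 = ∑ i, D.on (η i) T x ^ 2 := by
  simp [EuclideanSpace.norm_sq_eq, vecOn]

theorem integral_norm_sq_vecOn_le (hP : D.IsMesh) (hreg : IsShapeRegular D.shape κ₁ D.mesh)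
    (hd : 0 < d) (hp : 1 ≤ D.degree) (η : Fin d → D.V) {f : Face d}
    (hf : f ∈ faces D.shape Ω D.mesh) {T : Cell d} (hT : T ∈ f.cells) :
    faceSize D.shape f / (D.degree : ℝ) ^ 2 *
      ∫ x in f.carrier, ‖D.vecOn η T x‖ ^ 2 ∂(surface d) ≤
      traceConst d κ₁ * ∫ x in cell D.shape T, ⟪D.vecOn η T x, D.vecOn η T x⟫ := by
  simp only [real_inner_self_eq_norm_sq, norm_sq_vecOn]
  rw [integral_finsetSum _ fun i _ => integrableOn_carrier hP hf (by fun_prop),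
    integral_finsetSum _ fun i _ => integrableOn_cell (by fun_prop) T, Finset.mul_sum,
    Finset.mul_sum]
  exact Finset.sum_le_sum fun i _ => integral_sq_on_le hreg hP hd hp (η i) hf hT

/-- The contribution `p² / h_f ‖⟦v⟧‖²` of the face `f` to the squared jump seminorm. -/
def faceJumpSq (v : D.V) (f : Face d) : ℝ :=
  (D.degree : ℝ) ^ 2 / faceSize D.shape f * ∫ x in f.carrier, ‖D.jump v f x‖ ^ 2 ∂(surface d)

theorem faceJumpSq_nonneg (hd : 0 < d) (v : D.V) {f : Face d} (hf : f ∈ faces D.shape Ω D.mesh) :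
    0 ≤ faceJumpSq v f :=
  mul_nonneg (div_nonneg (sq_nonneg _) (faceSize_pos hd (cells_nonempty hf)).le)
    (integral_nonneg fun _ => sq_nonneg _)

/-- The squared jump seminorm, which is the penalty term of the form without the parameter `α`. -/
def jumpSum (v : D.V) : ℝ := ∑ f ∈ faces D.shape Ω D.mesh, faceJumpSq v f

theorem jumpForm_self (v : D.V) : jumpForm v v = D.α * jumpSum v := by
  rw [jumpForm, jumpSum, Finset.mul_sum]
  refine Finset.sum_congr rfl fun f _ => ?_
  rw [faceJumpSq, integral_const_mul, σ_eq]
  simp only [real_inner_self_eq_norm_sq]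
  ring

theorem jumpSum_nonneg (hd : 0 < d) (v : D.V) : 0 ≤ jumpSum v :=
  Finset.sum_nonneg fun _ hf => faceJumpSq_nonneg hd v hf

theorem norm_vecAvg_le {η : Fin d → D.V} {f : Face d} (hf : f ∈ faces D.shape Ω D.mesh) (x : E d) :
    ‖D.vecAvg η f x‖ ≤ ∑ T ∈ f.cells, ‖D.vecOn η T x‖ := by
  rw [vecAvg, norm_smul]
  have hc : (1 : ℝ) ≤ f.cells.card := by exact_mod_cast (cells_nonempty hf).card_pos
  have h1 : ‖((f.cells.card : ℝ))⁻¹‖ ≤ 1 := by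
    rw [Real.norm_of_nonneg (by positivity)]
    exact inv_le_one_of_one_le₀ hc
  calc _ ≤ 1 * ∑ T ∈ f.cells, ‖D.vecOn η T x‖ := by
        gcongr
        exact norm_sum_le _ _
    _ = _ := one_mul _

theorem abs_vecJump_le (hP : D.IsMesh) {η : Fin d → D.V} {f : Face d}
    (hf : f ∈ faces D.shape Ω D.mesh) (x : E d) :
    |D.vecJump η f x| ≤ ∑ T ∈ f.cells, ‖D.vecOn η T x‖ := by
  rw [vecJump]
  refine (Finset.abs_sum_le_sum_abs _ _).trans (Finset.sum_le_sum fun T hT => ?_)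
  refine (abs_real_inner_le_norm _ _).trans ?_
  rw [(isFacet_normal hP hf hT).norm, mul_one]

theorem card_cells_le_two {s : Shape} {𝒯 : Finset (Cell d)} {f : Face d} (hf : f ∈ faces s Ω 𝒯) :
    (f.cells.card : ℝ) ≤ 2 := by
  classical
  have : f.cells.card ≤ 2 := by
    rcases mem_faces.1 hf with h | h
    · obtain ⟨T₁, _, T₂, _, hne, rfl, _⟩ := mem_interiorFaces.1 h
      exact (Finset.card_pair hne).le
    · obtain ⟨T₁, _, G, _, rfl, _⟩ := mem_boundaryFaces.1 h
      simp
  exact_mod_cast this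

/-- The upper bound of Young's inequality for `∫_F |⟦v⟧| |η|`, with the weights `t` and `w`. -/
def youngTerm (v : D.V) (η : Fin d → D.V) (t w : ℝ) (f : Face d) : ℝ :=
  t * (w * ∫ x in f.carrier, ‖D.jump v f x‖ ^ 2 ∂(surface d)) +
    t⁻¹ * ∑ T ∈ f.cells, w⁻¹ * ∫ x in f.carrier, ‖D.vecOn η T x‖ ^ 2 ∂(surface d)

theorem norm_jump_mul_sum_le (v : D.V) (η : Fin d → D.V) {f : Face d}
    (hf : f ∈ faces D.shape Ω D.mesh) {t w : ℝ} (ht : 0 < t) (hw : 0 < w) (x : E d) :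
    ‖D.jump v f x‖ * ∑ T ∈ f.cells, ‖D.vecOn η T x‖ ≤
      t * (w * ‖D.jump v f x‖ ^ 2) + t⁻¹ * ∑ T ∈ f.cells, w⁻¹ * ‖D.vecOn η T x‖ ^ 2 := by
  have htw : 0 < t * w := mul_pos ht hw
  calc ‖D.jump v f x‖ * ∑ T ∈ f.cells, ‖D.vecOn η T x‖
      ≤ t * w / 2 * ‖D.jump v f x‖ ^ 2 +
          f.cells.card / (2 * (t * w)) * ∑ T ∈ f.cells, ‖D.vecOn η T x‖ ^ 2 :=
        mul_sum_le_young _ _ _ htw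
    _ ≤ t * w * ‖D.jump v f x‖ ^ 2 + 2 / (2 * (t * w)) * ∑ T ∈ f.cells, ‖D.vecOn η T x‖ ^ 2 := by
        gcongr
        · linarith
        · exact card_cells_le_two hf
    _ = _ := by
        rw [← Finset.mul_sum]
        field_simp

theorem neg_integral_le_youngTerm (hP : D.IsMesh) (v : D.V) (η : Fin d → D.V) {f : Face d}
    (hf : f ∈ faces D.shape Ω D.mesh) {g : E d → ℝ} (hg : Continuous g) {b w t : ℝ} (hb : 0 ≤ b)
    (hw : 0 < w) (ht : 0 < t)
    (hle : ∀ x, |g x| ≤ b * (‖D.jump v f x‖ * ∑ T ∈ f.cells, ‖D.vecOn η T x‖)) :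
    -∫ x in f.carrier, g x ∂(surface d) ≤ b * youngTerm v η t w f := by
  have hyoung : ∀ x, -g x ≤ b * (t * (w * ‖D.jump v f x‖ ^ 2) +
      t⁻¹ * ∑ T ∈ f.cells, w⁻¹ * ‖D.vecOn η T x‖ ^ 2) := fun x =>
    (neg_le_abs _).trans ((hle x).trans
      (mul_le_mul_of_nonneg_left (norm_jump_mul_sum_le v η hf ht hw x) hb))
  rw [← integral_neg, youngTerm]
  calc _ ≤ ∫ x in f.carrier, b * (t * (w * ‖D.jump v f x‖ ^ 2) +
      t⁻¹ * ∑ T ∈ f.cells, w⁻¹ * ‖D.vecOn η T x‖ ^ 2) ∂(surface d) :=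
        integral_mono (integrableOn_carrier hP hf (by fun_prop))
          (integrableOn_carrier hP hf (by fun_prop)) hyoung
    _ = _ := by
      rw [integral_const_mul, integral_add (integrableOn_carrier hP hf (by fun_prop))
        (integrableOn_carrier hP hf (by fun_prop)), integral_const_mul, integral_const_mul,
        integral_const_mul, integral_finsetSum _ fun T _ => integrableOn_carrier hP hf
          (by fun_prop)]
      simp only [integral_const_mul]

theorem youngTerm_nonneg (v : D.V) (η : Fin d → D.V) {t w : ℝ} (ht : 0 < t) (hw : 0 < w)
    (f : Face d) : 0 ≤ youngTerm v η t w f := by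
  have i1 : 0 ≤ ∫ x in f.carrier, ‖D.jump v f x‖ ^ 2 ∂(surface d) :=
    integral_nonneg fun _ => sq_nonneg _
  have i2 : 0 ≤ ∑ T ∈ f.cells, w⁻¹ * ∫ x in f.carrier, ‖D.vecOn η T x‖ ^ 2 ∂(surface d) :=
    Finset.sum_nonneg fun T _ => mul_nonneg (inv_nonneg.2 hw.le)
      (integral_nonneg fun _ => sq_nonneg _)
  exact add_nonneg (mul_nonneg ht.le (mul_nonneg hw.le i1)) (mul_nonneg (inv_nonneg.2 ht.le) i2)

theorem pairing_lift_le (hP : D.IsMesh) (hB : 0 ≤ B)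
    (hβ : ∀ f ∈ interiorFaces D.shape D.mesh, ‖D.β f‖ ≤ B) (v : D.V) (η : Fin d → D.V) {t : ℝ}
    (ht : 0 < t) (w : Face d → ℝ) (hw : ∀ f ∈ faces D.shape Ω D.mesh, 0 < w f) :
    pairing (D.lift v) η ≤ (1 + B) * ∑ f ∈ faces D.shape Ω D.mesh, youngTerm v η t (w f) f := by
  have hA0 : ∀ f ∈ faces D.shape Ω D.mesh, 0 ≤ youngTerm v η t (w f) f := fun f hf =>
    youngTerm_nonneg v η ht (hw f hf) f
  have h1 : ∀ f ∈ faces D.shape Ω D.mesh,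
      -∫ x in f.carrier, ⟪D.jump v f x, D.vecAvg η f x⟫ ∂(surface d) ≤
        1 * youngTerm v η t (w f) f := by
    intro f hf
    refine neg_integral_le_youngTerm hP v η hf (by fun_prop) zero_le_one (hw f hf) ht fun x => ?_
    rw [one_mul]
    exact (abs_real_inner_le_norm _ _).trans
      (mul_le_mul_of_nonneg_left (norm_vecAvg_le hf x) (norm_nonneg _))
  have h2 : ∀ f ∈ interiorFaces D.shape D.mesh,
      -∫ x in f.carrier, ⟪D.β f, D.jump v f x⟫ * D.vecJump η f x ∂(surface d) ≤
        B * youngTerm v η t (w f) f := by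
    intro f hf
    have hf' := mem_faces_of_mem_interiorFaces (Ω := Ω) hf
    refine neg_integral_le_youngTerm hP v η hf' (by fun_prop) hB (hw f hf') ht fun x => ?_
    rw [abs_mul, ← mul_assoc]
    refine mul_le_mul ?_ (abs_vecJump_le hP hf' x) (abs_nonneg _)
      (mul_nonneg hB (norm_nonneg _))
    exact (abs_real_inner_le_norm _ _).trans
      (mul_le_mul_of_nonneg_right (hβ f hf) (norm_nonneg _))
  rw [pairing_lift hP, add_mul, Finset.mul_sum, Finset.mul_sum]
  refine add_le_add (Finset.sum_le_sum h1) ((Finset.sum_le_sum h2).trans ?_)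
  exact Finset.sum_le_sum_of_subset_of_nonneg (fun f hf => mem_faces_of_mem_interiorFaces hf)
    fun f hf _ => mul_nonneg hB (hA0 f hf)

theorem sum_integral_vecOn_le (hd : 0 < d) (hP : D.IsMesh)
    (hreg : IsShapeRegular D.shape κ₁ D.mesh) (hqu : IsQuasiUniform D.shape κ₂ D.mesh)
    (h₁ : 0 < κ₁) (hp : 1 ≤ D.degree) (η : Fin d → D.V) :
    ∑ f ∈ faces D.shape Ω D.mesh, ∑ T ∈ f.cells,
      ((D.degree : ℝ) ^ 2 / faceSize D.shape f)⁻¹ *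
        ∫ x in f.carrier, ‖D.vecOn η T x‖ ^ 2 ∂(surface d) ≤
      traceConst d κ₁ * faceBound d D.shape κ₁ κ₂ *
        D.brokenInner (D.vecOn η) (D.vecOn η) := by
  let g : Cell d → ℝ := fun T =>
    traceConst d κ₁ * ∫ x in cell D.shape T, ⟪D.vecOn η T x, D.vecOn η T x⟫
  have hg : ∀ T, 0 ≤ g T := fun T =>
    mul_nonneg (traceConst_pos h₁).le (integral_nonneg fun _ => real_inner_self_nonneg)
  calc _ ≤ ∑ f ∈ faces D.shape Ω D.mesh, ∑ T ∈ f.cells, g T := by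
        refine Finset.sum_le_sum fun f hf => Finset.sum_le_sum fun T hT => ?_
        rw [inv_div]
        exact integral_norm_sq_vecOn_le hP hreg hd hp η hf hT
    _ ≤ faceBound d D.shape κ₁ κ₂ * ∑ T ∈ D.mesh, g T :=
        sum_faces_sum_cells_le hd hP hreg hqu fun T _ => hg T
    _ = _ := by
        rw [← Finset.mul_sum, ← mul_assoc, mul_comm (faceBound _ _ _ _)]
        rfl

theorem brokenInner_liftOn_le (hd : 0 < d) (hP : D.IsMesh) (hreg : IsShapeRegular D.shape κ₁ D.mesh)
    (hqu : IsQuasiUniform D.shape κ₂ D.mesh) (h₁ : 0 < κ₁) (h₂ : 0 < κ₂) (hp : 1 ≤ D.degree)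
    (hB : 0 ≤ B) (hβ : ∀ f ∈ interiorFaces D.shape D.mesh, ‖D.β f‖ ≤ B) (v : D.V) :
    D.brokenInner (liftOn v) (liftOn v) ≤ liftConst d D.shape κ₁ κ₂ B * jumpSum v := by
  set L := D.brokenInner (liftOn v) (liftOn v)
  set C := traceConst d κ₁ * faceBound d D.shape κ₁ κ₂ with hC
  have hC0 : 0 < C := mul_pos (traceConst_pos h₁) (faceBound_pos h₁ h₂)
  have : (0 : ℝ) < D.degree := by exact_mod_cast hp
  -- The weight for which Young's inequality returns half of `L`, to be absorbed on the left.
  let t : ℝ := 2 * (1 + B) * C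
  have ht : 0 < t := by positivity
  have hsum : ∑ f ∈ faces D.shape Ω D.mesh,
      youngTerm v (D.lift v) t ((D.degree : ℝ) ^ 2 / faceSize D.shape f) f ≤
      t * jumpSum v + t⁻¹ * (C * L) := by
    simp only [youngTerm]
    rw [Finset.sum_add_distrib, ← Finset.mul_sum, ← Finset.mul_sum]
    exact add_le_add_right (mul_le_mul_of_nonneg_left
      (sum_integral_vecOn_le hd hP hreg hqu h₁ hp (D.lift v)) (inv_nonneg.2 ht.le)) _
  have habsorb : L ≤ (1 + B) * (t * jumpSum v) + L / 2 :=
    calc L = pairing (D.lift v) (D.lift v) := (pairing_eq_brokenInner hP _ _).symm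
      _ ≤ (1 + B) * (t * jumpSum v + t⁻¹ * (C * L)) :=
          (pairing_lift_le hP hB hβ v (D.lift v) ht
            (fun f => (D.degree : ℝ) ^ 2 / faceSize D.shape f) fun f hf =>
              div_pos (by positivity) (faceSize_pos hd (cells_nonempty hf))).trans
            (mul_le_mul_of_nonneg_left hsum (by positivity))
      _ = _ := by
          simp only [t]
          field_simp
  calc L ≤ 2 * ((1 + B) * (t * jumpSum v)) := by linarith
    _ = _ := by rw [liftConst, ← hC]; ring

end Level

/-! ### Coercivity and continuity of the form -/

namespace Level

variable {d : ℕ} {Ω : Set (E d)} {D : Level d Ω} {κ₁ κ₂ B : ℝ}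

/-- The assumptions on the mesh, the degree and `β` of one level, with the shape regularity constant
`κ₁`, the quasi-uniformity constant `κ₂` and the bound `B` on `β`. -/
structure IsRegular (D : Level d Ω) (κ₁ κ₂ B : ℝ) : Prop where
  isMesh : D.IsMesh
  shapeRegular : IsShapeRegular D.shape κ₁ D.mesh
  quasiUniform : IsQuasiUniform D.shape κ₂ D.mesh
  one_le_degree : 1 ≤ D.degree
  norm_β_le : ∀ f ∈ interiorFaces D.shape D.mesh, ‖D.β f‖ ≤ B

/-- The square of the DG norm `(∑ ‖∇v‖² + ∑ σ ‖⟦v⟧‖²)^(1/2)`, to which the energy norm is compared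
with constants that do not depend on the level. -/
def dgNormSq (v : D.V) : ℝ := D.brokenInner (grad v) (grad v) + jumpForm v v

theorem jumpForm_nonneg (hd : 0 < d) (hα : 0 ≤ D.α) (v : D.V) : 0 ≤ jumpForm v v := by
  rw [jumpForm_self]; exact mul_nonneg hα (jumpSum_nonneg hd v)

theorem dgNormSq_nonneg (hd : 0 < d) (hα : 0 ≤ D.α) (v : D.V) : 0 ≤ dgNormSq v :=
  add_nonneg (brokenInner_self_nonneg _) (jumpForm_nonneg hd hα v)

theorem form_self (hP : D.IsMesh) (v : D.V) :
    D.form v v = D.brokenInner (grad v) (grad v) + 2 * D.brokenInner (grad v) (liftOn v) +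
      jumpForm v v + D.θ * D.brokenInner (liftOn v) (liftOn v) := by
  rw [form_eq hP, brokenInner_comm (liftOn v) (grad v)]; ring

theorem brokenInner_liftOn_le_jumpForm (hd : 0 < d) (h₁ : 0 < κ₁) (h₂ : 0 < κ₂) (hB : 0 ≤ B)
    (hD : D.IsRegular κ₁ κ₂ B) {a : ℝ} (ha : 0 < a) (haα : a ≤ D.α) (v : D.V) :
    D.brokenInner (liftOn v) (liftOn v) ≤ liftConst d D.shape κ₁ κ₂ B / a * jumpForm v v := by
  refine (brokenInner_liftOn_le hd hD.isMesh hD.shapeRegular hD.quasiUniform h₁ h₂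
    hD.one_le_degree hB hD.norm_β_le v).trans ?_
  have hC := liftConst_pos (d := d) (s := D.shape) h₁ h₂ hB
  have hJ := jumpSum_nonneg hd v
  rw [jumpForm_self, div_mul_eq_mul_div, le_div_iff₀ ha, mul_assoc]
  refine mul_le_mul_of_nonneg_left ?_ hC.le
  rw [mul_comm]
  exact mul_le_mul_of_nonneg_right haα hJ

/-- The coercivity constant of the form, where `C` is the stability constant of the lifting and `a`
is the lower bound of the penalty parameter. -/
def coercConst (C a : ℝ) : ℝ := min (1 / 2) (a / (2 * C + a))

theorem coercConst_pos {C a : ℝ} (hC : 0 < C) (ha : 0 < a) : 0 < coercConst C a :=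
  lt_min (by norm_num) (by positivity)

theorem half_mul_dgNormSq_le_form (hd : 0 < d) (h₁ : 0 < κ₁) (h₂ : 0 < κ₂) (hB : 0 ≤ B)
    (hD : D.IsRegular κ₁ κ₂ B) (hα : 4 * liftConst d D.shape κ₁ κ₂ B ≤ D.α) (hθ : 0 ≤ D.θ)
    (v : D.V) : 1 / 2 * dgNormSq v ≤ D.form v v := by
  have hC := liftConst_pos (d := d) (s := D.shape) h₁ h₂ hB
  set C := liftConst d D.shape κ₁ κ₂ B
  have hα0 : 0 < D.α := by linarith
  have hlift : D.brokenInner (liftOn v) (liftOn v) ≤ 1 / 4 * jumpForm v v :=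
    (brokenInner_liftOn_le_jumpForm hd h₁ h₂ hB hD hα0 le_rfl v).trans
      (mul_le_mul_of_nonneg_right (by rw [div_le_iff₀ hα0]; linarith)
        (jumpForm_nonneg hd hα0.le v))
  have hmixed := neg_le_of_abs_le (abs_two_mul_brokenInner_le (D := D) (continuous_grad v)
    (continuous_liftOn v) one_half_pos)
  have hθL := mul_nonneg hθ (brokenInner_self_nonneg (D := D) (liftOn v))
  rw [form_self hD.isMesh, dgNormSq]
  norm_num at hmixed
  linarith

theorem coercConst_mul_dgNormSq_le_form_of_one_le (hd : 0 < d) (h₁ : 0 < κ₁) (h₂ : 0 < κ₂)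
    (hB : 0 ≤ B) (hD : D.IsRegular κ₁ κ₂ B) {a : ℝ} (ha : 0 < a) (haα : a ≤ D.α)
    (hθ : 1 ≤ D.θ) (v : D.V) :
    coercConst (liftConst d D.shape κ₁ κ₂ B) a * dgNormSq v ≤ D.form v v := by
  have hC := liftConst_pos (d := d) (s := D.shape) h₁ h₂ hB
  set C := liftConst d D.shape κ₁ κ₂ B
  have hL := brokenInner_liftOn_le_jumpForm hd h₁ h₂ hB hD ha haα v
  have hθL := mul_le_mul_of_nonneg_right hθ (brokenInner_self_nonneg (D := D) (liftOn v))
  have hG0 := brokenInner_self_nonneg (D := D) (grad v)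
  have hJ0 := jumpForm_nonneg hd (ha.le.trans haα) v
  -- With this `ε` the part of the lifting term that the form does not contain is half the penalty.
  let ε := 2 * C / (2 * C + a)
  have hmixed := neg_le_of_abs_le (abs_two_mul_brokenInner_le (D := D) (continuous_grad v)
    (continuous_liftOn v) (ε := ε) (by positivity))
  rw [form_self hD.isMesh, dgNormSq]
  set G := D.brokenInner (grad v) (grad v)
  set L := D.brokenInner (liftOn v) (liftOn v)
  set J := jumpForm v v
  have hgrad : coercConst C a * G ≤ (1 - ε) * G := by
    have h1ε : 1 - ε = a / (2 * C + a) := by simp only [ε]; field_simp; ring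
    rw [h1ε]
    exact mul_le_mul_of_nonneg_right (min_le_right _ _) hG0
  have hjump : coercConst C a * J ≤ 1 / 2 * J := mul_le_mul_of_nonneg_right (min_le_left _ _) hJ0
  have hlift : (ε⁻¹ - 1) * L ≤ 1 / 2 * J := by
    have hε : ε⁻¹ - 1 = a / (2 * C) := by simp only [ε]; field_simp; ring
    calc (ε⁻¹ - 1) * L ≤ a / (2 * C) * (C / a * J) := by
          rw [hε]; exact mul_le_mul_of_nonneg_left hL (by positivity)
      _ = 1 / 2 * J := by field_simp
  linarith

theorem coercConst_mul_dgNormSq_le_form (hd : 0 < d) (h₁ : 0 < κ₁) (h₂ : 0 < κ₂) (hB : 0 ≤ B)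
    (hD : D.IsRegular κ₁ κ₂ B) {a : ℝ} (ha : 0 < a) (haα : a ≤ D.α)
    (hθ : D.θ = 0 ∧ 4 * liftConst d D.shape κ₁ κ₂ B ≤ a ∨ D.θ = 1) (v : D.V) :
    coercConst (liftConst d D.shape κ₁ κ₂ B) a * dgNormSq v ≤ D.form v v := by
  rcases hθ with ⟨h0, h4⟩ | h1
  · exact (mul_le_mul_of_nonneg_right (min_le_left _ _)
      (dgNormSq_nonneg hd (ha.le.trans haα) v)).trans
      (half_mul_dgNormSq_le_form hd h₁ h₂ hB hD (h4.trans haα) h0.ge v)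
  · exact coercConst_mul_dgNormSq_le_form_of_one_le hd h₁ h₂ hB hD ha haα h1.ge v

theorem form_le (hd : 0 < d) (h₁ : 0 < κ₁) (h₂ : 0 < κ₂) (hB : 0 ≤ B)
    (hD : D.IsRegular κ₁ κ₂ B) {a : ℝ} (ha : 0 < a) (haα : a ≤ D.α) (hθ : D.θ ≤ 1) (v : D.V) :
    D.form v v ≤ (2 + 2 * (liftConst d D.shape κ₁ κ₂ B / a)) * dgNormSq v := by
  have hC := liftConst_pos (d := d) (s := D.shape) h₁ h₂ hB
  set C := liftConst d D.shape κ₁ κ₂ B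
  have hL := brokenInner_liftOn_le_jumpForm hd h₁ h₂ hB hD ha haα v
  have hL0 := brokenInner_self_nonneg (D := D) (liftOn v)
  have hG0 := brokenInner_self_nonneg (D := D) (grad v)
  have hJ0 := jumpForm_nonneg hd (ha.le.trans haα) v
  rw [form_self hD.isMesh, dgNormSq]
  have hX := le_of_abs_le (abs_two_mul_brokenInner_le (D := D) (continuous_grad v)
    (continuous_liftOn v) one_pos)
  have hθL := mul_le_mul_of_nonneg_right hθ hL0
  have hCG : 0 ≤ C / a * D.brokenInner (grad v) (grad v) := mul_nonneg (by positivity) hG0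
  norm_num at hX
  linarith

end Level

/-! ### Positivity of the form -/

section Partition

variable {d : ℕ} {s : Shape} {Ω : Set (E d)} {𝒯 : Finset (Cell d)}

theorem IsPartition.subset_biUnion_closure (hP : IsPartition s Ω 𝒯) :
    Ω ⊆ ⋃ T ∈ 𝒯, closure (cell s T) :=
  hP.cover.subset.trans interior_subset

theorem IsPartition.exists_refFacet_of_mem_closure_cell (hP : IsPartition s Ω 𝒯) {T : Cell d}
    (hT : T ∈ 𝒯) {x : E d} (hx : x ∈ closure (cell s T)) (hxΩ : x ∉ Ω) :
    ∃ G ∈ refFacets d s, x ∈ T '' G ∩ frontier Ω := by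
  have hfrT : x ∈ frontier (cell s T) := by
    rw [(isOpen_cell s T).frontier_eq]
    exact ⟨hx, fun h => hxΩ (hP.cell_subset hT h)⟩
  obtain ⟨G, hG, hxG⟩ := Set.mem_iUnion₂.1 (frontier_cell_subset s T hfrT)
  refine ⟨G, hG, hxG, ?_⟩
  rw [hP.isOpen.frontier_eq]
  exact ⟨closure_mono (hP.cell_subset hT) hx, hxΩ⟩

theorem IsPartition.exists_mem_closure_cell_of_mem_frontier (hP : IsPartition s Ω 𝒯)
    (p : Cell d → Prop) [DecidablePred p] {x : E d}
    (hx : x ∈ frontier (⋃ T ∈ 𝒯.filter p, closure (cell s T))) (hxΩ : x ∈ Ω) :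
    ∃ T ∈ 𝒯, ¬ p T ∧ x ∈ closure (cell s T) := by
  by_contra! hnot
  set U := ⋃ T ∈ 𝒯.filter p, closure (cell s T)
  set U' := ⋃ T ∈ 𝒯.filter (¬ p ·), closure (cell s T) with hU'
  have hclosed : IsClosed U' :=
    (𝒯.filter (¬ p ·)).finite_toSet.isClosed_biUnion fun _ _ => isClosed_closure
  have hxU' : x ∉ U' := by
    simp only [hU', Set.mem_iUnion₂, Finset.mem_filter]
    rintro ⟨T, ⟨hT, hpT⟩, hxT⟩
    exact hnot T hT hpT hxT
  have hsub : Ω ∩ U'ᶜ ⊆ U := by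
    rintro y ⟨hy, hy'⟩
    obtain ⟨T, hT, hyT⟩ := Set.mem_iUnion₂.1 (hP.subset_biUnion_closure hy)
    refine Set.mem_iUnion₂.2 ⟨T, Finset.mem_filter.2 ⟨hT, ?_⟩, hyT⟩
    by_contra hpT
    exact hy' (Set.mem_iUnion₂.2 ⟨T, Finset.mem_filter.2 ⟨hT, hpT⟩, hyT⟩)
  exact hx.2 (interior_maximal hsub (hP.isOpen.inter hclosed.isOpen_compl) ⟨hxΩ, hxU'⟩)

theorem IsPartition.frontier_biUnion_filter_subset (hP : IsPartition s Ω 𝒯) (p : Cell d → Prop)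
    [DecidablePred p] : frontier (⋃ T ∈ 𝒯.filter p, closure (cell s T)) ⊆
      (⋃ T ∈ 𝒯.filter p, ⋃ T' ∈ 𝒯.filter (¬ p ·), closure (cell s T) ∩ closure (cell s T')) ∪
      ⋃ T ∈ 𝒯.filter p, ⋃ G ∈ refFacets d s, T '' G ∩ frontier Ω := by
  intro x hx
  have hclosed : IsClosed (⋃ T ∈ 𝒯.filter p, closure (cell s T)) :=
    (𝒯.filter p).finite_toSet.isClosed_biUnion fun _ _ => isClosed_closure
  obtain ⟨T, hT, hxT⟩ := Set.mem_iUnion₂.1 (hclosed.frontier_subset hx)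
  by_cases hxΩ : x ∈ Ω
  · obtain ⟨T', hT', hpT', hxT'⟩ := hP.exists_mem_closure_cell_of_mem_frontier p hx hxΩ
    exact Or.inl (Set.mem_iUnion₂.2 ⟨T, hT, Set.mem_iUnion₂.2
      ⟨T', Finset.mem_filter.2 ⟨hT', hpT'⟩, hxT, hxT'⟩⟩)
  · obtain ⟨G, hG, hxG⟩ :=
      hP.exists_refFacet_of_mem_closure_cell (Finset.mem_filter.1 hT).1 hxT hxΩ
    exact Or.inr (Set.mem_iUnion₂.2 ⟨T, hT, Set.mem_iUnion₂.2 ⟨G, hG, hxG⟩⟩)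

/- The elements on which `a` takes a given value other than `z` would fill a bounded set whose
frontier lies in null sets, although the frontier of a bounded set with interior points has positive
surface measure. -/
theorem IsPartition.eq_of_forall_faces (hd : 0 < d) (hP : IsPartition s Ω 𝒯) {α : Type*}
    {a : Cell d → α} {z : α}
    (hint : ∀ T ∈ 𝒯, ∀ T' ∈ 𝒯, 0 < surface d (closure (cell s T) ∩ closure (cell s T')) →
      a T = a T')
    (hbd : ∀ T ∈ 𝒯, ∀ G ∈ refFacets d s, 0 < surface d (T '' G ∩ frontier Ω) → a T = z)
    {T : Cell d} (hT : T ∈ 𝒯) : a T = z := by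
  classical
  by_contra hne
  set U := ⋃ S ∈ 𝒯.filter (a · = a T), closure (cell s S)
  have hbounded : Bornology.IsBounded U :=
    (Bornology.isBounded_biUnion_finset _).2 fun S _ => (isBounded_cell s S).closure
  have hinterior : (interior U).Nonempty := by
    refine (cell_nonempty s T).mono (interior_maximal ?_ (isOpen_cell s T))
    exact subset_closure.trans (Set.subset_biUnion_of_mem (u := fun S => closure (cell s S))
      (Finset.mem_coe.2 (Finset.mem_filter.2 ⟨hT, rfl⟩)))
  refine (surface_frontier_pos hd hbounded hinterior).ne' (measure_mono_null
    (hP.frontier_biUnion_filter_subset _) (measure_union_null ?_ ?_))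
  all_goals
    refine (measure_biUnion_null_iff (Finset.countable_toSet _)).2 fun S hS => ?_
    obtain ⟨hS, haS⟩ := Finset.mem_filter.1 hS
  · refine (measure_biUnion_null_iff (Finset.countable_toSet _)).2 fun S' hS' => ?_
    obtain ⟨hS', haS'⟩ := Finset.mem_filter.1 hS'
    by_contra hpos
    exact haS' ((hint S hS S' hS' (pos_iff_ne_zero.2 hpos)).symm.trans haS)
  · refine (measure_biUnion_null_iff (refFacets_finite d s).countable).2 fun G hG => ?_
    by_contra hpos
    exact hne (haS.symm.trans (hbd S hS G hG (pos_iff_ne_zero.2 hpos)))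

end Partition

namespace Level

variable {d : ℕ} {Ω : Set (E d)} {D : Level d Ω} {κ₁ κ₂ B : ℝ}

open Classical in
theorem norm_jump_of_mem_interiorFaces (hd : 2 ≤ d) (hP : D.IsMesh) (v : D.V) {f : Face d}
    (hf : f ∈ interiorFaces D.shape D.mesh) {T T' : Cell d} (hc : f.cells = {T, T'})
    (x : E d) : ‖D.jump v f x‖ = |D.on v T x - D.on v T' x| := by
  have hn : ‖normal D.shape T f‖ = 1 :=
    (isFacet_normal hP (mem_faces_of_mem_interiorFaces hf) (by simp [hc])).norm
  have hne : T ≠ T' := by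
    rintro rfl
    obtain ⟨T₁, -, T₂, -, h, rfl, -⟩ := mem_interiorFaces.1 hf
    have := congrArg Finset.card hc
    simp [h] at this
  rw [jump, hc, Finset.sum_pair hne, normal_eq_neg_of_mem_interiorFaces hd hP hf hc, smul_neg,
    ← sub_eq_add_neg, ← sub_smul, norm_smul, hn, mul_one, Real.norm_eq_abs]

theorem norm_jump_of_cells_eq_singleton (hP : D.IsMesh) (v : D.V) {f : Face d}
    (hf : f ∈ faces D.shape Ω D.mesh) {T : Cell d} (hc : f.cells = {T}) (x : E d) :
    ‖D.jump v f x‖ = |D.on v T x| := by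
  have hn : ‖normal D.shape T f‖ = 1 := (isFacet_normal hP hf (by simp [hc])).norm
  rw [jump, hc, Finset.sum_singleton, norm_smul, hn, mul_one, Real.norm_eq_abs]

theorem exists_on_eq_of_brokenInner_grad_eq_zero {v : D.V}
    (h : D.brokenInner (grad v) (grad v) = 0) {T : Cell d} (hT : T ∈ D.mesh) :
    ∃ a, ∀ x ∈ closure (cell D.shape T), D.on v T x = a := by
  have h1 : ∫ x in cell D.shape T, ⟪grad v T x, grad v T x⟫ = 0 :=
    (Finset.sum_eq_zero_iff_of_nonneg fun T _ =>
      integral_nonneg fun _ => real_inner_self_nonneg).1 h T hT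
  rw [integral_eq_zero_iff_of_nonneg (fun _ => real_inner_self_nonneg)
    (integrableOn_inner_cell (continuous_grad v T) (continuous_grad v T) T)] at h1
  have h2 : Set.EqOn (grad v T) 0 (cell D.shape T) := by
    refine Measure.eqOn_open_of_ae_eq (μ := volume) ?_ (isOpen_cell D.shape T)
      (continuous_grad v T).continuousOn continuousOn_const
    filter_upwards [h1] with x hx
    exact inner_self_eq_zero.1 hx
  have h3 : Set.EqOn (fderiv ℝ (D.on v T)) 0 (cell D.shape T) := fun x hx =>
    (InnerProductSpace.toDual ℝ (E d)).symm.map_eq_zero_iff.1 (h2 hx)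
  obtain ⟨y, hy⟩ := cell_nonempty D.shape T
  refine ⟨D.on v T y, fun x hx => ?_⟩
  have hc : IsClosed {x | D.on v T x = D.on v T y} := isClosed_eq (by fun_prop) continuous_const
  refine (hc.closure_subset_iff.2 fun z hz => ?_) hx
  exact (isOpen_cell D.shape T).is_const_of_fderiv_eq_zero
    (convex_cell D.shape T).isPreconnected
    ((D.contDiff_on v T).differentiable (by norm_num)).differentiableOn h3 hz hy

theorem exists_jump_eq_zero (hd : 0 < d) (hp : 1 ≤ D.degree) (hP : D.IsMesh) {v : D.V}
    (h : jumpSum v = 0) {f : Face d} (hf : f ∈ faces D.shape Ω D.mesh) :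
    ∃ x ∈ f.carrier, D.jump v f x = 0 := by
  have : (0 : ℝ) < D.degree := by exact_mod_cast hp
  have hw : 0 < (D.degree : ℝ) ^ 2 / faceSize D.shape f :=
    div_pos (by positivity) (faceSize_pos hd (cells_nonempty hf))
  have h1 : faceJumpSq v f = 0 :=
    (Finset.sum_eq_zero_iff_of_nonneg fun f hf => faceJumpSq_nonneg hd v hf).1 h f hf
  have h2 := (mul_eq_zero.1 h1).resolve_left hw.ne'
  rw [integral_eq_zero_iff_of_nonneg (fun _ => sq_nonneg _)
    (integrableOn_carrier hP hf ((continuous_jump v f).norm.pow 2))] at h2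
  have hne : (surface d).restrict f.carrier ≠ 0 := by
    rw [Ne, Measure.restrict_eq_zero]
    exact (surface_pos_of_mem_faces hf).ne'
  have : (ae ((surface d).restrict f.carrier)).NeBot := ae_neBot.2 hne
  obtain ⟨x, hx, hxm⟩ := (h2.and (ae_restrict_mem (isClosed_carrier hf).measurableSet)).exists
  refine ⟨x, hxm, ?_⟩
  have hx' : ‖D.jump v f x‖ ^ 2 = 0 := hx
  exact norm_eq_zero.1 (pow_eq_zero_iff (by norm_num) |>.1 hx')

theorem eq_zero_of_brokenInner_grad_eq_zero (hd : 2 ≤ d) (hp : 1 ≤ D.degree) (hP : D.IsMesh)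
    {v : D.V} (hgrad : D.brokenInner (grad v) (grad v) = 0) (hjump : jumpSum v = 0) : v = 0 := by
  classical
  have hconst : ∀ T ∈ D.mesh, ∃ a, ∀ x ∈ closure (cell D.shape T), D.on v T x = a :=
    fun T hT => exists_on_eq_of_brokenInner_grad_eq_zero hgrad hT
  choose! a ha using hconst
  have hzero : ∀ T ∈ D.mesh, a T = 0 := by
    refine fun T hT => hP.eq_of_forall_faces (by omega) (fun S hS S' hS' hpos => ?_)
      (fun S hS G hG hpos => ?_) hT
    · by_cases hSS' : S = S'
      · rw [hSS']
      have hf : (⟨{S, S'}, closure (cell D.shape S) ∩ closure (cell D.shape S')⟩ : Face d) ∈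
          interiorFaces D.shape D.mesh := mem_interiorFaces.2 ⟨S, hS, S', hS', hSS', rfl, hpos⟩
      obtain ⟨x, hx, h0⟩ :=
        exists_jump_eq_zero (by omega) hp hP hjump (mem_faces_of_mem_interiorFaces hf)
      rw [← norm_eq_zero, norm_jump_of_mem_interiorFaces hd hP v hf rfl, ha S hS x hx.1,
        ha S' hS' x hx.2, abs_eq_zero] at h0
      exact sub_eq_zero.1 h0
    · have hf : (⟨{S}, S '' G ∩ frontier Ω⟩ : Face d) ∈ faces D.shape Ω D.mesh :=
        mem_faces.2 (Or.inr (mem_boundaryFaces.2 ⟨S, hS, G, hG, rfl, hpos⟩))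
      obtain ⟨x, hx, h0⟩ := exists_jump_eq_zero (by omega) hp hP hjump hf
      rwa [← norm_eq_zero, norm_jump_of_cells_eq_singleton hP v hf rfl,
        ha S hS x (image_refFacet_subset_closure _ _ hG hx.1), abs_eq_zero] at h0
  refine ext_on hP fun T hT x hx => ?_
  have h0 : D.on (0 : D.V) T = 0 := (onLinear hP T).map_zero
  rw [ha T hT x (subset_closure hx), hzero T hT, h0, Pi.zero_apply]

theorem form_pos (hd : 2 ≤ d) (h₁ : 0 < κ₁) (h₂ : 0 < κ₂) (hB : 0 ≤ B)
    (hD : D.IsRegular κ₁ κ₂ B) {a : ℝ} (ha : 0 < a) (haα : a ≤ D.α)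
    (hθ : D.θ = 0 ∧ 4 * liftConst d D.shape κ₁ κ₂ B ≤ a ∨ D.θ = 1) {v : D.V} (hv : v ≠ 0) :
    0 < D.form v v := by
  have hd0 : 0 < d := by omega
  have hα : 0 < D.α := ha.trans_le haα
  refine (mul_pos (coercConst_pos (liftConst_pos h₁ h₂ hB) ha) ?_).trans_le
    (coercConst_mul_dgNormSq_le_form hd0 h₁ h₂ hB hD ha haα hθ v)
  refine lt_of_le_of_ne (dgNormSq_nonneg hd0 hα.le v) fun h0 => hv ?_
  have hG0 := brokenInner_self_nonneg (D := D) (grad v)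
  have hJ0 := jumpForm_nonneg hd0 hα.le v
  rw [dgNormSq] at h0
  have hJ : jumpForm v v = 0 := by linarith
  rw [jumpForm_self] at hJ
  exact eq_zero_of_brokenInner_grad_eq_zero hd hD.one_le_degree hD.isMesh (by linarith)
    ((mul_eq_zero.1 hJ).resolve_left hα.ne')

theorem form_self_nonneg (hd : 2 ≤ d) (h₁ : 0 < κ₁) (h₂ : 0 < κ₂) (hB : 0 ≤ B)
    (hD : D.IsRegular κ₁ κ₂ B) {a : ℝ} (ha : 0 < a) (haα : a ≤ D.α)
    (hθ : D.θ = 0 ∧ 4 * liftConst d D.shape κ₁ κ₂ B ≤ a ∨ D.θ = 1) (v : D.V) :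
    0 ≤ D.form v v :=
  (mul_nonneg (coercConst_pos (liftConst_pos h₁ h₂ hB) ha).le
    (dgNormSq_nonneg (by omega) (ha.le.trans haα) v)).trans
    (coercConst_mul_dgNormSq_le_form (by omega) h₁ h₂ hB hD ha haα hθ v)

end Level

/-! ### Uniform refinement -/

section RefSimplex

variable {d : ℕ}

theorem sum_bary_smul_refVertex (x : E d) : ∑ j, bary x j • refVertex d j = x := by
  ext i
  simp [Fin.sum_univ_succ, bary, refVertex, Finset.sum_apply, Pi.single_apply]

theorem bary_sum_smul_refVertex {μ : Fin (d + 1) → ℝ} (hμ : ∑ j, μ j = 1) :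
    bary (∑ j, μ j • refVertex d j) = μ := by
  have hcoord : ∀ i : Fin d, (∑ j, μ j • refVertex d j) i = μ i.succ := fun i => by
    simp [Fin.sum_univ_succ, refVertex, Finset.sum_apply, Pi.single_apply]
  rw [Fin.sum_univ_succ] at hμ
  ext j
  refine Fin.cases ?_ (fun i => ?_) j
  · simp only [bary, Fin.cons_zero, hcoord]
    linarith
  · simp only [bary, Fin.cons_succ, hcoord]

theorem bary_refVertex (j : Fin (d + 1)) : bary (refVertex d j) = Pi.single j 1 := by
  have h := bary_sum_smul_refVertex (d := d) (μ := Pi.single j 1) (by simp)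
  simpa [Pi.single_apply] using h

theorem map_eq_sum_bary_smul {V : Type*} [AddCommGroup V] [Module ℝ V] (f : E d →ᵃ[ℝ] V)
    (x : E d) : f x = ∑ j, bary x j • f (refVertex d j) := by
  conv_lhs => rw [← sum_bary_smul_refVertex x]
  rw [← Finset.univ.affineCombination_eq_linear_combination _ _ (sum_bary x),
    Finset.map_affineCombination _ _ _ (sum_bary x),
    Finset.univ.affineCombination_eq_linear_combination _ _ (sum_bary x)]
  rfl

theorem mem_cell_simplex_iff {T : Cell d} {y : E d} : y ∈ cell .simplex T ↔
    ∃ μ : Fin (d + 1) → ℝ, (∀ j, 0 < μ j) ∧ ∑ j, μ j = 1 ∧ ∑ j, μ j • T (refVertex d j) = y := by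
  have hT : ∀ x, T x = ∑ j, bary x j • T (refVertex d j) :=
    map_eq_sum_bary_smul (T : E d →ᵃ[ℝ] E d)
  constructor
  · rintro ⟨x, hx, rfl⟩
    exact ⟨bary x, (mem_simplex_iff x).1 hx, sum_bary x, (hT x).symm⟩
  · rintro ⟨μ, hpos, hsum, rfl⟩
    refine ⟨∑ j, μ j • refVertex d j, (mem_simplex_iff _).2 ?_, ?_⟩
    · rwa [bary_sum_smul_refVertex hsum]
    · rw [hT, bary_sum_smul_refVertex hsum]

theorem cell_simplex_subset {T T' : Cell d} {w : Fin (d + 1) → Fin (d + 1) → ℝ}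
    (hw : ∀ j i, 0 ≤ w j i) (hsum : ∀ j, ∑ i, w j i = 1) (hpos : ∀ i, ∃ j, 0 < w j i)
    (h : ∀ j, T' (refVertex d j) = ∑ i, w j i • T (refVertex d i)) :
    cell .simplex T' ⊆ cell .simplex T := by
  intro y hy
  obtain ⟨μ, hμ, hμsum, rfl⟩ := mem_cell_simplex_iff.1 hy
  refine mem_cell_simplex_iff.2 ⟨fun i => ∑ j, μ j * w j i, fun i => ?_, ?_, ?_⟩
  · obtain ⟨j, hj⟩ := hpos i
    exact Finset.sum_pos' (fun j _ => mul_nonneg (hμ j).le (hw j i))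
      ⟨j, Finset.mem_univ j, mul_pos (hμ j) hj⟩
  · rw [Finset.sum_comm]
    simp only [← Finset.mul_sum, hsum, mul_one, hμsum]
  · simp only [h, Finset.smul_sum, Finset.sum_smul, mul_smul]
    exact Finset.sum_comm

theorem cell_simplex_eq_of_perm {T T' : Cell d} (π : Equiv.Perm (Fin (d + 1)))
    (h : ∀ j, T' (refVertex d j) = T (refVertex d (π j))) :
    cell .simplex T' = cell .simplex T := by
  have hsub : ∀ {S S' : Cell d} (ρ : Equiv.Perm (Fin (d + 1))),
      (∀ j, S' (refVertex d j) = S (refVertex d (ρ j))) → cell .simplex S' ⊆ cell .simplex S :=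
    fun {S S'} ρ hρ => by
      refine cell_simplex_subset (w := fun j => Pi.single (ρ j) 1)
        (fun j => Pi.single_nonneg (α := fun _ => ℝ).2 zero_le_one) (fun j => by simp)
        (fun i => ⟨ρ.symm i, by simp⟩) fun j => ?_
      simp [hρ j, Pi.single_apply]
  exact (hsub π h).antisymm (hsub π.symm fun j => by rw [h, π.apply_symm_apply])

/-- The affine map that takes the vertex `refVertex d j` to `v j`. -/
def vertexMap (v : Fin (d + 1) → E d) : E d →ᵃ[ℝ] E d :=
  (∑ i, (EuclideanSpace.proj i : E d →L[ℝ] ℝ).smulRight (v i.succ - v 0)).toLinearMap.toAffineMap +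
    AffineMap.const ℝ (E d) (v 0)

theorem vertexMap_apply (v : Fin (d + 1) → E d) (x : E d) :
    vertexMap v x = ∑ j, bary x j • v j := by
  simp [vertexMap, Fin.sum_univ_succ, bary, smul_sub, sub_smul, Finset.sum_smul]
  abel

theorem vertexMap_refVertex (v : Fin (d + 1) → E d) (j : Fin (d + 1)) :
    vertexMap v (refVertex d j) = v j := by
  simp [vertexMap_apply, bary_refVertex, Pi.single_apply]

theorem vertexMap_comp_perm (π : Equiv.Perm (Fin (d + 1))) (x : E d) :
    vertexMap (refVertex d ∘ π.symm) (vertexMap (refVertex d ∘ π) x) = x := by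
  rw [vertexMap_apply (refVertex d ∘ π), ← Equiv.sum_comp π.symm]
  simp only [Function.comp_apply, π.apply_symm_apply]
  rw [vertexMap_apply, bary_sum_smul_refVertex (by rw [Equiv.sum_comp π.symm, sum_bary])]
  rw [← Equiv.sum_comp π]
  simp only [Function.comp_apply, π.symm_apply_apply, sum_bary_smul_refVertex]

/-- The affine automorphism of the reference simplex that permutes its vertices by `π`. -/
def vertexPerm (π : Equiv.Perm (Fin (d + 1))) : Cell d :=
  AffineEquiv.ofBijective (φ := vertexMap (refVertex d ∘ π)) (Function.bijective_iff_has_inverse.2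
    ⟨vertexMap (refVertex d ∘ π.symm), vertexMap_comp_perm π, vertexMap_comp_perm π.symm⟩)

theorem vertexPerm_refVertex (π : Equiv.Perm (Fin (d + 1))) (j : Fin (d + 1)) :
    vertexPerm π (refVertex d j) = refVertex d (π j) :=
  vertexMap_refVertex (refVertex d ∘ π) j

end RefSimplex

section Child

variable {d : ℕ} {π : Equiv.Perm (Fin (d + 1))} {T T' : Cell d}

theorem exists_eq_of_mem_redChildren (hd : d = 2 ∨ d = 3) :
    ∀ c ∈ redChildren d, ∀ i, ∃ j, (c j).1 = i ∨ (c j).2 = i := by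
  intro c hc
  rcases hd with rfl | rfl <;>
    simp only [redChildren, List.mem_cons, List.not_mem_nil, or_false] at hc <;>
    rcases hc with rfl | rfl | rfl | rfl | rfl | rfl | rfl | rfl <;> decide

theorem corner_mem_redChildren (hd : d = 2 ∨ d = 3) : (fun j => (0, j)) ∈ redChildren d := by
  rcases hd with rfl | rfl <;> decide

theorem IsChild.cell_simplex_subset (hd : d = 2 ∨ d = 3) (h : IsChild .simplex π T T') :
    cell .simplex T' ⊆ cell .simplex T := by
  obtain ⟨c, hc, hcT⟩ := h
  let w : Fin (d + 1) → Fin (d + 1) → ℝ := fun j =>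
    (2⁻¹ : ℝ) • (Pi.single (π (c j).1) 1 + Pi.single (π (c j).2) 1)
  have hnonneg : ∀ a i, 0 ≤ (Pi.single a 1 : Fin (d + 1) → ℝ) i := fun a i =>
    Pi.single_nonneg (α := fun _ => ℝ).2 zero_le_one i
  refine HPDG.cell_simplex_subset (w := w) (fun j i => ?_) (fun j => ?_) (fun i => ?_) fun j => ?_
  · exact mul_nonneg (by norm_num) (add_nonneg (hnonneg _ _) (hnonneg _ _))
  · simp only [w, Pi.smul_apply, Pi.add_apply, smul_eq_mul, ← Finset.mul_sum,
      Finset.sum_add_distrib, Finset.sum_pi_single', Finset.mem_univ, if_true]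
    norm_num
  · obtain ⟨j, hj⟩ := exists_eq_of_mem_redChildren hd c hc (π.symm i)
    refine ⟨j, mul_pos (by norm_num) ?_⟩
    rcases hj with hj | hj
    · exact add_pos_of_pos_of_nonneg (by simp [hj]) (hnonneg _ _)
    · exact add_pos_of_nonneg_of_pos (hnonneg _ _) (by simp [hj])
  · rw [hcT j, midpoint_eq_smul_add]
    simp [w, add_smul, Finset.sum_add_distrib, Pi.single_apply]

theorem IsChild.cell_cube_subset (h : IsChild .cube π T T') : cell .cube T' ⊆ cell .cube T := by
  classical
  obtain ⟨ε, hε⟩ := h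
  rintro _ ⟨x, hx, rfl⟩
  rw [hε]
  refine ⟨_, fun i => ?_, rfl⟩
  have hcorner : (∑ k ∈ ε, EuclideanSpace.single k (1 : ℝ) : E d) i = if i ∈ ε then 1 else 0 := by
    simp [WithLp.ofLp_sum, Finset.sum_apply]
  have hxi := hx i
  simp only [PiLp.smul_apply, PiLp.add_apply, smul_eq_mul, hcorner]
  split_ifs <;> constructor <;> linarith

theorem IsChild.cell_subset (hd : d = 2 ∨ d = 3) {s : Shape} (h : IsChild s π T T') :
    cell s T' ⊆ cell s T := by
  cases s
  exacts [h.cell_simplex_subset hd, h.cell_cube_subset]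

/-- The contraction by the factor `1 / 2` towards `x₀`. -/
def halfTowards (x₀ : E d) : Cell d :=
  AffineEquiv.homothetyUnitsMulHom x₀ (Units.mk0 (1 / 2 : ℝ) (by norm_num))

theorem halfTowards_apply (x₀ x : E d) : halfTowards x₀ x = midpoint ℝ x₀ x := by
  have : halfTowards x₀ x = AffineMap.homothety x₀ (1 / 2 : ℝ) x := rfl
  rw [this, AffineMap.homothety_eq_lineMap, midpoint, invOf_eq_inv, one_div]

theorem dist_halfTowards (x₀ x y : E d) :
    dist (halfTowards x₀ x) (halfTowards x₀ y) = dist x y / 2 := by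
  rw [halfTowards_apply, halfTowards_apply, midpoint_eq_smul_add, midpoint_eq_smul_add, dist_smul₀,
    dist_add_left, invOf_eq_inv, norm_inv, Real.norm_ofNat]
  ring

open scoped Pointwise in
theorem diam_image_halfTowards (x₀ : E d) (A : Set (E d)) :
    Metric.diam (halfTowards x₀ '' A) = Metric.diam A / 2 := by
  have himage : halfTowards x₀ '' A = (2⁻¹ : ℝ) • ((x₀ + ·) '' A) := by
    rw [← Set.image_smul, Set.image_image]
    refine Set.image_congr fun x _ => ?_
    rw [halfTowards_apply, midpoint_eq_smul_add, invOf_eq_inv]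
  rw [himage, diam_smul₀, (isometry_add_left x₀).diam_image, norm_inv, Real.norm_ofNat]
  ring

theorem cell_trans_halfTowards (s : Shape) (x₀ : E d) (T : Cell d) :
    cell s ((halfTowards x₀).trans T) = halfTowards (T x₀) '' cell s T := by
  rw [cell, cell, Set.image_image]
  refine Set.image_congr fun x _ => ?_
  rw [AffineEquiv.trans_apply, halfTowards_apply, halfTowards_apply, AffineEquiv.map_midpoint]

theorem exists_isChild_cell_eq_image_halfTowards (hd : d = 2 ∨ d = 3) (s : Shape)
    (π : Equiv.Perm (Fin (d + 1))) (T : Cell d) :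
    ∃ (T' : Cell d) (x₀ : E d), IsChild s π T T' ∧ cell s T' = halfTowards x₀ '' cell s T := by
  cases s
  · let v := refVertex d (π 0)
    refine ⟨(vertexPerm π).trans ((halfTowards v).trans T), T v,
      ⟨_, corner_mem_redChildren hd, fun j => ?_⟩, ?_⟩
    · rw [AffineEquiv.trans_apply, AffineEquiv.trans_apply, vertexPerm_refVertex,
        halfTowards_apply, AffineEquiv.map_midpoint]
    · rw [← cell_trans_halfTowards]
      refine cell_simplex_eq_of_perm π fun j => ?_
      rw [AffineEquiv.trans_apply, vertexPerm_refVertex]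
  · refine ⟨(halfTowards 0).trans T, T 0, ⟨∅, fun x => ?_⟩, cell_trans_halfTowards _ _ _⟩
    simp [AffineEquiv.trans_apply, halfTowards_apply, midpoint_eq_smul_add]

end Child

section Refinement

variable {d : ℕ} {s : Shape} {𝒯 𝒯' : Finset (Cell d)} {κ : ℝ}

theorem IsRefinement.exists_half (hd : d = 2 ∨ d = 3) (h : IsRefinement s 𝒯 𝒯') {T : Cell d}
    (hT : T ∈ 𝒯) : ∃ T' ∈ 𝒯', ∃ x₀, cell s T' = halfTowards x₀ '' cell s T ∧
      Metric.diam (cell s T') = Metric.diam (cell s T) / 2 := by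
  obtain ⟨π, hπ⟩ := h
  obtain ⟨T', x₀, hch, hcell⟩ := exists_isChild_cell_eq_image_halfTowards hd s (π T) T
  exact ⟨T', (hπ T').2 ⟨T, hT, hch⟩, x₀, hcell, by rw [hcell, diam_image_halfTowards]⟩

theorem IsRefinement.isShapeRegular (hd : d = 2 ∨ d = 3) (h : IsRefinement s 𝒯 𝒯')
    (hreg : IsShapeRegular s κ 𝒯') : IsShapeRegular s κ 𝒯 := by
  intro T hT
  obtain ⟨T', hT', x₀, hcell, hdiam⟩ := h.exists_half hd hT
  obtain ⟨y, r, hr, hball, hle⟩ := hreg T' hT'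
  obtain ⟨y, rfl⟩ := (halfTowards x₀).surjective y
  refine ⟨y, 2 * r, by positivity, fun z hz => ?_, by linarith⟩
  have hmem : halfTowards x₀ z ∈ cell s T' := hball (by
    rw [Metric.mem_ball, dist_halfTowards]
    linarith [Metric.mem_ball.1 hz])
  rwa [hcell, (halfTowards x₀).injective.mem_set_image] at hmem

theorem IsRefinement.isQuasiUniform (hd : d = 2 ∨ d = 3) (h : IsRefinement s 𝒯 𝒯')
    (hqu : IsQuasiUniform s κ 𝒯') : IsQuasiUniform s κ 𝒯 := by
  intro T₁ hT₁ T₂ hT₂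
  obtain ⟨T₁', hT₁', _, _, hd₁⟩ := h.exists_half hd hT₁
  obtain ⟨T₂', hT₂', _, _, hd₂⟩ := h.exists_half hd hT₂
  have := hqu T₁' hT₁' T₂' hT₂'
  rw [hd₁, hd₂] at this
  linarith

theorem IsRefinement.diam_le (hd : d = 2 ∨ d = 3) (h : IsRefinement s 𝒯 𝒯')
    (hqu : IsQuasiUniform s κ 𝒯') {T T' : Cell d} (hT : T ∈ 𝒯) (hT' : T' ∈ 𝒯') :
    Metric.diam (cell s T) ≤ 2 * κ * Metric.diam (cell s T') := by
  obtain ⟨S, hS, _, _, hdS⟩ := h.exists_half hd hT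
  have := hqu S hS T' hT'
  rw [hdS] at this
  linarith

theorem IsRefinement.exists_parent (h : IsRefinement s 𝒯 𝒯') {T' : Cell d} (hT' : T' ∈ 𝒯') :
    ∃ T ∈ 𝒯, ∃ π, IsChild s π T T' := by
  obtain ⟨π, hπ⟩ := h
  obtain ⟨T, hT, hch⟩ := (hπ T').1 hT'
  exact ⟨T, hT, π T, hch⟩

end Refinement

/-! ### Polynomials on the children of an element -/

section Polynomial

variable {d p : ℕ}

theorem eval_aeval (L : Fin d → MvPolynomial (Fin d) ℝ) (P : MvPolynomial (Fin d) ℝ)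
    (x : Fin d → ℝ) : MvPolynomial.eval x (MvPolynomial.aeval L P) =
      MvPolynomial.eval (fun i => MvPolynomial.eval x (L i)) P := by
  rw [MvPolynomial.aeval_eq_bind₁]
  exact MvPolynomial.eval₂Hom_bind₁ _ _ _ _

theorem pushPoly_aeval {T T' : Cell d} {L : Fin d → MvPolynomial (Fin d) ℝ}
    (hL : ∀ x i, MvPolynomial.eval (fun j => x j) (L i) = T.symm (T' x) i)
    (P : MvPolynomial (Fin d) ℝ) :
    Level.pushPoly T' (MvPolynomial.aeval L P) = Level.pushPoly T P := by
  ext x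
  rw [Level.pushPoly, Level.pushPoly, eval_aeval]
  simp only [hL, AffineEquiv.apply_symm_apply]

theorem aeval_mem_refPoly {q : ℕ} {s : Shape} {P : MvPolynomial (Fin d) ℝ}
    {L : Fin d → MvPolynomial (Fin d) ℝ} (h : ∀ m ∈ P.support, ∏ i, L i ^ m i ∈ refPoly d s q) :
    MvPolynomial.aeval L P ∈ refPoly d s q := by
  rw [MvPolynomial.aeval_def, MvPolynomial.eval₂_eq']
  refine Submodule.sum_mem _ fun m hm => ?_
  rw [← Algebra.smul_def]
  exact Submodule.smul_mem _ _ (h m hm)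

theorem aeval_mem_refPoly_simplex {P : MvPolynomial (Fin d) ℝ} (hP : P ∈ refPoly d .simplex p)
    {L : Fin d → MvPolynomial (Fin d) ℝ} (hL : ∀ i, (L i).totalDegree ≤ 1) :
    MvPolynomial.aeval L P ∈ refPoly d .simplex p := by
  refine aeval_mem_refPoly fun m hm => (MvPolynomial.mem_restrictTotalDegree _ _ _).2 ?_
  calc (∏ i, L i ^ m i).totalDegree ≤ ∑ i, (L i ^ m i).totalDegree :=
        MvPolynomial.totalDegree_finsetProd _ _
    _ ≤ ∑ i, m i := by
        refine Finset.sum_le_sum fun i _ => (MvPolynomial.totalDegree_pow _ _).trans ?_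
        simpa using Nat.mul_le_mul_left (m i) (hL i)
    _ = m.sum fun _ e => e := (m.sum_fintype (fun _ e => e) fun _ => rfl).symm
    _ ≤ P.totalDegree := MvPolynomial.le_totalDegree hm
    _ ≤ p := (MvPolynomial.mem_restrictTotalDegree (Fin d) p P).1 hP

theorem aeval_mem_refPoly_cube {P : MvPolynomial (Fin d) ℝ} (hP : P ∈ refPoly d .cube p)
    {L : Fin d → MvPolynomial (Fin d) ℝ} (hL : ∀ i j, (L i).degreeOf j ≤ if i = j then 1 else 0) :
    MvPolynomial.aeval L P ∈ refPoly d .cube p := by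
  refine aeval_mem_refPoly fun m hm => (MvPolynomial.mem_restrictDegree _ _ _).2 fun n hn j => ?_
  refine MvPolynomial.degreeOf_le_iff.1 ?_ n hn
  calc (∏ i, L i ^ m i).degreeOf j ≤ ∑ i, (L i ^ m i).degreeOf j :=
        MvPolynomial.degreeOf_prod_le _ _ _
    _ ≤ ∑ i, m i * (if i = j then 1 else 0) :=
        Finset.sum_le_sum fun i _ => (MvPolynomial.degreeOf_pow_le _ _ _).trans
          (Nat.mul_le_mul_left _ (hL i j))
    _ = m j := by simp
    _ ≤ p := (MvPolynomial.mem_restrictDegree (Fin d) P p).1 hP m hm j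

/-- The `i`-th coordinate of the affine map `f`, as a polynomial. -/
def affinePoly (f : E d →ᵃ[ℝ] E d) (i : Fin d) : MvPolynomial (Fin d) ℝ :=
  MvPolynomial.C (f 0 i) +
    ∑ j, MvPolynomial.C (f.linear (EuclideanSpace.single j 1) i) * MvPolynomial.X j

theorem eval_affinePoly (f : E d →ᵃ[ℝ] E d) (i : Fin d) (x : E d) :
    MvPolynomial.eval (fun j => x j) (affinePoly f i) = f x i := by
  have hx : ∑ j, x j • EuclideanSpace.single j (1 : ℝ) = x := by
    ext j
    simp [Finset.sum_apply, Pi.single_apply]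
  have hlin : f.linear x i = ∑ j, f.linear (EuclideanSpace.single j 1) i * x j := by
    conv_lhs => rw [← hx]
    simp [WithLp.ofLp_sum, Finset.sum_apply, mul_comm]
  have hf : f x = f.linear x + f 0 := congrFun f.decomp x
  rw [hf, PiLp.add_apply, hlin]
  simp [affinePoly, add_comm]

theorem totalDegree_affinePoly_le (f : E d →ᵃ[ℝ] E d) (i : Fin d) :
    (affinePoly f i).totalDegree ≤ 1 := by
  refine (MvPolynomial.totalDegree_add _ _).trans (max_le (by simp) ?_)
  refine MvPolynomial.totalDegree_finsetSum_le fun j _ => ?_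
  exact (MvPolynomial.totalDegree_mul _ _).trans (by simp)

theorem exists_pushPoly_eq_simplex (T T' : Cell d) {P : MvPolynomial (Fin d) ℝ}
    (hP : P ∈ refPoly d .simplex p) :
    ∃ Q ∈ refPoly d .simplex p, Level.pushPoly T' Q = Level.pushPoly T P :=
  let f : E d →ᵃ[ℝ] E d := (T'.trans T.symm : Cell d)
  ⟨_, aeval_mem_refPoly_simplex hP (totalDegree_affinePoly_le f),
    pushPoly_aeval (fun x i => eval_affinePoly f i x) P⟩

theorem IsChild.exists_pushPoly_eq_cube {π : Equiv.Perm (Fin (d + 1))} {T T' : Cell d}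
    (h : IsChild .cube π T T') {P : MvPolynomial (Fin d) ℝ} (hP : P ∈ refPoly d .cube p) :
    ∃ Q ∈ refPoly d .cube p, Level.pushPoly T' Q = Level.pushPoly T P := by
  obtain ⟨ε, hε⟩ := h
  set c : E d := (1 / 2 : ℝ) • ∑ i ∈ ε, EuclideanSpace.single i 1 with hc
  let L : Fin d → MvPolynomial (Fin d) ℝ := fun i =>
    MvPolynomial.C (1 / 2) * MvPolynomial.X i + MvPolynomial.C (c i)
  refine ⟨MvPolynomial.aeval L P, aeval_mem_refPoly_cube hP fun i j => ?_,
    pushPoly_aeval (fun x i => ?_) P⟩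
  · refine (MvPolynomial.degreeOf_add_le _ _ _).trans (max_le ?_ (by simp))
    refine (MvPolynomial.degreeOf_C_mul_le _ _ _).trans ?_
    simp only [MvPolynomial.degreeOf_X, eq_comm, le_refl]
  · rw [hε, AffineEquiv.symm_apply_apply, smul_add, ← hc]
    simp [L]

theorem IsChild.exists_pushPoly_eq {s : Shape} {π : Equiv.Perm (Fin (d + 1))} {T T' : Cell d}
    (h : IsChild s π T T') {P : MvPolynomial (Fin d) ℝ} (hP : P ∈ refPoly d s p) :
    ∃ Q ∈ refPoly d s p, Level.pushPoly T' Q = Level.pushPoly T P := by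
  cases s
  exacts [exists_pushPoly_eq_simplex T T' hP, h.exists_pushPoly_eq_cube hP]

end Polynomial

/-! ### Comparison of the norms on two consecutive levels -/

theorem setIntegral_le_sum {X ι : Type*} [MeasurableSpace X] {μ : Measure X} {g : X → ℝ}
    (hg : ∀ x, 0 ≤ g x) (S : Finset ι) {A : Set X} {B : ι → Set X}
    (hint : ∀ i ∈ S, IntegrableOn g (B i) μ) (hA : A ≤ᵐ[μ] ⋃ i ∈ S, B i) :
    ∫ x in A, g x ∂μ ≤ ∑ i ∈ S, ∫ x in B i, g x ∂μ := by
  classical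
  have hle : μ.restrict (⋃ i ∈ S, B i) ≤ ∑ i ∈ S, μ.restrict (B i) := by
    clear hA hint
    induction S using Finset.induction_on with
    | empty => simp
    | insert j S hj ih =>
      rw [Finset.set_biUnion_insert, Finset.sum_insert hj]
      exact (Measure.restrict_union_le _ _).trans (add_le_add le_rfl ih)
  rw [← integral_finsetSum_measure hint]
  exact integral_mono_measure ((Measure.restrict_mono_ae hA).trans hle)
    (Filter.Eventually.of_forall hg) (integrable_finsetSum_measure.2 hint)

theorem IsPartition.closure_cell_inter_frontier_ae_le {d : ℕ} {Ω : Set (E d)} {s : Shape}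
    {𝒯 : Finset (Cell d)} (hP : IsPartition s Ω 𝒯) {T : Cell d} (hT : T ∈ 𝒯) {S : Finset (Face d)}
    (hS : ∀ F ∈ boundaryFaces s Ω 𝒯, F.cells = {T} → F ∈ S) :
    (closure (cell s T) ∩ frontier Ω : Set (E d)) ≤ᵐ[surface d] ⋃ F ∈ S, F.carrier := by
  have hnull : surface d (⋃ G ∈ {G ∈ refFacets d s | surface d (T '' G ∩ frontier Ω) = 0},
      T '' G ∩ frontier Ω) = 0 :=
    (measure_biUnion_null_iff ((refFacets_finite d s).subset fun _ h => h.1).countable).2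
      fun _ hG => hG.2
  filter_upwards [measure_eq_zero_iff_ae_notMem.1 hnull] with x hx ⟨hxT, hxΩ⟩
  rw [hP.isOpen.frontier_eq] at hxΩ
  obtain ⟨G, hG, hxG⟩ := hP.exists_refFacet_of_mem_closure_cell hT hxT hxΩ.2
  have hpos : 0 < surface d (T '' G ∩ frontier Ω) := pos_iff_ne_zero.2 fun h0 =>
    hx (Set.mem_iUnion₂.2 ⟨G, ⟨hG, h0⟩, hxG⟩)
  exact Set.mem_iUnion₂.2
    ⟨_, hS ⟨{T}, _⟩ (mem_boundaryFaces.2 ⟨T, hT, G, hG, rfl, hpos⟩) rfl, hxG⟩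

namespace Level

variable {d : ℕ} {Ω : Set (E d)}

/-- The mesh of `Df` is nested in the mesh of `Dc`; `par` maps an element to its parent. -/
structure IsNested (Dc Df : Level d Ω) (par : Cell d → Cell d) : Prop where
  shape_eq : Df.shape = Dc.shape
  V_le : Dc.V ≤ Df.V
  mem : ∀ T ∈ Df.mesh, par T ∈ Dc.mesh
  subset : ∀ T ∈ Df.mesh, cell Dc.shape T ⊆ cell Dc.shape (par T)

/-- The bounds on the mesh sizes and on the polynomial degrees of two consecutive levels. -/
structure IsComparable (Dc Df : Level d Ω) (κ₂ c : ℝ) : Prop where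
  diam_le : ∀ T ∈ Dc.mesh, ∀ T' ∈ Df.mesh,
    Metric.diam (cell Dc.shape T) ≤ 2 * κ₂ * Metric.diam (cell Dc.shape T')
  degree_le : (Df.degree : ℝ) ≤ c * Dc.degree

theorem exists_isNested (hd : d = 2 ∨ d = 3) {Dc Df : Level d Ω} (hs : Df.shape = Dc.shape)
    (href : IsRefinement Dc.shape Dc.mesh Df.mesh) (hdeg : Dc.degree ≤ Df.degree) :
    ∃ par, IsNested Dc Df par := by
  have h : ∀ T' ∈ Df.mesh, ∃ T ∈ Dc.mesh, ∃ π, IsChild Dc.shape π T T' :=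
    fun T' hT' => href.exists_parent hT'
  choose! par hmem π hch using h
  refine ⟨par, hs, fun v hv T' hT' => ?_, hmem, fun T' hT' => (hch T' hT').cell_subset hd⟩
  obtain ⟨P, hP, hvP⟩ := hv (par T') (hmem T' hT')
  obtain ⟨Q, hQ, hQe⟩ := (hch T' hT').exists_pushPoly_eq hP
  rw [hs]
  refine ⟨Q, refPoly_mono hdeg hQ, ?_⟩
  filter_upwards [hvP] with x hx hxT'
  rw [hx ((hch T' hT').cell_subset hd hxT'), hQe]

theorem isComparable_of_isRefinement (hd : d = 2 ∨ d = 3) {Dc Df : Level d Ω} {κ₂ c : ℝ}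
    (hs : Df.shape = Dc.shape) (href : IsRefinement Dc.shape Dc.mesh Df.mesh)
    (hqu : IsQuasiUniform Df.shape κ₂ Df.mesh) (hdeg : (Df.degree : ℝ) ≤ c * Dc.degree) :
    IsComparable Dc Df κ₂ c :=
  ⟨fun _ hT _ hT' => href.diam_le hd (hs ▸ hqu) hT hT', hdeg⟩

variable {Dc Df : Level d Ω} {par : Cell d → Cell d} {κ₁ κ₂ B c : ℝ}

/-- The inclusion `R` of the coarse space into the fine one. -/
abbrev IsNested.incl (h : IsNested Dc Df par) : Dc.V →ₗ[ℝ] Df.V := Submodule.inclusion h.V_le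

theorem IsNested.on_incl (h : IsNested Dc Df par) (hPc : Dc.IsMesh) (hPf : Df.IsMesh)
    (v : Dc.V) {T : Cell d} (hT : T ∈ Df.mesh) : Df.on (h.incl v) T = Dc.on v (par T) := by
  refine on_eq_of_ae_eq hPf _ hT (Dc.continuous_on v (par T)) (Dc.isPolyOnLines_on v (par T))
    (isOpen_cell Df.shape T) (cell_nonempty Df.shape T) subset_rfl ?_
  rw [h.shape_eq]
  exact ae_mono (Measure.restrict_mono (h.subset T hT) le_rfl) (on_ae_cell hPc v (h.mem T hT))

theorem IsNested.brokenInner_grad_le (h : IsNested Dc Df par) (hPc : Dc.IsMesh) (hPf : Df.IsMesh)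
    (v : Dc.V) : Df.brokenInner (grad (h.incl v)) (grad (h.incl v)) ≤
      Dc.brokenInner (grad v) (grad v) := by
  classical
  have hint : ∀ T A, IntegrableOn (fun x => ⟪grad v T x, grad v T x⟫) (cell Dc.shape A) :=
    fun T A => integrableOn_inner_cell (continuous_grad v T) (continuous_grad v T) A
  have hdisj : ∀ T ∈ Df.mesh, ∀ T' ∈ Df.mesh, T ≠ T' →
      Disjoint (cell Dc.shape T) (cell Dc.shape T') := h.shape_eq ▸ hPf.disjoint
  calc Df.brokenInner (grad (h.incl v)) (grad (h.incl v))
      = ∑ T' ∈ Df.mesh, ∫ x in cell Dc.shape T', ⟪grad v (par T') x, grad v (par T') x⟫ :=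
        Finset.sum_congr rfl fun T' hT' => by
          rw [grad, h.on_incl hPc hPf v hT', h.shape_eq]; rfl
    _ = ∑ T ∈ Dc.mesh, ∑ T' ∈ Df.mesh with par T' = T,
          ∫ x in cell Dc.shape T', ⟪grad v T x, grad v T x⟫ := by
        rw [← Finset.sum_fiberwise_of_maps_to h.mem]
        refine Finset.sum_congr rfl fun T _ => Finset.sum_congr rfl fun T' hT' => ?_
        rw [(Finset.mem_filter.1 hT').2]
    _ ≤ Dc.brokenInner (grad v) (grad v) := Finset.sum_le_sum fun T _ => by
        rw [← integral_biUnion_finset _ (fun T' _ => measurableSet_cell Dc.shape T')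
          (fun T₁ h₁ T₂ h₂ => hdisj T₁ (Finset.mem_filter.1 h₁).1 T₂ (Finset.mem_filter.1 h₂).1)
          fun T' _ => hint T T']
        refine setIntegral_mono_set (hint T T)
          (Filter.Eventually.of_forall fun _ => real_inner_self_nonneg)
          (Set.iUnion₂_subset fun T' hT' => ?_).eventuallyLE
        obtain ⟨hT'm, rfl⟩ := Finset.mem_filter.1 hT'
        exact h.subset T' hT'm

theorem IsNested.weight_le (h : IsNested Dc Df par) (hd : 0 < d) (hcmp : IsComparable Dc Df κ₂ c)
    {f F : Face d} (hf : f ∈ faces Df.shape Ω Df.mesh) (hF : F ∈ faces Dc.shape Ω Dc.mesh)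
    (hfF : ∀ T ∈ f.cells, par T ∈ F.cells) :
    (Df.degree : ℝ) ^ 2 / faceSize Df.shape f ≤
      2 * κ₂ * c ^ 2 * ((Dc.degree : ℝ) ^ 2 / faceSize Dc.shape F) := by
  obtain ⟨T, hT, hsz⟩ := exists_faceSize_eq (s := Df.shape) (cells_nonempty hf)
  have hTm := mem_mesh_of_mem_cells hf hT
  have hposF : 0 < faceSize Dc.shape F := faceSize_pos hd (cells_nonempty hF)
  have hposf : 0 < faceSize Df.shape f := faceSize_pos hd (cells_nonempty hf)
  have hsize : faceSize Dc.shape F ≤ 2 * κ₂ * faceSize Df.shape f := by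
    rw [hsz, h.shape_eq]
    exact (faceSize_le (hfF T hT)).trans (hcmp.diam_le (par T) (h.mem T hTm) T hTm)
  have hdeg : (Df.degree : ℝ) ^ 2 ≤ c ^ 2 * (Dc.degree : ℝ) ^ 2 := by
    rw [← mul_pow]
    exact pow_le_pow_left₀ (Nat.cast_nonneg _) hcmp.degree_le 2
  rw [div_le_iff₀ hposf]
  calc (Df.degree : ℝ) ^ 2 ≤ c ^ 2 * (Dc.degree : ℝ) ^ 2 := hdeg
    _ = c ^ 2 * (Dc.degree : ℝ) ^ 2 / faceSize Dc.shape F * faceSize Dc.shape F := by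
        field_simp
    _ ≤ c ^ 2 * (Dc.degree : ℝ) ^ 2 / faceSize Dc.shape F * (2 * κ₂ * faceSize Df.shape f) :=
        mul_le_mul_of_nonneg_left hsize (by positivity)
    _ = _ := by ring

open Classical in
/-- The coarse faces that can contain the fine face `f`. -/
def parentFaces (Dc : Level d Ω) (par : Cell d → Cell d) (f : Face d) : Finset (Face d) :=
  (faces Dc.shape Ω Dc.mesh).filter fun F => ∀ T ∈ f.cells, par T ∈ F.cells

theorem mem_parentFaces {f F : Face d} : F ∈ parentFaces Dc par f ↔
    F ∈ faces Dc.shape Ω Dc.mesh ∧ ∀ T ∈ f.cells, par T ∈ F.cells := by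
  classical exact Finset.mem_filter

theorem sum_parentFaces_nonneg (hd : 0 < d) (v : Dc.V) (f : Face d) :
    0 ≤ ∑ F ∈ parentFaces Dc par f, faceJumpSq v F :=
  Finset.sum_nonneg fun _ hF => faceJumpSq_nonneg hd v (mem_parentFaces.1 hF).1

theorem IsNested.faceJumpSq_le_of_subset (h : IsNested Dc Df par) (hd : 0 < d)
    (hcmp : IsComparable Dc Df κ₂ c) (h₂ : 0 ≤ κ₂) (hPc : Dc.IsMesh) {f : Face d}
    (hf : f ∈ faces Df.shape Ω Df.mesh) (v : Dc.V) {S : Finset (Face d)}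
    (hS : S ⊆ parentFaces Dc par f) (hsub : f.carrier ≤ᵐ[surface d] ⋃ F ∈ S, F.carrier)
    (hjump : ∀ F ∈ S, ∀ x, ‖Df.jump (h.incl v) f x‖ = ‖Dc.jump v F x‖) :
    faceJumpSq (h.incl v) f ≤ 2 * κ₂ * c ^ 2 * ∑ F ∈ parentFaces Dc par f, faceJumpSq v F := by
  have hSf : ∀ F ∈ S, F ∈ faces Dc.shape Ω Dc.mesh := fun F hF => (mem_parentFaces.1 (hS hF)).1
  have hint : ∫ x in f.carrier, ‖Df.jump (h.incl v) f x‖ ^ 2 ∂(surface d) ≤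
      ∑ F ∈ S, ∫ x in F.carrier, ‖Dc.jump v F x‖ ^ 2 ∂(surface d) := by
    refine (setIntegral_le_sum (fun x => sq_nonneg _) S (fun F hF => integrableOn_carrier hPc
      (hSf F hF) ((continuous_jump _ _).norm.pow 2)) hsub).trans_eq ?_
    exact Finset.sum_congr rfl fun F hF => by simp only [hjump F hF]
  calc faceJumpSq (h.incl v) f
      ≤ (Df.degree : ℝ) ^ 2 / faceSize Df.shape f *
          ∑ F ∈ S, ∫ x in F.carrier, ‖Dc.jump v F x‖ ^ 2 ∂(surface d) :=
        mul_le_mul_of_nonneg_left hint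
          (div_nonneg (sq_nonneg _) (faceSize_pos hd (cells_nonempty hf)).le)
    _ ≤ ∑ F ∈ S, 2 * κ₂ * c ^ 2 * faceJumpSq v F := by
        rw [Finset.mul_sum]
        refine Finset.sum_le_sum fun F hF => ?_
        rw [faceJumpSq, ← mul_assoc]
        exact mul_le_mul_of_nonneg_right
          (h.weight_le hd hcmp hf (hSf F hF) (mem_parentFaces.1 (hS hF)).2)
          (integral_nonneg fun _ => sq_nonneg _)
    _ ≤ ∑ F ∈ parentFaces Dc par f, 2 * κ₂ * c ^ 2 * faceJumpSq v F :=
        Finset.sum_le_sum_of_subset_of_nonneg hS fun F hF _ =>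
          mul_nonneg (by positivity) (faceJumpSq_nonneg hd v (mem_parentFaces.1 hF).1)
    _ = _ := (Finset.mul_sum _ _ _).symm

theorem IsNested.faceJumpSq_le_of_mem_interiorFaces (h : IsNested Dc Df par) (hd : 2 ≤ d)
    (hcmp : IsComparable Dc Df κ₂ c) (h₂ : 0 ≤ κ₂) (hPc : Dc.IsMesh) (hPf : Df.IsMesh)
    {f : Face d} (hf : f ∈ interiorFaces Df.shape Df.mesh) (v : Dc.V) :
    faceJumpSq (h.incl v) f ≤ 2 * κ₂ * c ^ 2 * ∑ F ∈ parentFaces Dc par f, faceJumpSq v F := by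
  classical
  obtain ⟨T, hT, T', hT', -, hfe, hpos⟩ := mem_interiorFaces.1 hf
  have hc : f.cells = {T, T'} := by rw [hfe]
  have hjump : ∀ x, ‖Df.jump (h.incl v) f x‖ = |Dc.on v (par T) x - Dc.on v (par T') x| := by
    intro x
    rw [norm_jump_of_mem_interiorFaces hd hPf _ hf hc, h.on_incl hPc hPf v hT,
      h.on_incl hPc hPf v hT']
  by_cases hpar : par T = par T'
  · have h0 : faceJumpSq (h.incl v) f = 0 := by simp [faceJumpSq, hjump, hpar]
    rw [h0]
    exact mul_nonneg (by positivity) (sum_parentFaces_nonneg (by omega) v f)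
  · set F : Face d := ⟨{par T, par T'},
      closure (cell Dc.shape (par T)) ∩ closure (cell Dc.shape (par T'))⟩
    have hsub : f.carrier ⊆ F.carrier := by
      rw [hfe, h.shape_eq]
      exact Set.inter_subset_inter (closure_mono (h.subset T hT)) (closure_mono (h.subset T' hT'))
    have hF : F ∈ interiorFaces Dc.shape Dc.mesh :=
      mem_interiorFaces.2 ⟨par T, h.mem T hT, par T', h.mem T' hT', hpar, rfl,
        hpos.trans_le (measure_mono hsub)⟩
    refine h.faceJumpSq_le_of_subset (by omega) hcmp h₂ hPc (mem_faces_of_mem_interiorFaces hf) v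
      (S := {F}) ?_ ?_ ?_
    · rw [Finset.singleton_subset_iff, mem_parentFaces, hc]
      exact ⟨mem_faces_of_mem_interiorFaces hF, by simp [F]⟩
    · rw [Finset.set_biUnion_singleton]
      exact hsub.eventuallyLE
    · intro F' hF' x
      rw [Finset.mem_singleton.1 hF', hjump, norm_jump_of_mem_interiorFaces hd hPc v hF rfl]

theorem IsNested.faceJumpSq_le_of_mem_boundaryFaces (h : IsNested Dc Df par) (hd : 0 < d)
    (hcmp : IsComparable Dc Df κ₂ c) (h₂ : 0 ≤ κ₂) (hPc : Dc.IsMesh) (hPf : Df.IsMesh)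
    {f : Face d} (hf : f ∈ boundaryFaces Df.shape Ω Df.mesh) (v : Dc.V) :
    faceJumpSq (h.incl v) f ≤ 2 * κ₂ * c ^ 2 * ∑ F ∈ parentFaces Dc par f, faceJumpSq v F := by
  classical
  have hff : f ∈ faces Df.shape Ω Df.mesh := mem_faces.2 (Or.inr hf)
  obtain ⟨T, hT, G, -, hfe, -⟩ := mem_boundaryFaces.1 hf
  have hc : f.cells = {T} := by rw [hfe]
  have hsub : f.carrier ⊆ closure (cell Dc.shape (par T)) ∩ frontier Ω := by
    refine Set.subset_inter ?_ (by rw [hfe]; exact Set.inter_subset_right)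
    refine (carrier_subset_closure hff (T := T) (by simp [hc])).trans ?_
    rw [h.shape_eq]
    exact closure_mono (h.subset T hT)
  set S := (faces Dc.shape Ω Dc.mesh).filter fun F => F.cells = {par T}
  have hS : ∀ F ∈ S, F ∈ faces Dc.shape Ω Dc.mesh ∧ F.cells = {par T} := fun F hF =>
    Finset.mem_filter.1 hF
  refine h.faceJumpSq_le_of_subset hd hcmp h₂ hPc hff v (S := S) ?_ ?_ ?_
  · intro F hF
    exact mem_parentFaces.2 ⟨(hS F hF).1, by simp [hc, (hS F hF).2]⟩
  · exact hsub.eventuallyLE.trans (hPc.closure_cell_inter_frontier_ae_le (h.mem T hT)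
      fun F hF hFc => Finset.mem_filter.2 ⟨mem_faces.2 (Or.inr hF), hFc⟩)
  · intro F hF x
    rw [norm_jump_of_cells_eq_singleton hPf _ hff hc, h.on_incl hPc hPf v hT,
      norm_jump_of_cells_eq_singleton hPc v (hS F hF).1 (hS F hF).2]

theorem IsNested.faceJumpSq_le (h : IsNested Dc Df par) (hd : 2 ≤ d)
    (hcmp : IsComparable Dc Df κ₂ c) (h₂ : 0 ≤ κ₂) (hPc : Dc.IsMesh) (hPf : Df.IsMesh)
    {f : Face d} (hf : f ∈ faces Df.shape Ω Df.mesh) (v : Dc.V) :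
    faceJumpSq (h.incl v) f ≤ 2 * κ₂ * c ^ 2 * ∑ F ∈ parentFaces Dc par f, faceJumpSq v F :=
  (mem_faces.1 hf).elim
    (fun hi => h.faceJumpSq_le_of_mem_interiorFaces hd hcmp h₂ hPc hPf hi v)
    fun hb => h.faceJumpSq_le_of_mem_boundaryFaces (by omega) hcmp h₂ hPc hPf hb v

open Classical in
theorem IsNested.card_children_le (h : IsNested Dc Df par) (hd : 0 < d) (h₁ : 0 < κ₁)
    (h₂ : 0 < κ₂) (hcmp : IsComparable Dc Df κ₂ c) (hDf : Df.IsRegular κ₁ κ₂ B) {T : Cell d}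
    (hT : T ∈ Dc.mesh) : ((Df.mesh.filter (par · = T)).card : ℝ) ≤ (2 * κ₁ * κ₂) ^ d := by
  obtain ⟨x, hx⟩ := cell_nonempty Dc.shape T
  have hδ := diam_cell_pos Dc.shape T hd
  have hP : IsPartition Dc.shape Ω Df.mesh := h.shape_eq ▸ hDf.isMesh
  have hreg : IsShapeRegular Dc.shape κ₁ Df.mesh := h.shape_eq ▸ hDf.shapeRegular
  calc ((Df.mesh.filter (par · = T)).card : ℝ)
      ≤ (κ₁ * Metric.diam (cell Dc.shape T) /
          (Metric.diam (cell Dc.shape T) / (2 * κ₂))) ^ d := by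
        refine hP.card_le_of_subset_closedBall hreg h₁ (Finset.filter_subset _ _) (x := x) hδ.le
          (by positivity) (fun T' hT' => ?_) fun T' hT' y hy => ?_
        · rw [div_le_iff₀' (by positivity)]
          exact hcmp.diam_le T hT T' (Finset.mem_filter.1 hT').1
        · obtain ⟨hT'm, rfl⟩ := Finset.mem_filter.1 hT'
          exact Metric.dist_le_diam_of_mem (isBounded_cell _ _) (h.subset T' hT'm hy) hx
    _ = (2 * κ₁ * κ₂) ^ d := by
        congr 1
        field_simp

open Classical in
theorem IsNested.card_filter_mem_parentFaces_le (h : IsNested Dc Df par) (hd : 0 < d)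
    (h₁ : 0 < κ₁) (h₂ : 0 < κ₂) (hcmp : IsComparable Dc Df κ₂ c) (hDf : Df.IsRegular κ₁ κ₂ B)
    {F : Face d} (hF : F ∈ faces Dc.shape Ω Dc.mesh) :
    (((faces Df.shape Ω Df.mesh).filter fun f => F ∈ parentFaces Dc par f).card : ℝ) ≤
      2 * (2 * κ₁ * κ₂) ^ d * faceBound d Df.shape κ₁ κ₂ := by
  set A := F.cells.biUnion fun T => Df.mesh.filter (par · = T)
  have hA : (A.card : ℝ) ≤ 2 * (2 * κ₁ * κ₂) ^ d := by
    calc (A.card : ℝ) ≤ ∑ T ∈ F.cells, ((Df.mesh.filter (par · = T)).card : ℝ) := by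
          exact_mod_cast Finset.card_biUnion_le
      _ ≤ ∑ T ∈ F.cells, (2 * κ₁ * κ₂) ^ d := Finset.sum_le_sum fun T hT =>
          h.card_children_le hd h₁ h₂ hcmp hDf (mem_mesh_of_mem_cells hF hT)
      _ = F.cells.card * (2 * κ₁ * κ₂) ^ d := by rw [Finset.sum_const, nsmul_eq_mul]
      _ ≤ _ := mul_le_mul_of_nonneg_right (card_cells_le_two hF) (by positivity)
  have hsub : ((faces Df.shape Ω Df.mesh).filter fun f => F ∈ parentFaces Dc par f) ⊆
      A.biUnion fun T' => (faces Df.shape Ω Df.mesh).filter fun f => T' ∈ f.cells := by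
    intro f hf
    obtain ⟨hf, hFf⟩ := Finset.mem_filter.1 hf
    obtain ⟨T', hT'⟩ := cells_nonempty hf
    exact Finset.mem_biUnion.2 ⟨T', Finset.mem_biUnion.2 ⟨par T', (mem_parentFaces.1 hFf).2 T' hT',
      Finset.mem_filter.2 ⟨mem_mesh_of_mem_cells hf hT', rfl⟩⟩, Finset.mem_filter.2 ⟨hf, hT'⟩⟩
  calc (((faces Df.shape Ω Df.mesh).filter fun f => F ∈ parentFaces Dc par f).card : ℝ)
      ≤ ∑ T' ∈ A, (((faces Df.shape Ω Df.mesh).filter fun f => T' ∈ f.cells).card : ℝ) := by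
        exact_mod_cast (Finset.card_le_card hsub).trans Finset.card_biUnion_le
    _ ≤ ∑ _T' ∈ A, faceBound d Df.shape κ₁ κ₂ := by
        refine Finset.sum_le_sum fun T' hT' => ?_
        obtain ⟨T, -, hT'⟩ := Finset.mem_biUnion.1 hT'
        exact card_faces_le hd hDf.isMesh hDf.shapeRegular hDf.quasiUniform
          (Finset.mem_filter.1 hT').1
    _ = A.card * faceBound d Df.shape κ₁ κ₂ := by rw [Finset.sum_const, nsmul_eq_mul]
    _ ≤ _ := mul_le_mul_of_nonneg_right hA (faceBound_pos h₁ h₂).le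

/-- The factor by which the squared jump seminorm can grow from one level to the next. -/
def jumpTransferConst (d : ℕ) (s : Shape) (κ₁ κ₂ c : ℝ) : ℝ :=
  2 * κ₂ * c ^ 2 * (2 * (2 * κ₁ * κ₂) ^ d * faceBound d s κ₁ κ₂)

theorem jumpTransferConst_nonneg {s : Shape} (h₁ : 0 < κ₁) (h₂ : 0 < κ₂) :
    0 ≤ jumpTransferConst d s κ₁ κ₂ c := by
  have := faceBound_pos (d := d) (s := s) h₁ h₂
  unfold jumpTransferConst
  positivity

theorem IsNested.jumpSum_le (h : IsNested Dc Df par) (hd : 2 ≤ d) (h₁ : 0 < κ₁) (h₂ : 0 < κ₂)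
    (hcmp : IsComparable Dc Df κ₂ c) (hPc : Dc.IsMesh) (hDf : Df.IsRegular κ₁ κ₂ B) (v : Dc.V) :
    jumpSum (h.incl v) ≤ jumpTransferConst d Df.shape κ₁ κ₂ c * jumpSum v := by
  classical
  have hd0 : 0 < d := by omega
  calc jumpSum (h.incl v)
      ≤ ∑ f ∈ faces Df.shape Ω Df.mesh,
          2 * κ₂ * c ^ 2 * ∑ F ∈ parentFaces Dc par f, faceJumpSq v F :=
        Finset.sum_le_sum fun f hf => h.faceJumpSq_le hd hcmp h₂.le hPc hDf.isMesh hf v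
    _ = 2 * κ₂ * c ^ 2 * ∑ F ∈ faces Dc.shape Ω Dc.mesh,
          ∑ _f ∈ (faces Df.shape Ω Df.mesh).filter fun f => F ∈ parentFaces Dc par f,
            faceJumpSq v F := by
        rw [← Finset.mul_sum, Finset.sum_comm' fun f F => ?_]
        simp only [Finset.mem_filter]
        exact ⟨fun hf => ⟨hf, (mem_parentFaces.1 hf.2).1⟩, And.left⟩
    _ ≤ 2 * κ₂ * c ^ 2 * ∑ F ∈ faces Dc.shape Ω Dc.mesh,
          2 * (2 * κ₁ * κ₂) ^ d * faceBound d Df.shape κ₁ κ₂ * faceJumpSq v F := by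
        refine mul_le_mul_of_nonneg_left (Finset.sum_le_sum fun F hF => ?_) (by positivity)
        rw [Finset.sum_const, nsmul_eq_mul]
        exact mul_le_mul_of_nonneg_right
          (h.card_filter_mem_parentFaces_le hd0 h₁ h₂ hcmp hDf hF) (faceJumpSq_nonneg hd0 v hF)
    _ = jumpTransferConst d Df.shape κ₁ κ₂ c * jumpSum v := by
        rw [← Finset.mul_sum, ← mul_assoc, jumpTransferConst, jumpSum]

end Level

/-! ### Adjoints with respect to a pair of forms -/

section Adjoint

variable {V W : Type*} [AddCommGroup V] [Module ℝ V] [AddCommGroup W] [Module ℝ W]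

theorem existsUnique_adjoint [FiniteDimensional ℝ W] (a : V →ₗ[ℝ] V →ₗ[ℝ] ℝ)
    (b : W →ₗ[ℝ] W →ₗ[ℝ] ℝ) (hb : ∀ w, w ≠ 0 → 0 < b w w) (R : W →ₗ[ℝ] V) :
    ∃! P : V →ₗ[ℝ] W, ∀ v w, b (P v) w = a v (R w) := by
  have hinj : Function.Injective b := LinearMap.ker_eq_bot.1 <| LinearMap.ker_eq_bot'.2
    fun w hw => by
      by_contra hne
      simpa [hw] using hb w hne
  let e : W ≃ₗ[ℝ] Module.Dual ℝ W :=
    LinearMap.linearEquivOfInjective b hinj Subspace.dual_finrank_eq.symm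
  have he : ∀ f, b (e.symm f) = f := e.apply_symm_apply
  refine ⟨e.symm.toLinearMap ∘ₗ R.dualMap ∘ₗ a, fun v w => ?_, fun P hP => ?_⟩
  · exact LinearMap.congr_fun (he (R.dualMap (a v))) w
  · ext v
    refine hinj (LinearMap.ext fun w => ?_)
    exact (hP v w).trans (LinearMap.congr_fun (he (R.dualMap (a v))) w).symm

theorem sqrt_adjoint_le {a : V →ₗ[ℝ] V →ₗ[ℝ] ℝ} {b : W →ₗ[ℝ] W →ₗ[ℝ] ℝ}
    (ha : ∀ v, 0 ≤ a v v) (hsymm : ∀ v v', a v v' = a v' v) (hb : ∀ w, 0 ≤ b w w)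
    {R : W →ₗ[ℝ] V} {C : ℝ} (hC : 0 ≤ C) (hR : ∀ w, √(a (R w) (R w)) ≤ C * √(b w w))
    {P : V →ₗ[ℝ] W} (hP : ∀ v w, b (P v) w = a v (R w)) (v : V) :
    √(b (P v) (P v)) ≤ C * √(a v v) := by
  have cauchySchwarz : a v (R (P v)) ≤ √(a v v) * √(a (R (P v)) (R (P v))) := by
    rw [← Real.sqrt_mul (ha v)]
    refine Real.le_sqrt_of_sq_le ?_
    have := LinearMap.BilinForm.apply_mul_apply_le_of_forall_zero_le a ha v (R (P v))
    rwa [hsymm (R (P v)) v, ← sq] at this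
  rcases (Real.sqrt_nonneg (b (P v) (P v))).eq_or_lt with h | h
  · rw [← h]
    positivity
  · refine le_of_mul_le_mul_right ?_ h
    calc √(b (P v) (P v)) * √(b (P v) (P v)) = a v (R (P v)) := by
          rw [Real.mul_self_sqrt (hb _), hP]
      _ ≤ √(a v v) * (C * √(b (P v) (P v))) :=
          cauchySchwarz.trans (mul_le_mul_of_nonneg_left (hR _) (Real.sqrt_nonneg _))
      _ = C * √(a v v) * √(b (P v) (P v)) := by ring

end Adjoint

/-! ### Stability of the transfer between two levels -/

namespace Level

variable {d : ℕ} {s : Shape} {Ω : Set (E d)} {D Dc Df : Level d Ω} {par : Cell d → Cell d}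
  {κ₁ κ₂ B αmin αmax c : ℝ}

/-- A regular level whose penalty parameter lies in `[αmin, αmax]` and, unless the lifting term is
part of the form (`θ = 1`), is large enough for coercivity. -/
structure IsAdmissible (D : Level d Ω) (κ₁ κ₂ B αmin αmax : ℝ) : Prop extends
    D.IsRegular κ₁ κ₂ B where
  le_α : αmin ≤ D.α
  α_le : D.α ≤ αmax
  θ_eq : D.θ = 0 ∧ 4 * liftConst d D.shape κ₁ κ₂ B ≤ αmin ∨ D.θ = 1

theorem IsAdmissible.θ_le_one (hD : D.IsAdmissible κ₁ κ₂ B αmin αmax) : D.θ ≤ 1 := by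
  rcases hD.θ_eq with ⟨h, -⟩ | h <;> simp [h]

theorem IsAdmissible.form_pos (hD : D.IsAdmissible κ₁ κ₂ B αmin αmax) (hd : 2 ≤ d) (h₁ : 0 < κ₁)
    (h₂ : 0 < κ₂) (hB : 0 ≤ B) (hα : 0 < αmin) {v : D.V} (hv : v ≠ 0) : 0 < D.form v v :=
  Level.form_pos hd h₁ h₂ hB hD.toIsRegular hα hD.le_α hD.θ_eq hv

/-- The factor by which the square of the DG norm can grow under the inclusion of a coarse space
into the fine one. -/
def transferConst (d : ℕ) (s : Shape) (κ₁ κ₂ αmin αmax c : ℝ) : ℝ :=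
  1 + |αmax| / αmin * jumpTransferConst d s κ₁ κ₂ c

theorem transferConst_pos (h₁ : 0 < κ₁) (h₂ : 0 < κ₂) (hα : 0 < αmin) :
    0 < transferConst d s κ₁ κ₂ αmin αmax c := by
  have := jumpTransferConst_nonneg (d := d) (s := s) (c := c) h₁ h₂
  unfold transferConst
  positivity

theorem IsNested.dgNormSq_le (h : IsNested Dc Df par) (hd : 2 ≤ d) (h₁ : 0 < κ₁) (h₂ : 0 < κ₂)
    (hα : 0 < αmin) (hcmp : IsComparable Dc Df κ₂ c) (hPc : Dc.IsMesh) (hαc : αmin ≤ Dc.α)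
    (hDf : Df.IsRegular κ₁ κ₂ B) (hαf : Df.α ≤ αmax) (v : Dc.V) :
    dgNormSq (h.incl v) ≤ transferConst d Df.shape κ₁ κ₂ αmin αmax c * dgNormSq v := by
  have hd0 : 0 < d := by omega
  have hG0 := brokenInner_self_nonneg (D := Dc) (grad v)
  have hJ0 := jumpSum_nonneg hd0 v
  have hQ := jumpTransferConst_nonneg (d := d) (s := Df.shape) (c := c) h₁ h₂
  rw [dgNormSq, dgNormSq, jumpForm_self, jumpForm_self, transferConst]
  set Q := jumpTransferConst d Df.shape κ₁ κ₂ c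
  have hgrad := h.brokenInner_grad_le hPc hDf.isMesh v
  have hjump : Df.α * jumpSum (h.incl v) ≤ |αmax| / αmin * Q * (Dc.α * jumpSum v) := by
    calc Df.α * jumpSum (h.incl v) ≤ |αmax| * (Q * jumpSum v) :=
          mul_le_mul (hαf.trans (le_abs_self _)) (h.jumpSum_le hd h₁ h₂ hcmp hPc hDf v)
            (jumpSum_nonneg hd0 _) (abs_nonneg _)
      _ = |αmax| / αmin * Q * (αmin * jumpSum v) := by field_simp
      _ ≤ _ := mul_le_mul_of_nonneg_left (mul_le_mul_of_nonneg_right hαc hJ0) (by positivity)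
  have hcross : 0 ≤ |αmax| / αmin * Q * Dc.brokenInner (grad v) (grad v) := by positivity
  have hJα : 0 ≤ Dc.α * jumpSum v := mul_nonneg (hα.le.trans hαc) hJ0
  linarith

/-- The constant `C_stab` of the lemma. -/
def stabConst (d : ℕ) (s : Shape) (κ₁ κ₂ B αmin αmax c : ℝ) : ℝ :=
  √((2 + 2 * (liftConst d s κ₁ κ₂ B / αmin)) * transferConst d s κ₁ κ₂ αmin αmax c /
    coercConst (liftConst d s κ₁ κ₂ B) αmin)

theorem stabConst_pos (h₁ : 0 < κ₁) (h₂ : 0 < κ₂) (hB : 0 ≤ B) (hα : 0 < αmin) :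
    0 < stabConst d s κ₁ κ₂ B αmin αmax c := by
  have hL := liftConst_pos (d := d) (s := s) h₁ h₂ hB
  have hT := transferConst_pos (d := d) (s := s) (αmax := αmax) (c := c) h₁ h₂ hα
  have hC := coercConst_pos hL hα
  exact Real.sqrt_pos.2 (by positivity)

theorem IsNested.energyNorm_incl_le (h : IsNested Dc Df par) (hd : 2 ≤ d) (h₁ : 0 < κ₁)
    (h₂ : 0 < κ₂) (hB : 0 ≤ B) (hα : 0 < αmin) (hcmp : IsComparable Dc Df κ₂ c)
    (hDc : Dc.IsAdmissible κ₁ κ₂ B αmin αmax) (hDf : Df.IsAdmissible κ₁ κ₂ B αmin αmax)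
    (v : Dc.V) :
    Df.energyNorm (h.incl v) ≤ stabConst d Dc.shape κ₁ κ₂ B αmin αmax c * Dc.energyNorm v := by
  have hd0 : 0 < d := by omega
  have hL := liftConst_pos (d := d) (s := Dc.shape) h₁ h₂ hB
  have hT := transferConst_pos (d := d) (s := Dc.shape) (αmax := αmax) (c := c) h₁ h₂ hα
  have hC := coercConst_pos hL hα
  have hcont := form_le hd0 h₁ h₂ hB hDf.toIsRegular hα hDf.le_α hDf.θ_le_one (h.incl v)
  have hdg := h.dgNormSq_le hd h₁ h₂ hα hcmp hDc.isMesh hDc.le_α hDf.toIsRegular hDf.α_le v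
  have hcoer := coercConst_mul_dgNormSq_le_form hd0 h₁ h₂ hB hDc.toIsRegular hα hDc.le_α hDc.θ_eq v
  rw [h.shape_eq] at hcont hdg
  rw [energyNorm, energyNorm, stabConst, ← Real.sqrt_mul (by positivity)]
  refine Real.sqrt_le_sqrt (hcont.trans ?_)
  rw [mul_div_assoc, mul_assoc]
  refine mul_le_mul_of_nonneg_left (hdg.trans ?_) (by positivity)
  rw [div_mul_eq_mul_div, mul_div_assoc]
  exact mul_le_mul_of_nonneg_left ((le_div_iff₀' hC).2 hcoer) hT.le

theorem IsNested.existsUnique_adjoint_incl (h : IsNested Dc Df par) (hd : 2 ≤ d) (h₁ : 0 < κ₁)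
    (h₂ : 0 < κ₂) (hB : 0 ≤ B) (hα : 0 < αmin) (hDc : Dc.IsAdmissible κ₁ κ₂ B αmin αmax)
    (hPf : Df.IsMesh) :
    ∃! P : Df.V →ₗ[ℝ] Dc.V, ∀ v w, Dc.form (P v) w = Df.form v (h.incl w) :=
  have := finiteDimensional_V hDc.isMesh
  existsUnique_adjoint (bilin hPf) (bilin hDc.isMesh)
    (fun _ => hDc.form_pos hd h₁ h₂ hB hα) h.incl

theorem IsNested.energyNorm_adjoint_le (h : IsNested Dc Df par) (hd : 2 ≤ d) (h₁ : 0 < κ₁)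
    (h₂ : 0 < κ₂) (hB : 0 ≤ B) (hα : 0 < αmin) (hcmp : IsComparable Dc Df κ₂ c)
    (hDc : Dc.IsAdmissible κ₁ κ₂ B αmin αmax) (hDf : Df.IsAdmissible κ₁ κ₂ B αmin αmax)
    {P : Df.V →ₗ[ℝ] Dc.V} (hP : ∀ v w, Dc.form (P v) w = Df.form v (h.incl w)) (v : Df.V) :
    Dc.energyNorm (P v) ≤ stabConst d Dc.shape κ₁ κ₂ B αmin αmax c * Df.energyNorm v :=
  sqrt_adjoint_le (a := bilin hDf.isMesh) (b := bilin hDc.isMesh)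
    (form_self_nonneg hd h₁ h₂ hB hDf.toIsRegular hα hDf.le_α hDf.θ_eq) (form_comm hDf.isMesh)
    (form_self_nonneg hd h₁ h₂ hB hDc.toIsRegular hα hDc.le_α hDc.θ_eq)
    (stabConst_pos h₁ h₂ hB hα).le (h.energyNorm_incl_le hd h₁ h₂ hB hα hcmp hDc hDf) hP v

end Level

/-! ### The hierarchy of meshes -/

section Hierarchy

variable {d : ℕ} {s : Shape} {Ω : Set (E d)} {𝒯 : Finset (Cell d)} {m : Method}
  {κ κ' κ₁ κ₂ B : ℝ}

theorem IsShapeRegular.mono (h : IsShapeRegular s κ 𝒯) (hκ : κ ≤ κ') :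
    IsShapeRegular s κ' 𝒯 := fun T hT => by
  obtain ⟨x, r, hr, hb, hle⟩ := h T hT
  exact ⟨x, r, hr, hb, hle.trans (mul_le_mul_of_nonneg_right hκ hr.le)⟩

theorem IsQuasiUniform.mono (h : IsQuasiUniform s κ 𝒯) (hκ : κ ≤ κ') :
    IsQuasiUniform s κ' 𝒯 := fun T hT T' hT' =>
  (h T hT T' hT').trans (mul_le_mul_of_nonneg_right hκ Metric.diam_nonneg)

theorem isShapeRegular_and_isQuasiUniform_of_isRefinement {K : ℕ} (hd : d = 2 ∨ d = 3)
    {𝒯 : ℕ → Finset (Cell d)} (href : ∀ k, 2 ≤ k → k ≤ K → IsRefinement s (𝒯 (k - 1)) (𝒯 k))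
    (hreg : IsShapeRegular s κ₁ (𝒯 K)) (hqu : IsQuasiUniform s κ₂ (𝒯 K)) {k : ℕ} (hk : 1 ≤ k)
    (hkK : k ≤ K) : IsShapeRegular s κ₁ (𝒯 k) ∧ IsQuasiUniform s κ₂ (𝒯 k) := by
  induction hkK using Nat.decreasingInduction with
  | self => exact ⟨hreg, hqu⟩
  | of_succ j hj ih =>
    have hr := href (j + 1) (by omega) hj
    rw [Nat.add_sub_cancel] at hr
    obtain ⟨h₁, h₂⟩ := ih (by omega)
    exact ⟨hr.isShapeRegular hd h₁, hr.isQuasiUniform hd h₂⟩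

theorem Method.IsBeta.norm_le {β : Face d → E d} (hβ : m.IsBeta B s 𝒯 β)
    (hP : IsPartition s Ω 𝒯) {f : Face d} (hf : f ∈ interiorFaces s 𝒯) : ‖β f‖ ≤ |B| + 1 := by
  have hB := abs_nonneg B
  cases m with
  | sipg => rw [hβ f hf, norm_zero]; positivity
  | sipgDelta =>
    obtain ⟨T, hT, δ, h0, h1, he⟩ := hβ f hf
    rw [he, norm_smul, (isFacet_normal hP (mem_faces_of_mem_interiorFaces hf) hT).norm, mul_one,
      Real.norm_eq_abs]
    have : |δ - 1 / 2| ≤ 1 := abs_le.2 ⟨by linarith, by linarith⟩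
    linarith
  | ldg => linarith [hβ f hf, le_abs_self B]

theorem Method.θ_eq_zero_and_or_eq_one {q : Prop} (h : m ≠ .ldg → q) : m.θ = 0 ∧ q ∨ m.θ = 1 := by
  cases m
  exacts [Or.inl ⟨rfl, h (by simp)⟩, Or.inl ⟨rfl, h (by simp)⟩, Or.inr rfl]

theorem Level.isAdmissible {p : ℕ} {α αmin αmax : ℝ} {β : Face d → E d} (hP : IsPartition s Ω 𝒯)
    (hreg : IsShapeRegular s κ₁ 𝒯) (hqu : IsQuasiUniform s κ₂ 𝒯) (hp : 1 ≤ p)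
    (hα : αmin ≤ α ∧ α ≤ αmax) (hβ : m.IsBeta B s 𝒯 β)
    (hα₀ : m ≠ .ldg → 4 * liftConst d s κ₁ κ₂ (|B| + 1) ≤ αmin) :
    IsAdmissible (⟨s, 𝒯, p, α, m.θ, β⟩ : Level d Ω) κ₁ κ₂ (|B| + 1) αmin αmax where
  isMesh := hP
  shapeRegular := hreg
  quasiUniform := hqu
  one_le_degree := hp
  norm_β_le _ := hβ.norm_le hP
  le_α := hα.1
  α_le := hα.2
  θ_eq := m.θ_eq_zero_and_or_eq_one hα₀

end Hierarchy

end HPDG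

end

open HPDG in
theorem lemma4p4 (d : ℕ) (hd : d = 2 ∨ d = 3) (s : Shape) (m : Method) (κ₁ κ₂ : ℝ) (B : ℝ) :
    ∃ α₀ : ℝ, 0 < α₀ ∧ ∀ αmin αmax c : ℝ, 0 < αmin → (m ≠ Method.ldg → α₀ ≤ αmin) →
      ∃ Cstab : ℝ, 0 < Cstab ∧
        ∀ (Ω : Set (E d)) (K : ℕ) (𝒯 : ℕ → Finset (Cell d)) (p : ℕ → ℕ) (α : ℕ → ℝ)
          (β : ℕ → Face d → E d) (D : ℕ → Level d Ω),
          (∀ k, D k = ⟨s, 𝒯 k, p k, α k, m.θ, β k⟩) →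
          (∀ k, 1 ≤ k → k ≤ K → IsPartition s Ω (𝒯 k)) →
          (∀ k, 2 ≤ k → k ≤ K → IsRefinement s (𝒯 (k - 1)) (𝒯 k)) →
          IsShapeRegular s κ₁ (𝒯 K) →
          IsQuasiUniform s κ₂ (𝒯 K) →
          (∀ k, 1 ≤ k → k ≤ K → 1 ≤ p k) →
          (∀ k, 2 ≤ k → k ≤ K → p (k - 1) ≤ p k ∧ (p k : ℝ) ≤ c * p (k - 1)) →
          (∀ k, 1 ≤ k → k ≤ K → αmin ≤ α k ∧ α k ≤ αmax) →
          (∀ k, 1 ≤ k → k ≤ K → m.IsBeta B s (𝒯 k) (β k)) →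
          (∀ k, 1 ≤ k → k ≤ K → ∀ v : (D k).V, v ≠ 0 → 0 < (D k).form v v) ∧
          ∀ k, 2 ≤ k → k ≤ K →
            ∃ hV : (D (k - 1)).V ≤ (D k).V,
              (∀ v : (D (k - 1)).V,
                (D k).energyNorm (Submodule.inclusion hV v) ≤
                  Cstab * (D (k - 1)).energyNorm v) ∧
              (∃! P : (D k).V →ₗ[ℝ] (D (k - 1)).V,
                ∀ (v : (D k).V) (w : (D (k - 1)).V),
                  (D (k - 1)).form (P v) w = (D k).form v (Submodule.inclusion hV w)) ∧
              ∀ P : (D k).V →ₗ[ℝ] (D (k - 1)).V,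
                (∀ (v : (D k).V) (w : (D (k - 1)).V),
                  (D (k - 1)).form (P v) w = (D k).form v (Submodule.inclusion hV w)) →
                ∀ v : (D k).V,
                  (D (k - 1)).energyNorm (P v) ≤ Cstab * (D k).energyNorm v := by
  have hd2 : 2 ≤ d := by omega
  obtain ⟨h₁, h₂, hB⟩ : 0 < max κ₁ 1 ∧ 0 < max κ₂ 1 ∧ 0 ≤ |B| + 1 :=
    ⟨lt_max_of_lt_right one_pos, lt_max_of_lt_right one_pos, by positivity⟩
  refine ⟨4 * liftConst d s (max κ₁ 1) (max κ₂ 1) (|B| + 1),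
    mul_pos four_pos (liftConst_pos h₁ h₂ hB), fun αmin αmax c hα hα₀ =>
    ⟨Level.stabConst d s (max κ₁ 1) (max κ₂ 1) (|B| + 1) αmin αmax c,
      Level.stabConst_pos h₁ h₂ hB hα, ?_⟩⟩
  intro Ω K 𝒯 p α β D hD hpart href hreg hqu hp hpp hαk hβ
  obtain rfl : D = fun k => ⟨s, 𝒯 k, p k, α k, m.θ, β k⟩ := funext hD
  have admissible : ∀ k, 1 ≤ k → k ≤ K → Level.IsAdmissible
      (⟨s, 𝒯 k, p k, α k, m.θ, β k⟩ : Level d Ω) (max κ₁ 1) (max κ₂ 1) (|B| + 1) αmin αmax :=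
    fun k hk hkK =>
      have h := isShapeRegular_and_isQuasiUniform_of_isRefinement hd href hreg hqu hk hkK
      Level.isAdmissible (hpart k hk hkK) (h.1.mono (le_max_left κ₁ 1))
        (h.2.mono (le_max_left κ₂ 1)) (hp k hk hkK) (hαk k hk hkK) (hβ k hk hkK) hα₀
  refine ⟨fun k hk hkK v => (admissible k hk hkK).form_pos hd2 h₁ h₂ hB hα, fun k hk hkK => ?_⟩
  have hc := admissible (k - 1) (by omega) (by omega)
  have hf := admissible k (by omega) hkK
  obtain ⟨par, nested⟩ := Level.exists_isNested (Dc := ⟨s, 𝒯 (k - 1), p (k - 1), α (k - 1), m.θ,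
    β (k - 1)⟩) (Df := ⟨s, 𝒯 k, p k, α k, m.θ, β k⟩) hd rfl (href k hk hkK) (hpp k hk hkK).1
  have hcmp := Level.isComparable_of_isRefinement hd nested.shape_eq (href k hk hkK)
    hf.quasiUniform (hpp k hk hkK).2
  exact ⟨nested.V_le, nested.energyNorm_incl_le hd2 h₁ h₂ hB hα hcmp hc hf,
    nested.existsUnique_adjoint_incl hd2 h₁ h₂ hB hα hc hf.isMesh,
    fun P hP => nested.energyNorm_adjoint_le hd2 h₁ h₂ hB hα hcmp hc hf hP⟩
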